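/- Let $n\ge 0$. For a prime power $r$ let $\mathcal F_r$ be the set of complete flags in $\mathbb F_r^n$, and let $E_r$ be the $\mathbb C$-algebra of all functions $\mathcal F_r\times\mathcal F_r\times\mathbb F_r^n\to\mathbb C$ with the convolution product $$(\alpha*\beta)(F,F',v)=\sum_{H\in\mathcal F_r,\;u\in\mathbb F_r^n}\alpha(F,H,u)\,\beta(H,F',v-u).$$ For $w\in S_n$ and $\beta\subseteq\{1,\dots,n\}$ let $T_{w,\beta}$ be the characteristic function of the $GL_n(\mathbb F_r)$-orbit of those triples $(F,F',v)$ for which there is a basis $b_1,\dots,b_n$ of $\mathbb F_r^n$ with $F_i=\langle b_1,\dots,b_i\rangle$ and $F'_j=\langle b_{w(1)},\dots,b_{w(j)}\rangle$ for all $i,j$, and $v=\sum_{i\in\beta}b_i$. The structure constants of the products of the orbit functions are polynomials in $r$; let $R_n$ be the $\mathbb C[\mathbf q,\mathbf q^{-1}]$-algebra with these structure constants, that is, the $\mathbb C[\mathbf q,\mathbf q^{-1}]$-subalgebra generated by the families $T_{w,\beta}$ in the product of the algebras $E_r$ over all prime powers $r$, where $\mathbf q$ acts on $E_r$ as the scalar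 $r$. The generic mirabolic Hecke algebra is $\mathcal R_n=R_n\otimes_{\mathbb C[\mathbf q,\mathbf q^{-1}]}\mathbb C(\mathbf q)$, and for $q\in\mathbb C^\times$ the specialization is $\mathcal R_n(q)=R_n/(\mathbf q-q)$. Put $T_i=T_{s_i,\emptyset}$ for $1\le i\le n-1$, where $s_i=(i\ \,i+1)$; for $n\ge 1$ put $T_0=T_{1,\{1\}}$, $e=\mathbf q^{-1}(T_0+1)$, and for $1\le i\le n$ let $$L_i=\mathbf q^{1-i}\,T_{i-1}\cdots T_1\,e\,T_1\cdots T_{i-1}$$ be the Jucys–Murphy elements. **Theorem.** In $\mathcal R_n$ the elements $L_1,\dots,L_n$ commute with each other, and the center is the set of values of symmetric polynomials at them: $$Z(\mathcal R_n)=\{\,p(L_1,\dots,L_n) : p\in\mathbb C(\mathbf q)[x_1,\dots,x_n]^{S_n}\,\}.$$ The same holds for every semisimple specialization: if $q\in\mathbb C^\times$, $\mathcal R_n(q)$ is semisimple, and $q\ne 1$ or $n\le 1$, then the images of $L_1,\dots,L_n$ in $\mathcal R_n(q)$ commute with each other and $$Z(\mathcal R_n(q))=\{\,p(L_1,\dots,L_n)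 : p\in\mathbb C[x_1,\dots,x_n]^{S_n}\,\}.$$ -/

import Mathlib

open scoped LaurentPolynomial TensorProduct

noncomputable section

namespace Mirabolic

/-! ### Complete flags and convolution over a finite field -/

/-- A complete flag `0 = F_0 ⊂ F_1 ⊂ ⋯ ⊂ F_n = 𝔽^n`. -/
@[ext]
structure CompleteFlag (n : ℕ) (F : Type) [Field F] where
  space : Fin (n + 1) → Submodule F (Fin n → F)
  mono : Monotone space
  finrank_space : ∀ i, Module.finrank F (space i) = i

instance (n : ℕ) (F : Type) [Field F] [Finite F] : Finite (CompleteFlag n F) :=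
  Finite.of_injective (fun X : CompleteFlag n F => X.space) fun _ _ h => CompleteFlag.ext h

instance (n : ℕ) (F : Type) [Field F] [Finite F] : Fintype (CompleteFlag n F) :=
  Fintype.ofFinite _

/-- Complex valued functions of two complete flags and a vector. -/
def FlagFun (n : ℕ) (F : Type) [Field F] : Type :=
  CompleteFlag n F → CompleteFlag n F → (Fin n → F) → ℂ

namespace FlagFun

variable {n : ℕ} {F : Type} [Field F]

instance : AddCommGroup (FlagFun n F) :=
  inferInstanceAs (AddCommGroup (CompleteFlag n F → CompleteFlag n F → (Fin n → F) → ℂ))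

instance : Module ℂ (FlagFun n F) :=
  inferInstanceAs (Module ℂ (CompleteFlag n F → CompleteFlag n F → (Fin n → F) → ℂ))

@[ext]
theorem ext {α β : FlagFun n F} (h : ∀ X Y v, α X Y v = β X Y v) : α = β :=
  funext fun X => funext fun Y => funext fun v => h X Y v

@[simp] theorem add_apply (α β : FlagFun n F) (X Y : CompleteFlag n F) (v : Fin n → F) :
    (α + β) X Y v = α X Y v + β X Y v := rfl

@[simp] theorem zero_apply (X Y : CompleteFlag n F) (v : Fin n → F) :
    (0 : FlagFun n F) X Y v = 0 := rfl

@[simp] theorem smul_apply (c : ℂ) (α : FlagFun n F) (X Y : CompleteFlag n F) (v : Fin n → F) :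
    (c • α) X Y v = c * α X Y v := rfl

open Classical in
/-- The characteristic function of the diagonal orbit `X = Y`, `v = 0`. -/
instance : One (FlagFun n F) where
  one := fun X Y v => if X = Y ∧ v = 0 then 1 else 0

open Classical in
theorem one_apply (X Y : CompleteFlag n F) (v : Fin n → F) :
    (1 : FlagFun n F) X Y v = if X = Y ∧ v = 0 then 1 else 0 := rfl

variable [Fintype F]

/-- The convolution product
`(α * β)(X, Y, v) = ∑_{H, u} α(X, H, u) β(H, Y, v - u)`. -/
instance : Mul (FlagFun n F) where
  mul := by
    classical
    exact fun α β X Y v => ∑ H : CompleteFlag n F, ∑ u : Fin n → F, α X H u * β H Y (v - u)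

theorem mul_apply [DecidableEq F] (α β : FlagFun n F) (X Y : CompleteFlag n F) (v : Fin n → F) :
    (α * β) X Y v = ∑ H : CompleteFlag n F, ∑ u : Fin n → F, α X H u * β H Y (v - u) := by
  change (∑ H : CompleteFlag n F, @Finset.sum _ _ _ (@Finset.univ _ _) _) = _
  congr!

instance : Ring (FlagFun n F) :=
  { (inferInstance : AddCommGroup (FlagFun n F)),
    (inferInstance : Mul (FlagFun n F)),
    (inferInstance : One (FlagFun n F)) with
    left_distrib := fun a b c => by
      classical
      ext X Y v
      simp [mul_apply, mul_add, Finset.sum_add_distrib]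
    right_distrib := fun a b c => by
      classical
      ext X Y v
      simp [mul_apply, add_mul, Finset.sum_add_distrib]
    zero_mul := fun a => by
      classical
      ext X Y v
      simp [mul_apply]
    mul_zero := fun a => by
      classical
      ext X Y v
      simp [mul_apply]
    mul_assoc := fun a b c => by
      classical
      ext X Y v
      simp only [mul_apply, Finset.sum_mul, Finset.mul_sum]
      calc
        _ = ∑ H, ∑ K, ∑ w, ∑ u, a X K w * b K H (u - w) * c H Y (v - u) := by
          refine Finset.sum_congr rfl fun H _ => ?_
          rw [Finset.sum_comm]
          exact Finset.sum_congr rfl fun K _ => Finset.sum_comm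
        _ = ∑ H, ∑ K, ∑ w, ∑ u, a X K w * (b K H u * c H Y (v - w - u)) := by
          refine Finset.sum_congr rfl fun H _ => Finset.sum_congr rfl fun K _ =>
            Finset.sum_congr rfl fun w _ => ?_
          refine Fintype.sum_equiv (Equiv.subRight w) _ _ fun u => ?_
          simp [mul_assoc]
        _ = _ := by
          rw [Finset.sum_comm]
          refine Finset.sum_congr rfl fun K _ => ?_
          rw [Finset.sum_comm]
    one_mul := fun a => by
      classical
      ext X Y v
      rw [mul_apply, Finset.sum_eq_single X, Finset.sum_eq_single 0]
      · simp [one_apply]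
      · intro u _ hu
        simp [one_apply, hu]
      · simp
      · intro H _ hH
        simp [one_apply, hH.symm]
      · simp
    mul_one := fun a => by
      classical
      ext X Y v
      rw [mul_apply, Finset.sum_eq_single Y, Finset.sum_eq_single v]
      · simp [one_apply]
      · intro u _ hu
        simp [one_apply, sub_eq_zero, hu.symm]
      · simp
      · intro H _ hH
        simp [one_apply, hH]
      · simp }

instance : Algebra ℂ (FlagFun n F) :=
  Algebra.ofModule
    (fun c a b => by
      classical
      ext X Y v
      simp [mul_apply, Finset.mul_sum, mul_assoc])
    (fun c a b => by
      classical
      ext X Y v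
      simp [mul_apply, Finset.mul_sum, mul_left_comm])

end FlagFun

/-- The `GL_n`-orbit of triples with index `(w, β)`: for some basis `b` of `𝔽^n` one has
`X_i = ⟨b_1, …, b_i⟩`, `Y_j = ⟨b_{w(1)}, …, b_{w(j)}⟩` and `v = ∑_{i ∈ β} b_i`.
Every orbit is of this form; different indices may give the same orbit. -/
def InOrbit {n : ℕ} {F : Type} [Field F] (w : Equiv.Perm (Fin n)) (β : Finset (Fin n))
    (X Y : CompleteFlag n F) (v : Fin n → F) : Prop :=
  ∃ b : Module.Basis (Fin n) F (Fin n → F),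
    (∀ i : Fin (n + 1), X.space i = Submodule.span F (b '' {k | k.val < i.val})) ∧
    (∀ j : Fin (n + 1), Y.space j = Submodule.span F ((fun k => b (w k)) '' {k | k.val < j.val})) ∧
    v = ∑ i ∈ β, b i

/-- The characteristic function of an orbit. -/
def orbitFun {n : ℕ} (F : Type) [Field F] (w : Equiv.Perm (Fin n)) (β : Finset (Fin n)) :
    FlagFun n F := by
  classical
  exact fun X Y v => if InOrbit w β X Y v then 1 else 0

/-! ### The mirabolic Hecke algebra over `ℂ[q, q⁻¹]` -/

/-- The evaluation `ℂ[q, q⁻¹] → ℂ` at a nonzero complex number. -/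
def evalAt (q : ℂˣ) : ℂ[T;T⁻¹] →+* ℂ :=
  LaurentPolynomial.eval₂ (RingHom.id ℂ) q

/-- Prime powers `p ^ k` with `k ≥ 1`. -/
structure PrimePower where
  p : ℕ
  k : ℕ
  prime : p.Prime
  pos : 0 < k

namespace PrimePower

instance (r : PrimePower) : Fact r.p.Prime := ⟨r.prime⟩

/-- The field with `p ^ k` elements. -/
abbrev field (r : PrimePower) : Type := GaloisField r.p r.k

instance (r : PrimePower) : Fintype r.field := Fintype.ofFinite _

/-- The number `p ^ k` as a nonzero complex number. -/
def card (r : PrimePower) : ℂˣ :=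
  Units.mk0 ((r.p : ℂ) ^ r.k) (pow_ne_zero _ (Nat.cast_ne_zero.mpr r.prime.ne_zero))

end PrimePower

/-- The convolution algebra over the field with `r` elements. -/
def ConvAlg (n : ℕ) (r : PrimePower) : Type := FlagFun n r.field

instance (n : ℕ) (r : PrimePower) : Ring (ConvAlg n r) :=
  inferInstanceAs (Ring (FlagFun n r.field))

/-- `ConvAlg n r` is a `ℂ[q, q⁻¹]`-algebra, the indeterminate acting as the number `r`. -/
instance (n : ℕ) (r : PrimePower) : Algebra ℂ[T;T⁻¹] (ConvAlg n r) :=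
  ((algebraMap ℂ (FlagFun n r.field)).comp (evalAt r.card)).toAlgebra'
    fun c x => Algebra.commutes (evalAt r.card c) (x : FlagFun n r.field)

/-- The family, over all prime powers, of the characteristic functions of the orbits with
index `(w, β)`. -/
def orbitFamily {n : ℕ} (w : Equiv.Perm (Fin n)) (β : Finset (Fin n)) :
    ∀ r : PrimePower, ConvAlg n r :=
  fun r => orbitFun r.field w β

/-- The mirabolic Hecke algebra `R_n` over `ℂ[q, q⁻¹]`. Convolution products of characteristic
functions of orbits have structure constants that are polynomials in the cardinality of the
field, and `R_n` is the algebra with these polynomials as structure constants.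
Since a Laurent polynomial is determined by its values at all prime powers, this is the
`ℂ[q, q⁻¹]`-algebra generated by the families `T_{w, β}` inside the product of all
convolution algebras. -/
def integralAlgebra (n : ℕ) : Subalgebra ℂ[T;T⁻¹] (∀ r : PrimePower, ConvAlg n r) :=
  Algebra.adjoin ℂ[T;T⁻¹] {x | ∃ w β, x = orbitFamily w β}

abbrev R (n : ℕ) : Type := integralAlgebra n

/-- The basis element `T_{w, β}`. -/
def orbitElt {n : ℕ} (w : Equiv.Perm (Fin n)) (β : Finset (Fin n)) : R n :=
  ⟨orbitFamily w β, Algebra.subset_adjoin ⟨w, β, rfl⟩⟩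

/-- The adjacent transposition exchanging the `i`-th and `(i+1)`-st of `n` points, counted from
`1`, for `1 ≤ i < n` (the identity for other `i`). -/
def adjSwap (n i : ℕ) : Equiv.Perm (Fin n) :=
  if h : 1 ≤ i ∧ i < n then Equiv.swap ⟨i - 1, by omega⟩ ⟨i, h.2⟩ else 1

/-- The generator `T_i = T_{s_i, ∅}`, for `1 ≤ i < n`. -/
def heckeGen (n i : ℕ) : R n := orbitElt (adjSwap n i) ∅

/-- `T_0 = T_{1, {1}}`: the orbit of triples `(X, X, v)` with `0 ≠ v ∈ X_1`. -/
def heckeZero (n : ℕ) : R n := orbitElt 1 {i | i.val = 0}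

/-- The idempotent `e = q⁻¹ (T_0 + 1)`. -/
def idem (n : ℕ) : R n := (LaurentPolynomial.T (-1) : ℂ[T;T⁻¹]) • (heckeZero n + 1)

/-- The Jucys-Murphy element `L_i = q^{1-i} T_{i-1} ⋯ T_1 e T_1 ⋯ T_{i-1}`, for `1 ≤ i ≤ n`. -/
def jucysMurphy (n i : ℕ) : R n :=
  (LaurentPolynomial.T (1 - (i : ℤ)) : ℂ[T;T⁻¹]) •
    (((List.range' 1 (i - 1)).reverse.map (heckeGen n)).prod * idem n *
      ((List.range' 1 (i - 1)).map (heckeGen n)).prod)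

/-! ### Generic algebra and specializations -/

/-- The field `ℂ(q)`. -/
abbrev GenericField : Type := FractionRing ℂ[T;T⁻¹]

/-- The field `ℂ`, regarded as a `ℂ[q, q⁻¹]`-algebra by sending the indeterminate to `q`. -/
def SpecField (_q : ℂˣ) : Type := ℂ

instance (q : ℂˣ) : Field (SpecField q) := inferInstanceAs (Field ℂ)

instance (q : ℂˣ) : Algebra ℂ[T;T⁻¹] (SpecField q) :=
  RingHom.toAlgebra (S := SpecField q) (evalAt q)

/-- The algebra `R_n` with scalars extended to `K`: for `K = GenericField` the generic mirabolic
Hecke algebra, for `K = SpecField q` the specialization `R_n / (𝐪 - q)` at `q`. -/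
abbrev BaseChange (K : Type) [Field K] [Algebra ℂ[T;T⁻¹] K] (n : ℕ) : Type :=
  K ⊗[ℂ[T;T⁻¹]] R n

/-- The elements `L_1, …, L_n` in the algebra over `K`, indexed by `Fin n`. -/
def jm (K : Type) [Field K] [Algebra ℂ[T;T⁻¹] K] (n : ℕ) (i : Fin n) : BaseChange K n :=
  1 ⊗ₜ[ℂ[T;T⁻¹]] jucysMurphy n (i.val + 1)

/-- The value of a polynomial at a tuple of elements of a possibly noncommutative algebra,
each monomial being multiplied out in the order of the variables. -/
def evalTuple {K A : Type} [Field K] [Ring A] [Algebra K A] {n : ℕ} (x : Fin n → A)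
    (p : MvPolynomial (Fin n) K) : A :=
  p.support.sum fun m => p.coeff m • (List.ofFn fun i => x i ^ m i).prod

/-- The elements `L_i` commute, and the center of the algebra over `K` is the set of values
`p(L_1, …, L_n)` of symmetric polynomials `p` with coefficients in `K`. -/
def CenterIsSymmetricInJM (K : Type) [Field K] [Algebra ℂ[T;T⁻¹] K] (n : ℕ) : Prop :=
  (∀ i j, Commute (jm K n i) (jm K n j)) ∧
    (Subalgebra.center K (BaseChange K n) : Set (BaseChange K n)) =
      {z | ∃ p : MvPolynomial (Fin n) K, p.IsSymmetric ∧ z = evalTuple (jm K n) p}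

end Mirabolic

end

/-!
The algebra `R n` is generated by `e = idem n` and the Hecke generators `T_i`
(`adjoin_integral`), and these satisfy the relations collected in `MirabolicSystem`: the Hecke
relations, the relations of type `B` between `e` and the `T_i`, and one relation of degree two in
`T_1` that makes `-1` the eigenvalue of `T_1` on common null vectors of `L_1` and `L_2`.
Over a field in which `q ^ i ≠ 1` for `1 ≤ i ≤ n` these relations alone determine the
center when `2 ≤ n`, and the proof has three parts. For `n ≤ 1` every polynomial is symmetric and
the algebra is spanned by `1` and `e`.

*The center of a mirabolic system.* In the style of Okounkov and Vershik, the joint eigenvalues of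
`L_1, …, L_n` are described by words whose letters are blanks (eigenvalue `0`) or contents
`c` (eigenvalue `q ^ c`). The intertwiners `T_i + c` exchange the eigenvalues of `L_i` and
`L_{i+1}`, and the braid relation excludes the patterns `c, c ± 1, c`. By induction on the length,
every word that occurs has only prefixes in which the multiplicities of the contents are the
diagonal lengths of a Young diagram (`IsProfile`), and all `L_i` are diagonalizable
(`MirabolicSystem.isControlled`); two such words with the same letters are connected by swaps of
independent letters (`exists_linked_of_letterCount_eq`). Every weight projection `ε` satisfies
`ε A ε = K ε`, so a central element acts on each weight by a scalar,
which depends only on the multiset of the eigenvalues; Lagrange interpolation in several variables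
then produces a symmetric polynomial with these values (`MirabolicSystem.center_eq`).
Conversely `ε' T_i ε = 0` unless the two weights are equal or differ by the swap of the
entries `i` and `i + 1`, so that symmetric polynomials in the `L_i` are central.

*The relations and the generation.* Let `f_{w,I}` be the characteristic function of the triples
`(X, Y, v)` for which the flags are in relative position `w` and `v` lies in the span of the
vectors with index in `I` of a basis adapted to both flags. If `w` has a left descent `i` which is
compatible with `I`, then `T_i f_{s_i w, s_i I} = f_{w, I}` (`hecke_mul_subFun`), and likewise on
the right. If no descent is compatible with `I`, then `w = 1` and `I` is an initial segment, and
the function is obtained from `e` and the `T_i` by the identity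
`E_k T_k E_k = T_k E_{k+1}` for the averages `E_k` over the spaces of a flag. Inclusion and
exclusion over the maximal elements of `I` gives the orbit functions (`integralAlgebra_le`).

*Semisimple specializations.* The constant functions `1` form an element `J` of `R n`
that spans a left ideal after extension of scalars, and `J ^ 2 = q ^ n (∑ q ^ ℓ(w)) J`, where the
sum over the symmetric group is the product of the `q`-integers from `1` to `n`. If `q ≠ 1` is a
root of unity of order at most `n`, then `J ^ 2 = 0`. The image of `J` never vanishes, since a
linear functional on `R n` takes it to a unit (`exists_functional`), so the algebra is not
semisimple in this case.
-/

noncomputable section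

namespace Mirabolic

/-! ### The algebra generated by the Hecke generators and the idempotent -/

/-- Generators `e, T_0, …, T_{n-2}` of a `K`-algebra `A` subject to the relations of the mirabolic
Hecke algebra at the parameter `q`: the Hecke relations for the `T_i`, the type `B` relations for
the idempotent `e`, and the relation `rook`, which cuts the algebra down from
the Hecke algebra of type `B` to the mirabolic one. Indices are counted from `0`, so that `T_i`
here is the generator `T_{i+1}` of the flag algebra. -/
structure MirabolicSystem (K A : Type) [Field K] [Ring A] [Algebra K A] (n : ℕ) where
  q : K
  T : ℕ → A
  e : A
  q_ne_zero : q ≠ 0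
  quad : ∀ i, i + 1 < n → T i * T i = (q - 1) • T i + q • 1
  braid : ∀ i, i + 2 < n → T i * T (i + 1) * T i = T (i + 1) * T i * T (i + 1)
  comm : ∀ i j, i + 1 < j → j + 1 < n → T i * T j = T j * T i
  idem : e * e = e
  comm_e : ∀ i, 0 < i → i + 1 < n → e * T i = T i * e
  typeB : 1 < n → e * T 0 * e * T 0 = T 0 * e * T 0 * e
  rook : 1 < n → (T 0 + 1) * (e * T 0 - 1) * (1 - e) = 0
  gen : Algebra.adjoin K ({x | x = e ∧ 0 < n} ∪ {x | ∃ i, i + 1 < n ∧ x = T i}) = ⊤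

namespace MirabolicSystem

variable {K A : Type} [Field K] [Ring A] [Algebra K A] {n : ℕ} (D : MirabolicSystem K A n)

/-- The Jucys-Murphy elements, counted from `0`. -/
def L : ℕ → A
  | 0 => D.e
  | i + 1 => D.q⁻¹ • (D.T i * L i * D.T i)

theorem L_zero : D.L 0 = D.e := rfl

theorem L_succ (i : ℕ) : D.L (i + 1) = D.q⁻¹ • (D.T i * D.L i * D.T i) := rfl

theorem T_mul_sub {i : ℕ} (hi : i + 1 < n) : D.T i * (D.T i - (D.q - 1) • 1) = D.q • 1 := by
  rw [mul_sub, D.quad i hi, mul_smul_comm, mul_one]; abel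

theorem sub_mul_T {i : ℕ} (hi : i + 1 < n) : (D.T i - (D.q - 1) • 1) * D.T i = D.q • 1 := by
  rw [sub_mul, D.quad i hi, smul_mul_assoc, one_mul]; abel

theorem T_mul_cancel {i : ℕ} (hi : i + 1 < n) {x y : A} (h : D.T i * x = D.T i * y) : x = y := by
  have h2 := congrArg (fun z => (D.T i - (D.q - 1) • 1) * z) h
  simp only [← mul_assoc, D.sub_mul_T hi, smul_mul_assoc, one_mul] at h2
  exact smul_right_injective A D.q_ne_zero h2

theorem T_mul_eq_zero {i : ℕ} (hi : i + 1 < n) {x : A} (h : D.T i * x = 0) : x = 0 :=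
  D.T_mul_cancel hi (by rw [h, mul_zero])

theorem sub_mul_eq_zero {i : ℕ} (hi : i + 1 < n) {x : A}
    (h : (D.T i - (D.q - 1) • 1) * x = 0) : x = 0 := by
  have h2 := congrArg (fun z => D.T i * z) h
  simp only [← mul_assoc, D.T_mul_sub hi, smul_mul_assoc, one_mul, mul_zero] at h2
  exact (smul_eq_zero.mp h2).resolve_left D.q_ne_zero

theorem L_mul_T {i : ℕ} (hi : i + 1 < n) :
    D.L i * D.T i = (D.T i - (D.q - 1) • 1) * D.L (i + 1) := by
  rw [L_succ, mul_smul_comm, mul_assoc (D.T i), ← mul_assoc _ (D.T i), D.sub_mul_T hi,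
    smul_mul_assoc, one_mul, smul_smul, inv_mul_cancel₀ D.q_ne_zero, one_smul]

theorem T_mul_L {i : ℕ} (hi : i + 1 < n) :
    D.T i * D.L i = D.L (i + 1) * (D.T i - (D.q - 1) • 1) := by
  rw [L_succ, smul_mul_assoc, mul_assoc (D.T i * D.L i), D.T_mul_sub hi,
    mul_smul_comm, mul_one, smul_smul, inv_mul_cancel₀ D.q_ne_zero, one_smul]

theorem L_succ_mul_T {i : ℕ} (hi : i + 1 < n) :
    D.L (i + 1) * D.T i = D.T i * D.L i + (D.q - 1) • D.L (i + 1) := by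
  rw [D.T_mul_L hi, mul_sub, mul_smul_comm, mul_one]; abel

theorem L_mul_T' {i : ℕ} (hi : i + 1 < n) :
    D.L i * D.T i = D.T i * D.L (i + 1) - (D.q - 1) • D.L (i + 1) := by
  rw [D.L_mul_T hi, sub_mul, smul_mul_assoc, one_mul]

theorem commute_T_T {i j : ℕ} (hij : i + 1 < j ∨ j + 1 < i) (hi : i + 1 < n) (hj : j + 1 < n) :
    Commute (D.T i) (D.T j) := by
  rcases hij with h | h
  · exact D.comm i j h hj
  · exact (D.comm j i h hi).symm

theorem commute_T_L_of_lt {i j : ℕ} (hij : i < j) (hj : j + 1 < n) :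
    Commute (D.T j) (D.L i) := by
  induction i with
  | zero => exact (D.comm_e j hij hj).symm
  | succ i ih =>
    have h1 := D.commute_T_T (i := j) (j := i) (Or.inr hij) hj (by omega)
    exact ((h1.mul_right (ih (by omega))).mul_right h1).smul_right _

theorem commute_T_L_of_gt {i j : ℕ} (hij : j + 1 < i) (hi : i < n) :
    Commute (D.T j) (D.L i) := by
  induction i with
  | zero => omega
  | succ i ih =>
    rcases Nat.lt_or_ge (j + 1) i with h | h
    · have h1 := D.commute_T_T (i := j) (j := i) (Or.inl h) (by omega) (by omega)
      exact ((h1.mul_right (ih h (by omega))).mul_right h1).smul_right _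
    · obtain rfl : i = j + 1 := by omega
      rw [L_succ, L_succ]
      refine Commute.smul_right ?_ _
      have hc := D.commute_T_L_of_lt (i := j) (j := j + 1) (by omega) hi
      have hb := D.braid j (by omega)
      rw [mul_smul_comm, smul_mul_assoc]
      refine Commute.smul_right ?_ _
      have e1 : D.T j * (D.T (j + 1) * (D.T j * D.L j * D.T j) * D.T (j + 1))
          = (D.T j * D.T (j + 1) * D.T j) * D.L j * (D.T j * D.T (j + 1)) := by noncomm_ring
      have e2 : (D.T (j + 1) * (D.T j * D.L j * D.T j) * D.T (j + 1)) * D.T j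
          = (D.T (j + 1) * D.T j) * D.L j * (D.T j * D.T (j + 1) * D.T j) := by noncomm_ring
      rw [Commute, SemiconjBy, e1, e2, hb]
      calc _ = (D.T (j + 1) * D.T j) * (D.T (j + 1) * D.L j) * (D.T j * D.T (j + 1)) := by
            noncomm_ring
        _ = _ := by rw [hc.eq]; noncomm_ring

theorem commute_e_L {i : ℕ} (hi : i < n) : Commute D.e (D.L i) := by
  induction i with
  | zero => exact Commute.refl _
  | succ i ih =>
    rcases Nat.eq_zero_or_pos i with rfl | h
    · rw [L_succ]
      refine Commute.smul_right ?_ _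
      have := D.typeB hi
      rw [Commute, SemiconjBy, L_zero]
      simpa only [mul_assoc] using this
    · have h1 : Commute D.e (D.T i) := D.comm_e i h hi
      exact ((h1.mul_right (ih (by omega))).mul_right h1).smul_right _

/-- The subalgebra generated by `e` and the first `m - 1` Hecke generators. -/
def level (m : ℕ) : Subalgebra K A :=
  Algebra.adjoin K ({x | x = D.e ∧ 0 < m} ∪ {x | ∃ i, i + 1 < m ∧ x = D.T i})

theorem level_top : D.level n = ⊤ := D.gen

theorem level_mono {m m' : ℕ} (h : m ≤ m') : D.level m ≤ D.level m' := by
  refine Algebra.adjoin_mono ?_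
  rintro x (⟨rfl, hx⟩ | ⟨i, hi, rfl⟩)
  · exact Or.inl ⟨rfl, by omega⟩
  · exact Or.inr ⟨i, by omega, rfl⟩

theorem e_mem_level {m : ℕ} (h : 0 < m) : D.e ∈ D.level m :=
  Algebra.subset_adjoin (Or.inl ⟨rfl, h⟩)

theorem T_mem_level {m i : ℕ} (h : i + 1 < m) : D.T i ∈ D.level m :=
  Algebra.subset_adjoin (Or.inr ⟨i, h, rfl⟩)

theorem L_mem_level {m i : ℕ} (h : i < m) : D.L i ∈ D.level m := by
  induction i with
  | zero => exact D.e_mem_level h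
  | succ i ih =>
    exact Subalgebra.smul_mem _ (mul_mem (mul_mem (D.T_mem_level h) (ih (by omega)))
      (D.T_mem_level h)) _

theorem commute_of_mem_level {m : ℕ} {y : A} (he : 0 < m → Commute D.e y)
    (hT : ∀ i, i + 1 < m → Commute (D.T i) y) {x : A} (hx : x ∈ D.level m) : Commute x y := by
  induction hx using Algebra.adjoin_induction with
  | mem x hx =>
    rcases hx with ⟨rfl, h⟩ | ⟨i, hi, rfl⟩
    · exact he h
    · exact hT i hi
  | algebraMap r => exact Algebra.commutes r y
  | add x z _ _ hx hz => exact hx.add_left hz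
  | mul x z _ _ hx hz => exact hx.mul_left hz

theorem commute_level_L {m : ℕ} (hm : m < n) {x : A} (hx : x ∈ D.level m) :
    Commute x (D.L m) :=
  D.commute_of_mem_level (fun _ => D.commute_e_L hm)
    (fun _ hi => D.commute_T_L_of_gt hi hm) hx

theorem commute_level_T {m i : ℕ} (hmi : m ≤ i) (hi : i + 1 < n) {x : A} (hx : x ∈ D.level m) :
    Commute x (D.T i) :=
  D.commute_of_mem_level (fun h => D.comm_e i (by omega) hi)
    (fun j hj => D.commute_T_T (Or.inl (by omega)) (by omega) hi) hx

theorem commute_L_L {i j : ℕ} (hi : i < n) (hj : j < n) : Commute (D.L i) (D.L j) := by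
  rcases Nat.lt_trichotomy i j with h | rfl | h
  · exact D.commute_level_L hj (D.L_mem_level h)
  · exact Commute.refl _
  · exact (D.commute_level_L hi (D.L_mem_level h)).symm

end MirabolicSystem

/-! ### Content words -/

/-- A function counting letters, a letter being a content `some c` or the blank `none`, is a
profile if its values at the contents are the lengths of the diagonals of a Young diagram: they
increase by at most `1` from one content to the next below `0` and decrease by at most `1`
above `0`. -/
def IsProfile (h : Option ℤ → ℕ) : Prop :=
  ∀ c : ℤ, (0 ≤ c → h (some (c + 1)) ≤ h (some c) ∧ h (some c) ≤ h (some (c + 1)) + 1) ∧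
    (c < 0 → h (some c) ≤ h (some (c + 1)) ∧ h (some (c + 1)) ≤ h (some c) + 1)

/-- The letter count `h` with one more letter `x`. -/
def addLetter (h : Option ℤ → ℕ) (x : Option ℤ) : Option ℤ → ℕ :=
  fun y => h y + if x = y then 1 else 0

/-- Two letters are independent if they are different and not adjacent contents. -/
def Indep (a b : Option ℤ) : Prop :=
  a ≠ b ∧ ∀ c d : ℤ, a = some c → b = some d → c + 1 ≠ d ∧ d + 1 ≠ c

theorem Indep.symm {a b : Option ℤ} (h : Indep a b) : Indep b a :=
  ⟨h.1.symm, fun c d hc hd => (h.2 d c hd hc).symm⟩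

theorem not_addable_succ {h : Option ℤ → ℕ} {c : ℤ} (h1 : IsProfile (addLetter h (some c)))
    (h2 : IsProfile (addLetter h (some (c + 1)))) : False := by
  have a1 := h1 c
  have a2 := h2 c
  simp only [addLetter, Option.some.injEq] at a1 a2
  split_ifs at a1 a2 <;> omega

theorem indep_of_addable {h : Option ℤ → ℕ} {a b : Option ℤ} (hab : a ≠ b)
    (h1 : IsProfile (addLetter h a)) (h2 : IsProfile (addLetter h b)) : Indep a b := by
  refine ⟨hab, ?_⟩
  rintro c d rfl rfl
  constructor
  · rintro rfl
    exact not_addable_succ h1 h2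
  · rintro rfl
    exact not_addable_succ h2 h1

/-- A condition on two adjacent contents sees at most one of two independent letters. -/
theorem IsProfile.of_indep {h : Option ℤ → ℕ} {a b : Option ℤ} (hab : Indep a b)
    (h0 : IsProfile h ∨ IsProfile (addLetter (addLetter h a) b)) (h1 : IsProfile (addLetter h a))
    (h2 : IsProfile (addLetter h b)) :
    IsProfile h ∧ IsProfile (addLetter (addLetter h a) b) := by
  rcases a with _ | a <;> rcases b with _ | b
  · exact absurd rfl hab.1
  all_goals
    try have hi := hab.2 _ _ rfl rfl
    try have hne : a ≠ b := fun e => hab.1 (by rw [e])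
    constructor <;> intro c <;> rcases h0 with h0 | h0 <;>
    · have a0 := h0 c
      have a1 := h1 c
      have a2 := h2 c
      simp only [addLetter, Option.some.injEq, reduceCtorEq, if_false] at a0 a1 a2 ⊢
      split_ifs at a0 a1 a2 ⊢ <;> omega

theorem IsProfile.exchange {h : Option ℤ → ℕ} {a b : Option ℤ} (hab : Indep a b)
    (h0 : IsProfile h) (h1 : IsProfile (addLetter h a))
    (h2 : IsProfile (addLetter (addLetter h a) b)) : IsProfile (addLetter h b) := by
  rcases a with _ | a <;> rcases b with _ | b
  · exact absurd rfl hab.1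
  all_goals
    try have hi := hab.2 _ _ rfl rfl
    try have hne : a ≠ b := fun e => hab.1 (by rw [e])
    intro c
    have a0 := h0 c
    have a1 := h1 c
    have a2 := h2 c
    simp only [addLetter, Option.some.injEq, reduceCtorEq, if_false] at a0 a1 a2 ⊢
    split_ifs at a0 a1 a2 ⊢ <;> omega

/-- The condition of `IsProfile` at the contents `c` and `c + 1`. -/
def IsProfileAt (h : Option ℤ → ℕ) (c : ℤ) : Prop :=
  (0 ≤ c → h (some (c + 1)) ≤ h (some c) ∧ h (some c) ≤ h (some (c + 1)) + 1) ∧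
    (c < 0 → h (some c) ≤ h (some (c + 1)) ∧ h (some (c + 1)) ≤ h (some c) + 1)

theorem isProfileAt_congr {h h' : Option ℤ → ℕ} {c : ℤ} (h1 : h (some c) = h' (some c))
    (h2 : h (some (c + 1)) = h' (some (c + 1))) : IsProfileAt h c ↔ IsProfileAt h' c := by
  simp only [IsProfileAt, h1, h2]

theorem addLetter_self (h : Option ℤ → ℕ) (a : Option ℤ) : addLetter h a a = h a + 1 := by
  simp [addLetter]

theorem addLetter_of_ne (h : Option ℤ → ℕ) {a b : Option ℤ} (hab : a ≠ b) :
    addLetter h a b = h b := by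
  simp [addLetter, hab]

theorem addLetter_cancel {h : Option ℤ → ℕ} {a : Option ℤ} (ha : 0 < h a) :
    h = addLetter (fun y => h y - if a = y then 1 else 0) a := by
  funext y
  simp only [addLetter]
  split_ifs with hy
  · subst hy; omega
  · rfl

/-- If `d` is next to an addable content `c` and is not addable after `c`, then it is removable
before. -/
theorem removable_of_not_addable {g : Option ℤ → ℕ} {c d : ℤ} (hcd : d = c + 1 ∨ d + 1 = c)
    (h0 : IsProfile g) (h1 : IsProfile (addLetter g (some c)))
    (h2 : ¬ IsProfile (addLetter (addLetter g (some c)) (some d))) :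
    ∃ g', IsProfile g' ∧ g = addLetter g' (some d) := by
  obtain ⟨k, hk⟩ : ∃ k, ¬ IsProfileAt (addLetter (addLetter g (some c)) (some d)) k := by
    by_contra hcon
    push Not at hcon
    exact h2 hcon
  have hkd : k = d ∨ k + 1 = d := by
    by_contra hne
    push Not at hne
    refine hk ((isProfileAt_congr ?_ ?_).2 (h1 k))
    · exact addLetter_of_ne _ (by simpa using hne.1.symm)
    · exact addLetter_of_ne _ (by simpa using hne.2.symm)
  -- The condition between `c` and `d` still holds after adding both, so the failing one
  -- is between `d` and its other neighbour.
  obtain ⟨rfl, rfl⟩ | ⟨rfl, rfl⟩ : (d = c + 1 ∧ k = c + 1) ∨ (c = k + 1 + 1 ∧ d = k + 1) := by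
    rcases hcd with rfl | rfl
    · rcases hkd with rfl | hkd
      · exact Or.inl ⟨rfl, rfl⟩
      · obtain rfl : k = c := by omega
        exfalso
        have e := h0 k
        have e1 := h1 k
        simp [IsProfileAt, addLetter, -not_and] at hk e e1
        omega
    · rcases hkd with rfl | rfl
      · exfalso
        have e := h0 k
        have e1 := h1 k
        simp [IsProfileAt, addLetter, -not_and] at hk e e1
        omega
      · exact Or.inr ⟨rfl, rfl⟩
  · have e := h0 c
    have e1 := h1 c
    have f := h0 (c + 1)
    have hne : ∀ p : ℤ, ¬ p = p + 1 + 1 := fun p => by omega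
    obtain ⟨g', rfl⟩ : ∃ g', g = addLetter g' (some (c + 1)) := by
      refine ⟨_, addLetter_cancel ?_⟩
      simp [IsProfileAt, addLetter, -not_and, hne] at hk e e1 f
      omega
    refine ⟨g', fun p => ?_, rfl⟩
    change IsProfileAt g' p
    by_cases hp : p = c
    · subst hp
      simp [IsProfileAt, addLetter, -not_and, hne] at hk e e1 f ⊢
      omega
    · by_cases hp2 : p = c + 1
      · subst hp2
        simp [IsProfileAt, addLetter, -not_and, hne] at hk e e1 f ⊢
        omega
      · refine (isProfileAt_congr ?_ ?_).1 (h0 p)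
        · exact addLetter_of_ne _ (by simpa using Ne.symm hp2)
        · exact addLetter_of_ne _ (by simpa using Ne.symm hp)
  · have e := h0 (k + 1)
    have e1 := h1 (k + 1)
    have f := h0 k
    have hne : ∀ p : ℤ, ¬ p + 1 + 1 = p := fun p => by omega
    obtain ⟨g', rfl⟩ : ∃ g', g = addLetter g' (some (k + 1)) := by
      refine ⟨_, addLetter_cancel ?_⟩
      simp [IsProfileAt, addLetter, -not_and, hne] at hk e e1 f
      omega
    refine ⟨g', fun p => ?_, rfl⟩
    change IsProfileAt g' p
    by_cases hp : p = k
    · subst hp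
      simp [IsProfileAt, addLetter, -not_and, hne] at hk e e1 f ⊢
      omega
    · by_cases hp2 : p = k + 1
      · subst hp2
        simp [IsProfileAt, addLetter, -not_and, hne] at hk e e1 f ⊢
        omega
      · refine (isProfileAt_congr ?_ ?_).1 (h0 p)
        · exact addLetter_of_ne _ (by simpa using Ne.symm hp2)
        · exact addLetter_of_ne _ (by simpa using Ne.symm hp)

/-! ### Words with a common profile are linked by swaps of independent letters -/

/-- The number of occurrences of each letter among the first `m` letters of a word. -/
def letterCount (γ : ℕ → Option ℤ) : ℕ → Option ℤ → ℕ
  | 0 => 0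
  | m + 1 => addLetter (letterCount γ m) (γ m)

/-- The content words of length `m`: each prefix counts the diagonals of a Young diagram, the
blank letters being ignored. They encode the standard tableaux of at most `m` boxes with entries
in `{1, …, m}`. -/
def IsContentWord (γ : ℕ → Option ℤ) (m : ℕ) : Prop :=
  ∀ k ≤ m, IsProfile (letterCount γ k)

theorem letterCount_congr {γ γ' : ℕ → Option ℤ} {m : ℕ} (h : ∀ k < m, γ k = γ' k) :
    letterCount γ m = letterCount γ' m := by
  induction m with
  | zero => rfl
  | succ m ih =>
    rw [letterCount, letterCount, ih fun k hk => h k (by omega), h m (by omega)]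

theorem IsContentWord.mono {γ : ℕ → Option ℤ} {m m' : ℕ} (hγ : IsContentWord γ m) (h : m' ≤ m) :
    IsContentWord γ m' := fun k hk => hγ k (hk.trans h)

theorem addLetter_comm (h : Option ℤ → ℕ) (a b : Option ℤ) :
    addLetter (addLetter h a) b = addLetter (addLetter h b) a := by
  funext y
  simp only [addLetter]
  omega

theorem addLetter_injective {h h' : Option ℤ → ℕ} {a : Option ℤ}
    (e : addLetter h a = addLetter h' a) : h = h' := by
  funext y
  have := congrFun e y
  simpa [addLetter] using this

/-- The word `γ` with the letters in the positions `i` and `i + 1` exchanged. -/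
def swapAt {X : Type} (γ : ℕ → X) (i : ℕ) : ℕ → X := fun k => γ (Equiv.swap i (i + 1) k)

section swapAt
variable {X : Type} (γ : ℕ → X) (i : ℕ)

@[simp] theorem swapAt_left : swapAt γ i i = γ (i + 1) := by simp [swapAt]

@[simp] theorem swapAt_right : swapAt γ i (i + 1) = γ i := by simp [swapAt]

theorem swapAt_of_ne {i k : ℕ} (h1 : k ≠ i) (h2 : k ≠ i + 1) : swapAt γ i k = γ k := by
  simp [swapAt, Equiv.swap_apply_of_ne_of_ne h1 h2]

end swapAt

theorem letterCount_swapAt_of_le (γ : ℕ → Option ℤ) {i k : ℕ} (h : k ≤ i) :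
    letterCount (swapAt γ i) k = letterCount γ k :=
  letterCount_congr fun j hj => swapAt_of_ne γ (by omega) (by omega)

theorem letterCount_swapAt_succ (γ : ℕ → Option ℤ) (i : ℕ) :
    letterCount (swapAt γ i) (i + 1) = addLetter (letterCount γ i) (γ (i + 1)) := by
  rw [letterCount, letterCount_swapAt_of_le γ le_rfl, swapAt_left]

theorem letterCount_swapAt_of_ge (γ : ℕ → Option ℤ) {i k : ℕ} (h : i + 2 ≤ k) :
    letterCount (swapAt γ i) k = letterCount γ k := by
  induction k, h using Nat.le_induction with
  | base =>
    rw [letterCount, letterCount_swapAt_succ, swapAt_right, addLetter_comm]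
    rfl
  | succ k hk ih =>
    rw [letterCount, letterCount, ih, swapAt_of_ne γ (by omega) (by omega)]

theorem IsContentWord.swapAt {γ : ℕ → Option ℤ} {i m : ℕ} (hγ : IsContentWord γ m)
    (hi : i + 1 < m) (hind : Indep (γ i) (γ (i + 1))) : IsContentWord (swapAt γ i) m := by
  intro k hk
  rcases Nat.lt_or_ge i k with h | h
  · rcases Nat.lt_or_ge (i + 1) k with h2 | h2
    · rw [letterCount_swapAt_of_ge γ h2]
      exact hγ k hk
    · obtain rfl : k = i + 1 := by omega
      rw [letterCount_swapAt_succ]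
      exact (hγ i (by omega)).exchange hind (hγ (i + 1) hk) (hγ (i + 2) (by omega))
  · rw [letterCount_swapAt_of_le γ h]
    exact hγ k hk

/-- Two words are linked below `m` if one arises from the other by successively exchanging
independent neighbours in positions below `m`. -/
inductive Linked (m : ℕ) : (ℕ → Option ℤ) → (ℕ → Option ℤ) → Prop
  | refl (γ : ℕ → Option ℤ) : Linked m γ γ
  | step (γ γ' : ℕ → Option ℤ) (i : ℕ) (hi : i + 1 < m) (hind : Indep (γ i) (γ (i + 1)))
      (h : Linked m (swapAt γ i) γ') : Linked m γ γ'

theorem Linked.trans {m : ℕ} {γ γ' γ'' : ℕ → Option ℤ} (h : Linked m γ γ')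
    (h' : Linked m γ' γ'') : Linked m γ γ'' := by
  induction h with
  | refl => exact h'
  | step γ γ' i hi hind _ ih => exact .step _ _ i hi hind (ih h')

theorem Linked.mono {m m' : ℕ} (hm : m ≤ m') {γ γ' : ℕ → Option ℤ} (h : Linked m γ γ') :
    Linked m' γ γ' := by
  induction h with
  | refl => exact .refl _
  | step γ γ' i hi hind _ ih => exact .step _ _ i (by omega) hind ih

theorem Linked.eq_of_le {m : ℕ} {γ γ' : ℕ → Option ℤ} (h : Linked m γ γ') {k : ℕ} (hk : m ≤ k) :
    γ' k = γ k := by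
  induction h with
  | refl => rfl
  | step γ γ' i hi hind _ ih => rw [ih, swapAt_of_ne γ (by omega) (by omega)]

theorem Linked.letterCount_eq {m : ℕ} {γ γ' : ℕ → Option ℤ} (h : Linked m γ γ') :
    letterCount γ' m = letterCount γ m := by
  induction h with
  | refl => rfl
  | step γ γ' i hi hind _ ih => rw [ih, letterCount_swapAt_of_ge γ (by omega)]

theorem Linked.isContentWord {m M : ℕ} (hM : m ≤ M) {γ γ' : ℕ → Option ℤ} (h : Linked m γ γ')
    (hγ : IsContentWord γ M) : IsContentWord γ' M := by
  induction h with
  | refl => exact hγ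
  | step γ γ' i hi hind _ ih => exact ih (hγ.swapAt (by omega) hind)

/-- A removable letter can be moved to the end of a content word. -/
theorem exists_linked_last (m : ℕ) {γ : ℕ → Option ℤ} (hγ : IsContentWord γ (m + 1))
    {g : Option ℤ → ℕ} {x : Option ℤ} (hg : IsProfile g)
    (e : letterCount γ (m + 1) = addLetter g x) :
    ∃ γ', Linked (m + 1) γ γ' ∧ γ' m = x := by
  induction m generalizing γ g with
  | zero =>
    refine ⟨γ, .refl _, ?_⟩
    by_contra hne
    have := congrFun e x
    rw [letterCount, letterCount, addLetter_of_ne _ hne, addLetter_self] at this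
    exact absurd this (by simp)
  | succ m ih =>
    by_cases hx : γ (m + 1) = x
    · exact ⟨γ, .refl _, hx⟩
    have e' : addLetter (letterCount γ (m + 1)) (γ (m + 1)) = addLetter g x := e
    obtain ⟨g', hg'⟩ : ∃ g', letterCount γ (m + 1) = addLetter g' x := by
      refine ⟨_, addLetter_cancel ?_⟩
      have := congrFun e' x
      rw [addLetter_of_ne _ hx, addLetter_self] at this
      omega
    obtain rfl : g = addLetter g' (γ (m + 1)) := by
      rw [hg', addLetter_comm] at e'
      exact (addLetter_injective e').symm
    have h1 : IsProfile (addLetter g' x) := hg' ▸ hγ (m + 1) (by omega)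
    have h2 : IsProfile (addLetter (addLetter g' (γ (m + 1))) x) := e ▸ hγ (m + 2) le_rfl
    have hind := indep_of_addable hx hg h1
    have h0 : IsProfile g' :=
      (IsProfile.of_indep hind (Or.inr h2) hg h1).1
    obtain ⟨γ', hl, hlast⟩ := ih (hγ.mono (by omega)) h0 hg'
    have hl' := hl.mono (show m + 1 ≤ m + 1 + 1 by omega)
    have h3 : γ' (m + 1) = γ (m + 1) := hl.eq_of_le le_rfl
    refine ⟨swapAt γ' m, hl'.trans (.step _ _ m (by omega) ?_ (.refl _)), ?_⟩
    · rw [hlast, h3]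
      exact hind.symm
    · rw [swapAt_right, hlast]

/-- Content words with the same letter counts are linked: this is the connectedness of the set of
standard tableaux of a given shape under admissible transpositions. -/
theorem exists_linked_of_letterCount_eq (m : ℕ) {γ γ' : ℕ → Option ℤ} (hγ : IsContentWord γ m)
    (hγ' : IsContentWord γ' m) (e : letterCount γ m = letterCount γ' m) :
    ∃ γ'', Linked m γ γ'' ∧ ∀ k < m, γ'' k = γ' k := by
  induction m generalizing γ with
  | zero => exact ⟨γ, .refl _, by simp⟩
  | succ m ih =>
    obtain ⟨γ₁, hl, hlast⟩ := exists_linked_last m hγ (hγ' m (by omega)) e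
    have hγ₁ := hl.isContentWord le_rfl hγ
    have e1 : letterCount γ₁ (m + 1) = letterCount γ' (m + 1) := hl.letterCount_eq.trans e
    rw [letterCount, letterCount, hlast] at e1
    obtain ⟨γ₂, hl2, h2⟩ := ih (hγ₁.mono (by omega)) (hγ'.mono (by omega)) (addLetter_injective e1)
    refine ⟨γ₂, hl.trans (hl2.mono (by omega)), fun k hk => ?_⟩
    rcases Nat.lt_succ_iff_lt_or_eq.mp hk with h | rfl
    · exact h2 k h
    · rw [hl2.eq_of_le le_rfl, hlast]

/-! ### Bounds for the contents in a profile -/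

/-- A letter count `h` of at most `m` letters. -/
def SizeLE (h : Option ℤ → ℕ) (m : ℕ) : Prop := ∀ s : Finset ℤ, ∑ c ∈ s, h (some c) ≤ m

theorem SizeLE.addLetter {h : Option ℤ → ℕ} {m : ℕ} (hh : SizeLE h m) (x : Option ℤ) :
    SizeLE (addLetter h x) (m + 1) := by
  intro s
  simp only [Mirabolic.addLetter, Finset.sum_add_distrib]
  refine add_le_add (hh s) ?_
  rcases x with _ | x
  · simp
  · simp only [Option.some.injEq, Finset.sum_ite_eq]
    split_ifs <;> simp

theorem sizeLE_letterCount (γ : ℕ → Option ℤ) (m : ℕ) : SizeLE (letterCount γ m) m := by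
  induction m with
  | zero => intro s; simp [letterCount]
  | succ m ih => exact ih.addLetter _

theorem IsProfile.pos_of_nonneg {h : Option ℤ → ℕ} (hh : IsProfile h) {c : ℤ} (hc : 0 ≤ c)
    (j : ℕ) (hj : 0 < h (some (c + j))) : 0 < h (some c) := by
  induction j with
  | zero => simpa using hj
  | succ j ih =>
    refine ih (lt_of_lt_of_le hj ?_)
    have := ((hh (c + j)).1 (by omega)).1
    push_cast
    rwa [← add_assoc]

theorem IsProfile.pos_of_nonpos {h : Option ℤ → ℕ} (hh : IsProfile h) {c : ℤ}
    (j : ℕ) (hc : c + j ≤ 0) (hj : 0 < h (some c)) : 0 < h (some (c + j)) := by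
  induction j with
  | zero => simpa using hj
  | succ j ih =>
    refine lt_of_lt_of_le (ih (by omega)) ?_
    have := ((hh (c + j)).2 (by omega)).1
    push_cast
    rwa [← add_assoc]

/-- The contents that occur in a profile form an interval. -/
theorem IsProfile.sub_lt {h : Option ℤ → ℕ} (hh : IsProfile h) {m : ℕ} (hm : SizeLE h m)
    {c d : ℤ} (hc : 0 < h (some c)) (hd : 0 < h (some d)) : d - c < m := by
  by_contra hcon
  have key : ∀ k ∈ Finset.Icc c d, 1 ≤ h (some k) := by
    intro k hk
    rw [Finset.mem_Icc] at hk
    rcases le_total 0 k with h0 | h0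
    · refine hh.pos_of_nonneg h0 (d - k).toNat ?_
      rwa [Int.toNat_of_nonneg (by omega), add_sub_cancel]
    · have := hh.pos_of_nonpos (c := c) (k - c).toNat
      rw [Int.toNat_of_nonneg (by omega), add_sub_cancel] at this
      exact this h0 hc
  have h1 := Finset.sum_le_sum key
  have h2 := hm (Finset.Icc c d)
  simp only [Finset.sum_const, Int.card_Icc, smul_eq_mul, mul_one] at h1
  have h3 := h1.trans h2
  omega

/-- The contents that occur in a profile form an interval containing `0`. -/
theorem IsProfile.pos_zero {h : Option ℤ → ℕ} (hh : IsProfile h) {c : ℤ}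
    (hc : 0 < h (some c)) : 0 < h (some 0) := by
  rcases le_total 0 c with h0 | h0
  · refine hh.pos_of_nonneg le_rfl c.toNat ?_
    rwa [Int.toNat_of_nonneg h0, zero_add]
  · have := hh.pos_of_nonpos (c := c) (-c).toNat
    rw [Int.toNat_of_nonneg (by omega), add_neg_cancel] at this
    exact this le_rfl hc

/-! ### Evaluation of letters in a field -/

/-- The eigenvalue belonging to a letter: `q ^ c` for the content `c` and `0` for the blank. -/
def letterValue {K : Type} [Field K] (q : K) : Option ℤ → K
  | none => 0
  | some c => q ^ c

section letterValue

variable {K : Type} [Field K] {q : K} {n : ℕ}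

theorem letterValue_some_ne_zero (hq0 : q ≠ 0) (c : ℤ) : letterValue q (some c) ≠ 0 :=
  zpow_ne_zero c hq0

theorem eq_of_zpow_eq (hq0 : q ≠ 0) (hq : ∀ i : ℕ, 1 ≤ i → i ≤ n → q ^ i ≠ 1) {c d : ℤ}
    (h1 : c - d ≤ n) (h2 : d - c ≤ n) (e : q ^ c = q ^ d) : c = d := by
  have aux : ∀ c d : ℤ, c - d ≤ n → q ^ c = q ^ d → ¬ d < c := by
    intro c d h e hlt
    refine hq (c - d).toNat (by omega) (by omega) ?_
    rw [← zpow_natCast, Int.toNat_of_nonneg (by omega), zpow_sub₀ hq0, e,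
      div_self (zpow_ne_zero _ hq0)]
  have a1 := aux c d h1 e
  have a2 := aux d c h2 e.symm
  omega

/-- Two letters that can be added to the same profile and have the same value are equal. -/
theorem eq_of_addable_of_letterValue_eq (hq0 : q ≠ 0)
    (hq : ∀ i : ℕ, 1 ≤ i → i ≤ n → q ^ i ≠ 1) {h : Option ℤ → ℕ} {m : ℕ} (hm : SizeLE h m)
    (hmn : m + 1 ≤ n) {a b : Option ℤ} (ha : IsProfile (addLetter h a))
    (hb : IsProfile (addLetter h b)) (h0 : IsProfile h)
    (e : letterValue q a = letterValue q b) : a = b := by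
  by_contra hab
  rcases a with _ | c <;> rcases b with _ | d
  · exact hab rfl
  · exact letterValue_some_ne_zero hq0 d e.symm
  · exact letterValue_some_ne_zero hq0 c e
  · have hind := indep_of_addable hab ha hb
    have hp := (IsProfile.of_indep hind (Or.inl h0) ha hb).2
    have hs := (hm.addLetter (some c)).addLetter (some d)
    have hc : 0 < addLetter (addLetter h (some c)) (some d) (some c) := by
      simp [addLetter]
    have hd : 0 < addLetter (addLetter h (some c)) (some d) (some d) := by
      simp [addLetter]
    have b1 := hp.sub_lt hs hc hd
    have b2 := hp.sub_lt hs hd hc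
    exact hab (congrArg some (eq_of_zpow_eq hq0 hq (by push_cast at *; omega)
      (by push_cast at *; omega) e))

/-- A content word is determined by the values of its letters. -/
theorem contentWord_unique (hq0 : q ≠ 0) (hq : ∀ i : ℕ, 1 ≤ i → i ≤ n → q ^ i ≠ 1) {m : ℕ}
    (hmn : m ≤ n) {γ γ' : ℕ → Option ℤ} (hγ : IsContentWord γ m) (hγ' : IsContentWord γ' m)
    (e : ∀ k < m, letterValue q (γ k) = letterValue q (γ' k)) : ∀ k < m, γ k = γ' k := by
  induction m with
  | zero => simp
  | succ m ih =>
    have h1 := ih (by omega) (hγ.mono (by omega)) (hγ'.mono (by omega))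
      (fun k hk => e k (by omega))
    intro k hk
    rcases Nat.lt_succ_iff_lt_or_eq.mp hk with h | rfl
    · exact h1 k h
    · refine eq_of_addable_of_letterValue_eq hq0 hq (sizeLE_letterCount γ k) hmn
        (hγ (k + 1) le_rfl) ?_ (hγ k (by omega)) (e k (by omega))
      rw [letterCount_congr h1]
      exact hγ' (k + 1) le_rfl

theorem profile_pos_of_value_eq (hq0 : q ≠ 0) (hq : ∀ i : ℕ, 1 ≤ i → i ≤ n → q ^ i ≠ 1)
    {h h' : Option ℤ → ℕ} (hh : IsProfile h) (hh' : IsProfile h') (hs : SizeLE h' n)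
    (e : ∀ c, 0 < h (some c) → ∃ d, 0 < h' (some d) ∧ q ^ c = q ^ d) (c : ℤ)
    (hc : 0 < h (some c)) : 0 < h' (some c) := by
  have hzero : 0 < h' (some 0) := by
    obtain ⟨d, hd, -⟩ := e c hc
    exact hh'.pos_zero hd
  -- Walking outwards from `0`, a first content missing from `h'` would have the value of
  -- a content of `h'` at distance at most `n`.
  have up : ∀ j : ℕ, 0 < h (some (j : ℤ)) → 0 < h' (some (j : ℤ)) := by
    intro j
    induction j with
    | zero => exact fun _ => hzero
    | succ j ih =>
      intro hj
      have hj' := ih (hh.pos_of_nonneg (by omega) 1 (by exact_mod_cast hj))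
      obtain ⟨d, hd, ed⟩ := e _ hj
      by_contra hcon
      have hdj : d ≤ j := by
        by_contra hlt
        refine hcon (hh'.pos_of_nonneg (by omega) (d - (j + 1 : ℕ)).toNat ?_)
        rwa [Int.toNat_of_nonneg (by omega), add_sub_cancel]
      have := hh'.sub_lt hs hd hj'
      have := eq_of_zpow_eq hq0 hq (by push_cast; omega) (by push_cast; omega) ed
      push_cast at this
      omega
  have down : ∀ j : ℕ, 0 < h (some (-(j : ℤ))) → 0 < h' (some (-(j : ℤ))) := by
    intro j
    induction j with
    | zero => exact fun _ => hzero
    | succ j ih =>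
      intro hj
      have hj' := ih (by
        have := hh.pos_of_nonpos 1 (by push_cast; omega) hj
        rwa [show (-((j + 1 : ℕ) : ℤ) + (1 : ℕ)) = -(j : ℤ) by push_cast; ring] at this)
      obtain ⟨d, hd, ed⟩ := e _ hj
      by_contra hcon
      have hdj : -(j : ℤ) ≤ d := by
        by_contra hlt
        have := hh'.pos_of_nonpos (c := d) (-((j + 1 : ℕ) : ℤ) - d).toNat
        rw [Int.toNat_of_nonneg (by push_cast; omega), add_sub_cancel] at this
        exact hcon (this (by push_cast; omega) hd)
      have := hh'.sub_lt hs hj' hd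
      have := eq_of_zpow_eq hq0 hq (by push_cast; omega) (by push_cast; omega) ed
      push_cast at this
      omega
  rcases le_total 0 c with h0 | h0
  · have := up c.toNat
    rw [Int.toNat_of_nonneg h0] at this
    exact this hc
  · have := down (-c).toNat
    rw [Int.toNat_of_nonneg (by omega), neg_neg] at this
    exact this hc

theorem letterCount_eq_sum (γ : ℕ → Option ℤ) (m : ℕ) (x : Option ℤ) :
    letterCount γ m x = ∑ k : Fin m, if γ k = x then 1 else 0 := by
  induction m with
  | zero => rfl
  | succ m ih =>
    rw [Fin.sum_univ_castSucc, letterCount, addLetter, ih]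
    rfl

theorem letterCount_pos {γ : ℕ → Option ℤ} {m k : ℕ} (hk : k < m) :
    0 < letterCount γ m (γ k) := by
  rw [letterCount_eq_sum]
  exact Finset.sum_pos' (fun _ _ => Nat.zero_le _) ⟨⟨k, hk⟩, Finset.mem_univ _, by simp⟩

theorem exists_of_letterCount_pos {γ : ℕ → Option ℤ} {m : ℕ} {x : Option ℤ}
    (h : 0 < letterCount γ m x) : ∃ k : Fin m, γ k = x := by
  rw [letterCount_eq_sum] at h
  by_contra hcon
  push Not at hcon
  simp [hcon] at h

/-- Content words whose values agree up to a permutation have the same letter counts: the multiset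
of values determines the Young diagram. -/
theorem letterCount_eq_of_perm (hq0 : q ≠ 0) (hq : ∀ i : ℕ, 1 ≤ i → i ≤ n → q ^ i ≠ 1)
    {γ γ' : ℕ → Option ℤ} (hγ : IsContentWord γ n) (hγ' : IsContentWord γ' n)
    (σ : Equiv.Perm (Fin n))
    (e : ∀ k : Fin n, letterValue q (γ' k) = letterValue q (γ (σ k))) :
    letterCount γ n = letterCount γ' n := by
  have hh := hγ n le_rfl
  have hh' := hγ' n le_rfl
  have key : ∀ k : Fin n, γ' k = γ (σ k) := by
    intro k
    have ek := e k
    have p1 := letterCount_pos (γ := γ) (σ k).2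
    have p2 := letterCount_pos (γ := γ') k.2
    rcases h1 : γ' k with _ | c <;> rcases h2 : γ (σ k) with _ | d <;>
      rw [h1, h2] at ek
    · exact absurd ek.symm (letterValue_some_ne_zero hq0 d)
    · exact absurd ek (letterValue_some_ne_zero hq0 c)
    · rw [h2] at p1
      rw [h1] at p2
      have p3 := profile_pos_of_value_eq hq0 hq hh hh' (sizeLE_letterCount γ' n) (fun c hc => by
        obtain ⟨j, hj⟩ := exists_of_letterCount_pos hc
        have ej := e (σ.symm j)
        rw [Equiv.apply_symm_apply, hj] at ej
        rcases h3 : γ' (σ.symm j) with _ | d'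
        · rw [h3] at ej
          exact absurd ej.symm (letterValue_some_ne_zero hq0 c)
        · rw [h3] at ej
          exact ⟨d', h3 ▸ letterCount_pos (σ.symm j).2, ej.symm⟩) d p1
      have s1 := hh'.sub_lt (sizeLE_letterCount γ' n) p2 p3
      have s2 := hh'.sub_lt (sizeLE_letterCount γ' n) p3 p2
      exact congrArg some (eq_of_zpow_eq hq0 hq (by omega) (by omega) ek)
  funext x
  rw [letterCount_eq_sum, letterCount_eq_sum, ← Equiv.sum_comp σ]
  simp only [key]

end letterValue

/-! ### Weight vectors and intertwiners -/

open Polynomial in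
theorem aeval_mul_of_mul_eq_smul {K A : Type} [Field K] [Ring A] [Algebra K A] {x v : A} {c : K}
    (h : x * v = c • v) (P : K[X]) : aeval x P * v = P.eval c • v := by
  induction P using Polynomial.induction_on' with
  | add P Q hP hQ => rw [map_add, add_mul, hP, hQ, eval_add, add_smul]
  | monomial k a =>
    rw [aeval_monomial, eval_monomial, mul_assoc, mul_smul, ← Algebra.smul_def]
    congr 1
    induction k with
    | zero => simp
    | succ k ih => rw [pow_succ, mul_assoc, h, mul_smul_comm, ih, smul_smul, pow_succ, mul_comm]

open Polynomial in
theorem aeval_mul_eq_mul_aeval {K A : Type} [Field K] [Ring A] [Algebra K A] {x y s : A}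
    (h : x * s = s * y) (P : K[X]) : aeval x P * s = s * aeval y P := by
  induction P using Polynomial.induction_on' with
  | add P Q hP hQ => rw [map_add, map_add, add_mul, hP, hQ, mul_add]
  | monomial k a =>
    rw [aeval_monomial, aeval_monomial, mul_assoc, ← mul_assoc s, ← Algebra.commutes a s, mul_assoc]
    congr 1
    exact (show SemiconjBy s y x from h.symm).pow_right k |>.symm

namespace MirabolicSystem

variable {K A : Type} [Field K] [Ring A] [Algebra K A] {n : ℕ} (D : MirabolicSystem K A n)

/-- The element `v` is a weight vector for the left action of the first `m` Jucys-Murphy elements,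
with weight `α`. -/
def IsWeight (m : ℕ) (α : ℕ → K) (v : A) : Prop := ∀ i < m, D.L i * v = α i • v

variable {D}

theorem IsWeight.mono {m m' : ℕ} {α : ℕ → K} {v : A} (h : D.IsWeight m α v) (hm : m' ≤ m) :
    D.IsWeight m' α v := fun i hi => h i (by omega)

theorem IsWeight.congr {m : ℕ} {α β : ℕ → K} {v : A} (h : D.IsWeight m α v)
    (e : ∀ i < m, α i = β i) : D.IsWeight m β v := fun i hi => by rw [h i hi, e i hi]

theorem IsWeight.mul_of_commute {m : ℕ} {α : ℕ → K} {v x : A} (h : D.IsWeight m α v)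
    (hx : ∀ i < m, Commute x (D.L i)) : D.IsWeight m α (x * v) := fun i hi => by
  rw [← mul_assoc, ← (hx i hi).eq, mul_assoc, h i hi, mul_smul_comm]

theorem commute_aeval_L {i : ℕ} {x : A} (h : Commute x (D.L i)) (P : Polynomial K) :
    Commute x (Polynomial.aeval (D.L i) P) :=
  (aeval_mul_eq_mul_aeval h.symm.eq P).symm

variable (D)

/-- The intertwiner exchanging the weights `α i` and `α (i + 1)`. -/
def swapVec (i : ℕ) (α : ℕ → K) (v : A) : A :=
  D.T i * v + ((D.q - 1) * α (i + 1) / (α i - α (i + 1))) • v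

variable {D}

theorem IsWeight.swapVec {m i : ℕ} {α : ℕ → K} {v : A} (h : D.IsWeight m α v) (hi : i + 1 < m)
    (hm : m ≤ n) (hne : α i ≠ α (i + 1)) : D.IsWeight m (swapAt α i) (D.swapVec i α v) := by
  have hne' := sub_ne_zero.mpr hne
  have hin : i + 1 < n := by omega
  intro k hk
  by_cases k1 : k = i
  · subst k1
    have h1 := h k hk
    have h2 := h (k + 1) hi
    rw [swapAt_left, MirabolicSystem.swapVec, mul_add, ← mul_assoc, D.L_mul_T' hin, sub_mul,
      mul_assoc, h2, mul_smul_comm, mul_smul_comm, h1, smul_mul_assoc, h2]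
    match_scalars
    · ring
    · field_simp
      ring
  · by_cases k2 : k = i + 1
    · subst k2
      have h1 := h i (by omega)
      have h2 := h (i + 1) hi
      rw [swapAt_right, MirabolicSystem.swapVec, mul_add, ← mul_assoc, D.L_succ_mul_T hin, add_mul,
        mul_assoc, h1, mul_smul_comm, smul_mul_assoc, h2, mul_smul_comm, h2]
      match_scalars
      · ring
      · field_simp
        ring
    · rw [swapAt_of_ne α k1 k2, MirabolicSystem.swapVec]
      have hc : Commute (D.T i) (D.L k) := by
        rcases Nat.lt_or_ge k i with hlt | hge
        · exact D.commute_T_L_of_lt hlt hin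
        · exact D.commute_T_L_of_gt (by omega) (by omega)
      rw [mul_add, ← mul_assoc, ← hc.eq, mul_assoc, h k hk, mul_smul_comm, mul_smul_comm, h k hk,
        smul_add, smul_comm]

theorem swapVec_ne_zero {i : ℕ} {α : ℕ → K} {v : A} (hv : v ≠ 0) (hi : i + 1 < n)
    (hne : α i ≠ α (i + 1)) (h1 : α (i + 1) ≠ D.q * α i) (h2 : α i ≠ D.q * α (i + 1)) :
    D.swapVec i α v ≠ 0 := by
  have hne' := sub_ne_zero.mpr hne
  have hne2 := sub_ne_zero.mpr hne.symm
  intro h0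
  have key : D.T i * D.swapVec i α v
      + ((D.q - 1) * α i / (α (i + 1) - α i)) • D.swapVec i α v =
      ((D.q * α i - α (i + 1)) * (α i - D.q * α (i + 1)) / (α i - α (i + 1)) ^ 2) • v := by
    rw [swapVec, mul_add, ← mul_assoc, D.quad i hi, add_mul, smul_mul_assoc, smul_mul_assoc,
      one_mul, mul_smul_comm]
    rw [show α (i + 1) - α i = -(α i - α (i + 1)) by ring]
    match_scalars
    · field_simp
      ring
    · field_simp
      ring
  rw [h0, mul_zero, smul_zero, add_zero, eq_comm, smul_eq_zero] at key
  rcases key with key | key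
  · rw [div_eq_zero_iff] at key
    rcases key with key | key
    · rcases mul_eq_zero.mp key with k | k
      · exact h1 (sub_eq_zero.mp k).symm
      · exact h2 (sub_eq_zero.mp k)
    · exact hne' (pow_eq_zero_iff (two_ne_zero) |>.mp key)
  · exact hv key

/-- On weight vectors whose weights in the positions `i` and `i + 1` vanish, `T_i` acts by `-1`.
For `i = 0` this is the relation `rook`; the zeros are moved there by the braid relation. -/
theorem IsWeight.T_mul_of_zero_zero {i : ℕ} (hi : i + 1 < n) {α : ℕ → K} {v : A}
    (h : D.IsWeight (i + 2) α v) (h0 : α i = 0) (h1 : α (i + 1) = 0) : D.T i * v = -v := by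
  induction i generalizing α v with
  | zero =>
    have e0 : D.e * v = 0 := by simpa [h0, L_zero] using h 0 (by omega)
    have e1 : D.L 1 * v = 0 := by simpa [h1] using h 1 (by omega)
    have e2 : D.e * (D.T 0 * v) = 0 := by
      rw [L_succ, L_zero, smul_mul_assoc, mul_assoc, mul_assoc] at e1
      exact D.T_mul_eq_zero hi ((smul_eq_zero.mp e1).resolve_left (inv_ne_zero D.q_ne_zero))
    have r := congrArg (· * v) (D.rook hi)
    simp only [zero_mul, mul_assoc, sub_mul, one_mul, e0, sub_zero, e2, zero_sub, mul_neg] at r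
    rw [neg_eq_zero, add_mul, one_mul] at r
    exact eq_neg_of_add_eq_zero_left r
  | succ i ih =>
    have hb := D.braid i hi
    have hb' := congrArg (· * v) hb
    simp only [mul_assoc] at hb'
    have hL : D.L (i + 1) * (D.T (i + 1) * v) = 0 := by
      have h2 := h (i + 2) (by omega)
      rw [h1, zero_smul] at h2
      rw [← mul_assoc, D.L_mul_T' hi, sub_mul, mul_assoc, smul_mul_assoc, h2]
      simp
    by_cases hp : α i = 0
    · have e1 := ih (by omega) (h.mono (by omega)) hp h0
      have hw : D.IsWeight (i + 2) α (D.T (i + 1) * v) := by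
        intro k hk
        rcases Nat.lt_succ_iff_lt_or_eq.mp hk with hk' | rfl
        · rw [← mul_assoc, ← (D.commute_T_L_of_lt hk' hi).eq, mul_assoc, h k (by omega),
            mul_smul_comm]
        · rw [hL, h0, zero_smul]
      have e2 := ih (by omega) hw hp h0
      rw [e1, e2, mul_neg, mul_neg, e2, neg_neg] at hb'
      have := D.T_mul_cancel hi (x := v) (y := -(D.T (i + 1) * v)) hb'
      rw [eq_comm, neg_eq_iff_eq_neg] at this
      exact this
    · have w1 := h.swapVec (i := i) (by omega) (by omega) (by rw [h0]; exact hp)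
      have w2 := w1.swapVec (i := i + 1) (by omega) (by omega) (by
        rw [swapAt_right, swapAt_of_ne α (by omega) (by omega), h1]; exact hp)
      have w3 := ih (by omega) (w2.mono (by omega))
        (by rw [swapAt_of_ne _ (by omega) (by omega), swapAt_left, h0])
        (by rw [swapAt_left, swapAt_of_ne _ (by omega) (by omega), h1])
      simp only [MirabolicSystem.swapVec, swapAt_of_ne α (show i + 1 + 1 ≠ i by omega)
        (show i + 1 + 1 ≠ i + 1 by omega), h0, h1, mul_zero, zero_div, zero_smul, add_zero] at w3
      rw [hb', ← mul_neg, ← mul_neg] at w3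
      exact D.T_mul_cancel (by omega) (D.T_mul_cancel hi w3)

end MirabolicSystem

namespace MirabolicSystem

variable {K A : Type} [Field K] [Ring A] [Algebra K A] {n : ℕ} (D : MirabolicSystem K A n)

/-! ### Simultaneous diagonalization of the Jucys-Murphy elements -/

open Classical in
/-- The possible eigenvalues of the Jucys-Murphy elements. -/
def values : Finset K :=
  insert 0 ((Finset.Icc (-(n : ℤ)) n).image fun c => D.q ^ c)

theorem zero_mem_values : (0 : K) ∈ D.values := by simp [values]

theorem zpow_mem_values {c : ℤ} (h1 : -(n : ℤ) ≤ c) (h2 : c ≤ n) : D.q ^ c ∈ D.values := by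
  simp only [values, Finset.mem_insert, Finset.mem_image, Finset.mem_Icc]
  exact Or.inr ⟨c, ⟨h1, h2⟩, rfl⟩

open Polynomial

/-- `L_i` is diagonalizable with eigenvalues among `D.values`. -/
def IsDiag (i : ℕ) : Prop := aeval (D.L i) (∏ y ∈ D.values, (X - C y)) = 0

variable {D}

theorem dvd_of_eval_eq_zero {s : Finset K} {P : K[X]} (h : ∀ y ∈ s, P.eval y = 0) :
    (∏ y ∈ s, (X - C y)) ∣ P := by
  refine Finset.prod_dvd_of_coprime (fun a _ b _ hab => ?_) fun y hy => dvd_iff_isRoot.mpr (h y hy)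
  exact isCoprime_X_sub_C_of_isUnit_sub (sub_ne_zero.mpr hab).isUnit

theorem IsDiag.aeval_eq_zero {i : ℕ} (h : D.IsDiag i) {P : K[X]}
    (hP : ∀ y ∈ D.values, P.eval y = 0) : aeval (D.L i) P = 0 := by
  obtain ⟨Q, rfl⟩ := dvd_of_eval_eq_zero hP
  rw [map_mul, show aeval (D.L i) (∏ y ∈ D.values, (X - C y)) = 0 from h, zero_mul]

/-- A diagonalizable element has no Jordan blocks. -/
theorem IsDiag.mul_eq_of_sq {i : ℕ} (h : D.IsDiag i) {x : K} {w : A}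
    (hw : D.L i * (D.L i * w - x • w) = x • (D.L i * w - x • w)) : D.L i * w = x • w := by
  classical
  set N : K[X] := ∏ y ∈ D.values.erase x, (X - C y)
  have h0 : aeval (D.L i) (N * (X - C x)) = 0 := h.aeval_eq_zero fun y hy => by
    by_cases hyx : y = x
    · simp [hyx]
    · rw [eval_mul, eval_prod, Finset.prod_eq_zero (Finset.mem_erase.mpr ⟨hyx, hy⟩) (by simp),
        zero_mul]
  have h1 := aeval_mul_of_mul_eq_smul hw N
  have h2 : aeval (D.L i) N * (D.L i * w - x • w) = 0 := by
    have := congrArg (· * w) h0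
    simp only [map_mul, map_sub, aeval_X, aeval_C, zero_mul, mul_assoc, sub_mul,
      ← Algebra.smul_def] at this
    exact this
  rw [h2, eq_comm, smul_eq_zero] at h1
  refine sub_eq_zero.mp (h1.resolve_left ?_)
  rw [eval_prod]
  refine Finset.prod_ne_zero_iff.mpr fun y hy => ?_
  simpa [sub_eq_zero] using (Finset.ne_of_mem_erase hy).symm

/-- Equal nonzero weights do not occur in neighbouring positions: `T_i` would produce a
Jordan block. -/
theorem IsWeight.eq_zero_of_eq {i m : ℕ} (hd : D.IsDiag i) (hq1 : D.q ≠ 1) (hi : i + 1 < m)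
    (hm : m ≤ n) {α : ℕ → K} {v : A} (h : D.IsWeight m α v) (e : α i = α (i + 1))
    (h0 : α i ≠ 0) : v = 0 := by
  have h1 := h i (by omega)
  have h2 := h (i + 1) (by omega)
  have e1 : D.L i * (D.T i * v) - α i • (D.T i * v) = -((D.q - 1) * α i) • v := by
    rw [← mul_assoc, D.L_mul_T' (by omega), sub_mul, mul_assoc, smul_mul_assoc, h2,
      mul_smul_comm, ← e]
    module
  have e2 := hd.mul_eq_of_sq (x := α i) (w := D.T i * v) (by
    rw [e1, mul_smul_comm, h1, smul_comm])
  rw [e2, sub_self, eq_comm, neg_smul, neg_eq_zero, smul_eq_zero] at e1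
  exact e1.resolve_left (mul_ne_zero (sub_ne_zero.mpr hq1) h0)

/-- The weights `z, x, z` with `z = q x` or `x = q z` do not occur in neighbouring positions:
both intertwiners vanish, so that the two Hecke generators act by the scalars `q` and `-1`, which
contradicts the braid relation. -/
theorem IsWeight.eq_zero_of_alternating {i m : ℕ} (hd : D.IsDiag i) (hd' : D.IsDiag (i + 1))
    (hq1 : D.q ≠ 1) (hq2 : D.q ^ 2 ≠ 1) (hi : i + 2 < m) (hm : m ≤ n) {α : ℕ → K} {v : A}
    (h : D.IsWeight m α v) (e : α i = α (i + 2)) (h0 : α i ≠ 0)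
    (hx : α (i + 1) = D.q * α i ∨ α i = D.q * α (i + 1)) : v = 0 := by
  have hx0 : α (i + 1) ≠ 0 := by
    rintro h3
    rw [h3, mul_zero] at hx
    rcases hx with hx | hx
    · exact mul_ne_zero D.q_ne_zero h0 hx.symm
    · exact h0 hx
  have hne : α i ≠ α (i + 1) := by
    intro h3
    rw [← h3] at hx
    have : D.q * α i = 1 * α i := by rw [one_mul]; rcases hx with hx | hx <;> exact hx.symm
    exact hq1 (mul_right_cancel₀ h0 this)
  have s1 := h.swapVec (i := i) (by omega) hm hne
  have s2 := h.swapVec (i := i + 1) (by omega) hm (by rw [← e]; exact hne.symm)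
  have z1 : D.swapVec i α v = 0 := s1.eq_zero_of_eq (i := i + 1) hd' hq1 (by omega) hm
    (by rw [swapAt_right, swapAt_of_ne α (by omega) (by omega), e]) (by rwa [swapAt_right])
  have z2 : D.swapVec (i + 1) α v = 0 := s2.eq_zero_of_eq (i := i) hd hq1 (by omega) hm
    (by rw [swapAt_left, swapAt_of_ne α (by omega) (by omega), e])
    (by rwa [swapAt_of_ne α (by omega) (by omega)])
  have hb := congrArg (· * v) (D.braid i (by omega))
  simp only [mul_assoc] at hb
  rw [MirabolicSystem.swapVec, add_eq_zero_iff_eq_neg, ← neg_smul] at z1 z2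
  rw [show i + 1 + 1 = i + 2 from rfl, ← e] at z2
  simp only [z1, z2, mul_smul_comm, smul_smul] at hb
  rw [← sub_eq_zero, ← sub_smul, smul_eq_zero] at hb
  refine hb.resolve_left fun hs => hq2 ?_
  have hq1' := sub_ne_zero.mpr hq1
  rcases hx with hx | hx
  · rw [hx] at hs
    have d1 : α i - D.q * α i ≠ 0 := by
      rw [show α i - D.q * α i = -((D.q - 1) * α i) by ring]
      exact neg_ne_zero.mpr (mul_ne_zero hq1' h0)
    have c1 : (D.q - 1) * (D.q * α i) / (α i - D.q * α i) = -D.q := by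
      rw [div_eq_iff d1]; ring
    have c2 : (D.q - 1) * α i / (D.q * α i - α i) = 1 := by
      rw [div_eq_iff (by rw [← neg_sub]; exact neg_ne_zero.mpr d1)]; ring
    rw [c1, c2] at hs
    have : D.q * (D.q + 1) = 0 := by linear_combination -hs
    have := (mul_eq_zero.mp this).resolve_left D.q_ne_zero
    linear_combination (D.q - 1) * this
  · rw [hx] at hs
    have d1 : α (i + 1) - D.q * α (i + 1) ≠ 0 := by
      rw [show α (i + 1) - D.q * α (i + 1) = -((D.q - 1) * α (i + 1)) by ring]
      exact neg_ne_zero.mpr (mul_ne_zero hq1' hx0)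
    have c1 : (D.q - 1) * (D.q * α (i + 1)) / (α (i + 1) - D.q * α (i + 1)) = -D.q := by
      rw [div_eq_iff d1]; ring
    have c2 : (D.q - 1) * α (i + 1) / (D.q * α (i + 1) - α (i + 1)) = 1 := by
      rw [div_eq_iff (by rw [← neg_sub]; exact neg_ne_zero.mpr d1)]; ring
    rw [c1, c2] at hs
    have : D.q * (D.q + 1) = 0 := by linear_combination hs
    have := (mul_eq_zero.mp this).resolve_left D.q_ne_zero
    linear_combination (D.q - 1) * this

/-- If the polynomial `R` kills all possible values of `L_i` on a weight space of
`L_0, …, L_{i-1}`, then `L_{i+1}` is killed by `(q x - t) (x - q t) R(t)` on the part on which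
`L_i` acts by `x`. -/
theorem IsWeight.aeval_succ_mul {i : ℕ} (hi : i + 1 < n) {α : ℕ → K} {v : A}
    (h : D.IsWeight (i + 1) α v) {R : K[X]}
    (hR : ∀ w, D.IsWeight i α w → aeval (D.L i) R * w = 0) :
    aeval (D.L (i + 1)) ((C (D.q * α i) - X) * (C (α i) - C D.q * X) * R) * v = 0 := by
  set a := D.L i
  set b := D.L (i + 1)
  set T := D.T i
  set x := α i
  have hav : a * v = x • v := h i (by omega)
  have hab : Commute a b := D.commute_L_L (by omega) hi
  have haT : a * T = T * b - (D.q - 1) • b := D.L_mul_T' hi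
  have hbT : b * T = T * a + (D.q - 1) • b := D.L_succ_mul_T hi
  have hTT : T * T = (D.q - 1) • T + D.q • 1 := D.quad i hi
  set Φ := T * (a - b) + (D.q - 1) • b
  have haΦ : a * Φ = Φ * b := by
    simp only [Φ, mul_add, add_mul, ← mul_assoc, haT, mul_smul_comm, smul_mul_assoc, hab.eq,
      sub_mul, mul_sub]
    simp only [mul_assoc, hab.eq]
    module
  have hΦv : D.IsWeight i α (Φ * v) := by
    refine (h.mono (by omega)).mul_of_commute fun k hk => ?_
    have c1 : Commute T (D.L k) := D.commute_T_L_of_lt hk hi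
    have c2 : Commute a (D.L k) := D.commute_L_L (by omega) (by omega)
    have c3 : Commute b (D.L k) := D.commute_L_L (by omega) (by omega)
    exact (c1.mul_left (c2.sub_left c3)).add_left (c3.smul_left _)
  set U := aeval b R * v
  have hΦU : Φ * U = 0 := by
    rw [← mul_assoc, ← aeval_mul_eq_mul_aeval haΦ, mul_assoc]
    exact hR _ hΦv
  have haU : a * U = x • U := by
    rw [← mul_assoc, (commute_aeval_L hab R).eq, mul_assoc, hav, mul_smul_comm]
  have haB : a * (b * U) = x • (b * U) := by
    rw [← mul_assoc, hab.eq, mul_assoc, haU, mul_smul_comm]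
  have E1 : x • (T * U) - T * (b * U) = -(D.q - 1) • (b * U) := by
    rw [add_mul, mul_assoc, sub_mul, haU, mul_sub, mul_smul_comm, smul_mul_assoc] at hΦU
    rw [neg_smul]
    exact eq_neg_of_add_eq_zero_left hΦU
  have E3 : (x * (D.q - 1)) • (T * U) = D.q • (b * U) - (x * D.q) • U := by
    have := congrArg (T * ·) E1
    simp only [mul_sub, mul_smul_comm, ← mul_assoc, hTT, add_mul, smul_mul_assoc, one_mul] at this
    simp only [mul_assoc] at this
    rw [← sub_eq_zero] at this ⊢
    rw [← this]
    module
  have E4 : b * (T * U) = x • (T * U) + (D.q - 1) • (b * U) := by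
    rw [← mul_assoc, hbT, add_mul, mul_assoc, haU, mul_smul_comm, smul_mul_assoc]
  have E5 : (x * (D.q - 1)) • (b * (T * U)) = D.q • (b * (b * U)) - (x * D.q) • (b * U) := by
    rw [← mul_smul_comm, E3, mul_sub, mul_smul_comm, mul_smul_comm]
  rw [E4, smul_add, smul_smul] at E5
  have E6 : D.q • (b * (b * U)) - (x * (D.q ^ 2 + 1)) • (b * U) + (D.q * x ^ 2) • U = 0 := by
    have e : (x * (D.q - 1) * x) • (T * U) = x • ((x * (D.q - 1)) • (T * U)) := by
      rw [smul_smul]; ring_nf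
    rw [e, E3] at E5
    rw [← sub_eq_zero] at E5
    rw [← neg_eq_zero, ← E5]
    module
  rw [map_mul, mul_assoc]
  change aeval b ((C (D.q * x) - X) * (C x - C D.q * X)) * U = 0
  rw [← E6]
  simp only [map_mul, map_sub, aeval_X, aeval_C, sub_mul, mul_sub, mul_assoc,
    mul_smul_comm, smul_mul_assoc, Algebra.algebraMap_eq_smul_one, one_mul, mul_one]
  module

end MirabolicSystem

/-! ### Weight projections -/

theorem Indep.letterValue_ne {K : Type} [Field K] {q : K} {n : ℕ} (hq0 : q ≠ 0)
    (hq : ∀ i : ℕ, 1 ≤ i → i ≤ n → q ^ i ≠ 1) {a b : Option ℤ} (hab : Indep a b)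
    {h : Option ℤ → ℕ} (hh : IsProfile h) (hs : SizeLE h n) (ha : 0 < h a) (hb : 0 < h b) :
    letterValue q a ≠ letterValue q b ∧ letterValue q b ≠ q * letterValue q a ∧
      letterValue q a ≠ q * letterValue q b := by
  rcases a with _ | c <;> rcases b with _ | d
  · exact absurd rfl hab.1
  · have := letterValue_some_ne_zero hq0 d
    refine ⟨this.symm, ?_, (mul_ne_zero hq0 this).symm⟩
    simpa [letterValue] using this
  · have := letterValue_some_ne_zero hq0 c
    refine ⟨this, (mul_ne_zero hq0 this).symm, ?_⟩
    simpa [letterValue] using this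
  · have b1 := hh.sub_lt hs ha hb
    have b2 := hh.sub_lt hs hb ha
    have hi := hab.2 c d rfl rfl
    have hne : c ≠ d := fun e => hab.1 (by rw [e])
    simp only [letterValue, ← zpow_one_add₀ hq0]
    refine ⟨fun e => ?_, fun e => ?_, fun e => ?_⟩ <;>
    · have := eq_of_zpow_eq hq0 hq (by omega) (by omega) e
      omega

namespace MirabolicSystem

variable {K A : Type} [Field K] [Ring A] [Algebra K A] {n : ℕ} (D : MirabolicSystem K A n)

open Polynomial

/-- The spectral projection of `L_i` for the eigenvalue `y`. -/
def proj (i : ℕ) (y : K) : A := by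
  classical
  exact aeval (D.L i) (Lagrange.basis D.values id y)

/-- The product of the spectral projections of the first `m` Jucys-Murphy elements for the
weight `α`. -/
def weightProj : ℕ → (ℕ → K) → A
  | 0, _ => 1
  | m + 1, α => weightProj m α * D.proj m (α m)

variable {D}

theorem commute_proj {i : ℕ} {x : A} (h : Commute x (D.L i)) (y : K) : Commute x (D.proj i y) :=
  commute_aeval_L h _

theorem IsDiag.L_mul_proj {i : ℕ} (h : D.IsDiag i) (y : K) :
    D.L i * D.proj i y = y • D.proj i y := by
  classical
  have h0 : aeval (D.L i) ((X - C y) * Lagrange.basis D.values id y) = 0 :=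
    h.aeval_eq_zero fun z hz => by
      by_cases hzy : y = z
      · simp [hzy]
      · have := Lagrange.eval_basis_of_ne (v := id) hzy hz
        rw [id] at this
        rw [eval_mul, this, mul_zero]
  rw [map_mul, map_sub, aeval_X, aeval_C, sub_mul, ← Algebra.smul_def] at h0
  exact sub_eq_zero.mp h0

variable (D)

theorem sum_proj (i : ℕ) : ∑ y ∈ D.values, D.proj i y = 1 := by
  classical
  have := Lagrange.sum_basis (s := D.values) (v := id) (Set.injOn_id _) ⟨0, D.zero_mem_values⟩
  simp only [proj]
  rw [← map_sum, this, map_one]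

theorem weightProj_congr {m : ℕ} {α β : ℕ → K} (h : ∀ i < m, α i = β i) :
    D.weightProj m α = D.weightProj m β := by
  induction m with
  | zero => rfl
  | succ m ih => rw [weightProj, weightProj, ih fun i hi => h i (by omega), h m (by omega)]

theorem weightProj_mem_level (m : ℕ) (α : ℕ → K) : D.weightProj m α ∈ D.level m := by
  induction m with
  | zero => exact one_mem _
  | succ m ih =>
    refine mul_mem (D.level_mono (Nat.le_succ m) ih) ?_
    refine (Algebra.adjoin_le ?_ : Algebra.adjoin K {D.L m} ≤ D.level (m + 1))
      (Polynomial.aeval_mem_adjoin_singleton K (D.L m))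
    simpa using D.L_mem_level (Nat.lt_succ_self m)

theorem commute_weightProj {m : ℕ} {α : ℕ → K} {x : A} (h : ∀ i < m, Commute x (D.L i)) :
    Commute x (D.weightProj m α) := by
  induction m with
  | zero => exact Commute.one_right x
  | succ m ih =>
    exact (ih fun i hi => h i (by omega)).mul_right (commute_proj (h m (by omega)) _)

theorem isWeight_weightProj {m : ℕ} (hm : m ≤ n) (hd : ∀ i < m, D.IsDiag i) (α : ℕ → K) :
    D.IsWeight m α (D.weightProj m α) := by
  induction m with
  | zero => exact fun i hi => absurd hi (by omega)
  | succ m ih =>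
    have ih := ih (by omega) fun i hi => hd i (by omega)
    intro i hi
    rcases Nat.lt_succ_iff_lt_or_eq.mp hi with h | rfl
    · rw [weightProj, ← mul_assoc, ih i h, smul_mul_assoc]
    · rw [weightProj, ← mul_assoc, (D.commute_weightProj fun j hj =>
        D.commute_L_L (by omega) (by omega)).eq, mul_assoc, (hd i hi).L_mul_proj, mul_smul_comm]

/-- The projections `weightProj m α` sum up to the identity; this is the form in which that is
used. -/
theorem mul_mem_of_forall_weightProj {S : Submodule K A} {a c : A} (m : ℕ)
    (h : ∀ α : ℕ → K, (∀ i < m, α i ∈ D.values) → a * D.weightProj m α * c ∈ S) : a * c ∈ S := by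
  induction m with
  | zero => simpa [weightProj] using h (fun _ => 0) (by simp)
  | succ m ih =>
    refine ih fun α hα => ?_
    have e : a * D.weightProj m α * c =
        ∑ y ∈ D.values, a * D.weightProj (m + 1) (Function.update α m y) * c := by
      rw [← Finset.sum_mul, ← Finset.mul_sum]
      congr 2
      simp only [weightProj, Function.update_self]
      rw [Finset.sum_congr rfl fun y _ => by
        rw [D.weightProj_congr (β := α) fun i hi => Function.update_of_ne (by omega) _ _]]
      rw [← Finset.mul_sum, D.sum_proj, mul_one]
    rw [e]
    refine Submodule.sum_mem _ fun y hy => h _ fun i hi => ?_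
    by_cases him : i = m
    · subst him; rwa [Function.update_self]
    · rw [Function.update_of_ne him]; exact hα i (by omega)

variable {D}

/-- Along a link of content words a nonzero weight vector is moved to a nonzero weight vector. -/
theorem exists_weight_of_linked (hq : ∀ i : ℕ, 1 ≤ i → i ≤ n → D.q ^ i ≠ 1) {M N : ℕ}
    (hMN : M ≤ N) (hN : N ≤ n) {γ γ' : ℕ → Option ℤ} (h : Linked M γ γ')
    (hγ : IsContentWord γ M) {α : ℕ → K} {v : A} (hv : v ≠ 0) (hw : D.IsWeight N α v)
    (hα : ∀ k < M, α k = letterValue D.q (γ k)) :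
    ∃ (a : A) (α' : ℕ → K), a * v ≠ 0 ∧ D.IsWeight N α' (a * v) ∧
      (∀ k < M, α' k = letterValue D.q (γ' k)) ∧ ∀ k, M ≤ k → α' k = α k := by
  induction h generalizing α v with
  | refl γ => exact ⟨1, α, by rwa [one_mul], by rwa [one_mul], hα, fun _ _ => rfl⟩
  | step γ γ' i hi hind _ ih =>
    have p := hind.letterValue_ne D.q_ne_zero hq (hγ M le_rfl)
      (fun s => (sizeLE_letterCount γ M s).trans (by omega))
      (letterCount_pos (by omega)) (letterCount_pos hi)
    rw [← hα i (by omega), ← hα (i + 1) hi] at p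
    have h1 := hw.swapVec (i := i) (by omega) hN p.1
    have h2 := swapVec_ne_zero hv (by omega) p.1 p.2.1 p.2.2
    obtain ⟨a, α', b1, b2, b3, b4⟩ := ih (hγ.swapAt hi hind) h2 h1 (by
      intro k hk
      by_cases k1 : k = i
      · subst k1; rw [swapAt_left, swapAt_left, hα _ hi]
      · by_cases k2 : k = i + 1
        · subst k2; rw [swapAt_right, swapAt_right, hα _ (by omega)]
        · rw [swapAt_of_ne _ k1 k2, swapAt_of_ne _ k1 k2, hα k hk])
    have e : D.swapVec i α v = (D.T i + ((D.q - 1) * α (i + 1) / (α i - α (i + 1))) • 1) * v := by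
      rw [MirabolicSystem.swapVec, add_mul, smul_mul_assoc, one_mul]
    rw [e, ← mul_assoc] at b1 b2
    refine ⟨_, α', b1, b2, b3, fun k hk => ?_⟩
    rw [b4 k hk, swapAt_of_ne _ (by omega) (by omega)]

end MirabolicSystem

/-! ### The weights are the values of content words -/

theorem isProfile_addLetter_none {h : Option ℤ → ℕ} (hh : IsProfile h) :
    IsProfile (addLetter h none) := fun c => by
  rw [addLetter_of_ne _ (by simp), addLetter_of_ne _ (by simp)]
  exact hh c

namespace MirabolicSystem

variable {K A : Type} [Field K] [Ring A] [Algebra K A] {n : ℕ} (D : MirabolicSystem K A n)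

open Polynomial

/-- The first `m` Jucys-Murphy elements are diagonalizable, and their weights are the values of
content words. -/
def IsControlled (m : ℕ) : Prop :=
  (∀ i < m, D.IsDiag i) ∧ ∀ (α : ℕ → K) (v : A), v ≠ 0 → D.IsWeight m α v →
    ∃ γ, IsContentWord γ m ∧ ∀ k < m, α k = letterValue D.q (γ k)

variable {D}

theorem isWeight_proj_mul {i : ℕ} (hi : i < n) (hd : D.IsDiag i) {α : ℕ → K} {w : A}
    (hw : D.IsWeight i α w) (y : K) :
    D.IsWeight (i + 1) (Function.update α i y) (D.proj i y * w) := by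
  intro k hk
  rcases Nat.lt_succ_iff_lt_or_eq.mp hk with h | rfl
  · rw [Function.update_of_ne h.ne, ← mul_assoc, (commute_proj (D.commute_L_L (by omega) hi) y).eq,
      mul_assoc, hw k h, mul_smul_comm]
  · rw [Function.update_self, ← mul_assoc, hd.L_mul_proj, smul_mul_assoc]

/-- If `L_i` is diagonalizable and acts by `0`, then `L_{i+1}` has no nilpotent Jordan block. -/
theorem mul_eq_zero_of_cube {i : ℕ} (hi : i + 1 < n) (hd : D.IsDiag i) {u : A}
    (ha : D.L i * u = 0) (hb : D.L (i + 1) * (D.L (i + 1) * (D.L (i + 1) * u)) = 0) :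
    D.L (i + 1) * u = 0 := by
  set a := D.L i
  set b := D.L (i + 1)
  set T := D.T i
  set S := T - (D.q - 1) • (1 : A)
  have hab : Commute a b := D.commute_L_L (by omega) hi
  have haT : a * T = S * b := D.L_mul_T hi
  have hab0 : ∀ w, a * w = 0 → a * (b * w) = 0 := fun w hw => by
    rw [← mul_assoc, hab.eq, mul_assoc, hw, mul_zero]
  have h1 : a * (T * u) = S * (b * u) := by rw [← mul_assoc, haT, mul_assoc]
  have step : ∀ w, a * w = 0 → a * (S * w) = S * (b * w) := fun w hw => by
    rw [sub_mul, mul_sub, ← mul_assoc, haT, smul_mul_assoc, one_mul, mul_smul_comm, hw, smul_zero,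
      sub_zero, mul_assoc]
  have h2 : a * (a * (T * u)) = S * (b * (b * u)) := by rw [h1, step _ (hab0 _ ha)]
  have h3 : a * (a * (a * (T * u))) = 0 := by
    rw [h2, step _ (hab0 _ (hab0 _ ha)), hb, mul_zero]
  have kill : ∀ w, a * (a * w) = 0 → a * w = 0 := fun w hw => by
    have := hd.mul_eq_of_sq (x := 0) (w := w) (by simpa using hw)
    simpa using this
  have h4 := kill _ (kill _ h3)
  rw [h1] at h4
  exact D.sub_mul_eq_zero hi h4

/-- On a vector whose weight is the value of the content word `γ` of length `i + 1`, the element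
`L_{i+1}` is killed by a polynomial with simple roots. A root is the value of a letter that can be
added to `γ` with its last letter removed, or of a neighbour of the last letter. -/
theorem IsControlled.exists_roots (hq : ∀ i : ℕ, 1 ≤ i → i ≤ n → D.q ^ i ≠ 1) (hn : 2 ≤ n)
    {i : ℕ} (hi : i + 1 < n) (hc : D.IsControlled (i + 1)) {α : ℕ → K} {v : A}
    (hv : v ≠ 0) (hw : D.IsWeight (i + 1) α v) {γ : ℕ → Option ℤ} (hγ : IsContentWord γ (i + 1))
    (hα : ∀ k < i + 1, α k = letterValue D.q (γ k)) :
    ∃ F ⊆ D.values,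
      (∀ y ∈ F, (∃ d, IsProfile (addLetter (letterCount γ i) d) ∧ y = letterValue D.q d) ∨
        ∃ c d : ℤ, γ i = some c ∧ (d = c + 1 ∨ d + 1 = c) ∧ y = letterValue D.q (some d)) ∧
      aeval (D.L (i + 1)) (∏ y ∈ F, (X - C y)) * v = 0 := by
  classical
  have hq0 := D.q_ne_zero
  set E := D.values.filter fun y => ∃ w : A, w ≠ 0 ∧ D.IsWeight (i + 1) (Function.update α i y) w
    with hE
  have hEd : ∀ y ∈ E, ∃ d, IsProfile (addLetter (letterCount γ i) d) ∧ y = letterValue D.q d := by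
    intro y hy
    obtain ⟨-, w, hw0, hww⟩ := Finset.mem_filter.mp hy
    obtain ⟨γ', h1, h2⟩ := hc.2 _ w hw0 hww
    have h3 := contentWord_unique hq0 hq (by omega : i ≤ n) (hγ.mono (by omega))
      (h1.mono (by omega)) (fun k hk => by
        rw [← hα k (by omega), ← h2 k (by omega), Function.update_of_ne hk.ne])
    refine ⟨γ' i, ?_, ?_⟩
    · rw [letterCount_congr h3]
      exact h1 (i + 1) le_rfl
    · rw [← h2 i (by omega), Function.update_self]
  have hR : ∀ w, D.IsWeight i α w → aeval (D.L i) (∏ y ∈ E, (X - C y)) * w = 0 := by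
    intro w hww
    rw [show w = ∑ y ∈ D.values, D.proj i y * w by rw [← Finset.sum_mul, D.sum_proj, one_mul],
      Finset.mul_sum]
    refine Finset.sum_eq_zero fun y hy => ?_
    have hd := hc.1 i (by omega)
    by_cases h0 : D.proj i y * w = 0
    · rw [h0, mul_zero]
    · have hyE : y ∈ E := Finset.mem_filter.mpr ⟨hy, _, h0, isWeight_proj_mul (by omega) hd hww y⟩
      rw [aeval_mul_of_mul_eq_smul (by rw [← mul_assoc, hd.L_mul_proj, smul_mul_assoc]),
        eval_prod, Finset.prod_eq_zero hyE (by simp), zero_smul]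
  have key := hw.aeval_succ_mul hi hR
  have hαi : α i = letterValue D.q (γ i) := hα i (by omega)
  rcases hγi : γ i with _ | c
  · have hx : α i = 0 := by rw [hαi, hγi]; rfl
    have h0E : (0 : K) ∈ E := by
      refine Finset.mem_filter.mpr ⟨D.zero_mem_values, v, hv, ?_⟩
      rwa [← hx, Function.update_eq_self]
    refine ⟨E, Finset.filter_subset _ _, fun y hy => Or.inl (hEd y hy), ?_⟩
    have hai := hw i (by omega)
    rw [hx, zero_smul] at hai
    rw [hx, ← Finset.mul_prod_erase E _ h0E] at key
    rw [← Finset.mul_prod_erase E _ h0E]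
    have e : (C (D.q * 0) - X) * (C 0 - C D.q * X) *
        ((X - C 0) * ∏ y ∈ E.erase 0, (X - C y)) =
        C D.q * (X * (X * (X * ∏ y ∈ E.erase 0, (X - C y)))) := by
      simp only [mul_zero, map_zero, zero_sub, sub_zero]; ring
    rw [e, map_mul, aeval_C, mul_assoc, ← Algebra.smul_def] at key
    have key := (smul_eq_zero.mp key).resolve_left hq0
    simp only [map_mul, aeval_X, mul_assoc] at key
    rw [map_zero, sub_zero, map_mul, aeval_X, mul_assoc]
    refine mul_eq_zero_of_cube hi (hc.1 i (by omega)) ?_ key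
    rw [← mul_assoc, (commute_aeval_L (D.commute_L_L (by omega) hi) _).eq, mul_assoc, hai, mul_zero]
  · have hx : α i = D.q ^ c := by rw [hαi, hγi]; rfl
    have hp : IsProfile (addLetter (letterCount γ i) (some c)) := hγi ▸ hγ (i + 1) le_rfl
    have hs := sizeLE_letterCount γ i
    have hg : IsProfile (letterCount γ i) := hγ i (by omega)
    -- The neighbours of an addable content are not values of addable letters.
    have hnot : ∀ d : ℤ, d = c + 1 ∨ d + 1 = c → D.q ^ d ∉ E := by
      intro d hd hdE
      obtain ⟨b, hb, e⟩ := hEd _ hdE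
      rcases b with _ | b
      · exact zpow_ne_zero d hq0 e
      · change D.q ^ d = D.q ^ b at e
        have hbd : b ≠ d := by
          rintro rfl
          rcases hd with rfl | rfl
          · exact not_addable_succ hp hb
          · exact not_addable_succ hb hp
        refine hbd ?_
        by_cases hbc : b = c
        · exact (eq_of_zpow_eq hq0 hq (by omega) (by omega) e).symm
        · have hpp := (IsProfile.of_indep (indep_of_addable (by simpa using Ne.symm hbc) hp hb)
            (Or.inl hg) hp hb).2
          have hss := (hs.addLetter (some c)).addLetter (some b)
          have b1 := hpp.sub_lt hss (c := c) (d := b) (by simp [addLetter]) (by simp [addLetter])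
          have b2 := hpp.sub_lt hss (c := b) (d := c) (by simp [addLetter]) (by simp [addLetter])
          push_cast at b1 b2
          exact (eq_of_zpow_eq hq0 hq (by omega) (by omega) e).symm
    have hmem : ∀ d : ℤ, d = c + 1 ∨ d + 1 = c → D.q ^ d ∈ D.values := by
      intro d hd
      have hss := hs.addLetter (some c)
      have hcpos : 0 < addLetter (letterCount γ i) (some c) (some c) := by simp [addLetter]
      have b1 := hp.sub_lt hss hcpos (hp.pos_zero hcpos)
      have b2 := hp.sub_lt hss (hp.pos_zero hcpos) hcpos
      push_cast at b1 b2
      exact D.zpow_mem_values (by omega) (by omega)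
    have hne : D.q ^ (c + 1) ∉ insert (D.q ^ (c - 1)) E := by
      rw [Finset.mem_insert, not_or]
      refine ⟨fun e => ?_, hnot _ (Or.inl rfl)⟩
      have := eq_of_zpow_eq hq0 hq (by omega) (by omega) e
      omega
    refine ⟨insert (D.q ^ (c + 1)) (insert (D.q ^ (c - 1)) E), ?_, ?_, ?_⟩
    · refine Finset.insert_subset (hmem _ (Or.inl rfl)) (Finset.insert_subset
        (hmem _ (Or.inr (by ring))) (Finset.filter_subset _ _))
    · intro y hy
      rw [Finset.mem_insert, Finset.mem_insert] at hy
      rcases hy with rfl | rfl | hy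
      · exact Or.inr ⟨c, c + 1, rfl, Or.inl rfl, rfl⟩
      · exact Or.inr ⟨c, c - 1, rfl, Or.inr (by ring), rfl⟩
      · exact Or.inl (hEd y hy)
    · rw [Finset.prod_insert hne, Finset.prod_insert (hnot _ (Or.inr (by ring)))]
      have e : (C (D.q * α i) - X) * (C (α i) - C D.q * X) * ∏ y ∈ E, (X - C y) =
          C D.q * ((X - C (D.q ^ (c + 1))) * ((X - C (D.q ^ (c - 1))) * ∏ y ∈ E, (X - C y))) := by
        rw [hx, zpow_add_one₀ hq0, zpow_sub_one₀ hq0]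
        have h1 : C (D.q ^ c) = C D.q * C (D.q ^ c * D.q⁻¹) := by
          rw [← C_mul, mul_left_comm, mul_inv_cancel₀ hq0, mul_one]
        rw [show (C (D.q ^ c) - C D.q * X : K[X]) = C D.q * (C (D.q ^ c * D.q⁻¹) - X) by
          rw [mul_sub, ← h1], mul_comm (D.q) (D.q ^ c)]
        ring
      rw [e, map_mul, aeval_C, mul_assoc, ← Algebra.smul_def] at key
      exact (smul_eq_zero.mp key).resolve_left hq0

end MirabolicSystem

namespace MirabolicSystem

variable {K A : Type} [Field K] [Ring A] [Algebra K A] {n : ℕ} {D : MirabolicSystem K A n}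

open Polynomial

theorem isProfile_zero : IsProfile 0 := fun c => by simp

theorem isControlled_zero : D.IsControlled 0 :=
  ⟨fun i hi => absurd hi (by omega), fun _ _ _ _ => ⟨fun _ => none, fun k hk => by
    obtain rfl : k = 0 := by omega
    exact isProfile_zero, fun k hk => absurd hk (by omega)⟩⟩

theorem IsControlled.isDiag {m : ℕ} (hm : m < n) (hc : D.IsControlled m)
    (h : ∀ (α : ℕ → K) (v : A), v ≠ 0 → D.IsWeight m α v →
      ∃ F ⊆ D.values, aeval (D.L m) (∏ y ∈ F, (X - C y)) * v = 0) : D.IsDiag m := by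
  classical
  have : (1 : A) * aeval (D.L m) (∏ y ∈ D.values, (X - C y)) ∈ (⊥ : Submodule K A) := by
    refine D.mul_mem_of_forall_weightProj m fun α _ => ?_
    rw [one_mul, Submodule.mem_bot]
    by_cases h0 : D.weightProj m α = 0
    · rw [h0, zero_mul]
    obtain ⟨F, hF, hF0⟩ := h α _ h0 (D.isWeight_weightProj hm.le hc.1 α)
    rw [(commute_aeval_L (D.commute_level_L hm (D.weightProj_mem_level m α)) _).eq,
      ← Finset.prod_sdiff hF, map_mul, mul_assoc, hF0, mul_zero]
  rwa [one_mul, Submodule.mem_bot] at this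

theorem eval_eq_zero_of_weight {m : ℕ} {α : ℕ → K} {v : A} (hv : v ≠ 0)
    (hw : D.L m * v = α m • v) {F : Finset K}
    (h : aeval (D.L m) (∏ y ∈ F, (X - C y)) * v = 0) : α m ∈ F := by
  rw [aeval_mul_of_mul_eq_smul hw, smul_eq_zero, eval_prod, Finset.prod_eq_zero_iff] at h
  obtain ⟨y, hy, e⟩ := h.resolve_right hv
  rw [eval_sub, eval_X, eval_C, sub_eq_zero] at e
  rwa [e]

theorem isContentWord_update {γ : ℕ → Option ℤ} {m : ℕ} (hγ : IsContentWord γ m) {d : Option ℤ}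
    (hd : IsProfile (addLetter (letterCount γ m) d)) :
    IsContentWord (Function.update γ m d) (m + 1) := by
  have e : ∀ k ≤ m, letterCount (Function.update γ m d) k = letterCount γ k := fun k hk =>
    letterCount_congr fun j hj => Function.update_of_ne (by omega) _ _
  intro k hk
  rcases Nat.lt_succ_iff_lt_or_eq.mp (Nat.lt_succ_of_le hk) with h | rfl
  · rw [e k (by omega)]
    exact hγ k (by omega)
  · rw [letterCount, e m le_rfl, Function.update_self]
    exact hd

theorem exists_contentWord_of_addable {m : ℕ} {γ : ℕ → Option ℤ} (hγ : IsContentWord γ m)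
    {α : ℕ → K} (hα : ∀ k < m, α k = letterValue D.q (γ k)) {d : Option ℤ}
    (hd : IsProfile (addLetter (letterCount γ m) d)) (e : α m = letterValue D.q d) :
    ∃ γ, IsContentWord γ (m + 1) ∧ ∀ k < m + 1, α k = letterValue D.q (γ k) := by
  refine ⟨_, isContentWord_update hγ hd, fun k hk => ?_⟩
  rcases Nat.lt_succ_iff_lt_or_eq.mp hk with h | rfl
  · rw [Function.update_of_ne h.ne, hα k h]
  · rw [Function.update_self, e]

theorem isControlled_one (hn : 0 < n) : D.IsControlled 1 := by
  classical
  have hF : aeval (D.L 0) (∏ y ∈ ({0, 1} : Finset K), (X - C y)) = 0 := by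
    rw [Finset.prod_pair zero_ne_one]
    simp only [map_mul, map_sub, aeval_X, map_zero, map_one, sub_zero, L_zero, mul_sub, D.idem,
      mul_one, sub_self]
  have hFs : ({0, 1} : Finset K) ⊆ D.values := by
    intro y hy
    rcases Finset.mem_insert.mp hy with rfl | hy
    · exact D.zero_mem_values
    · rw [Finset.mem_singleton.mp hy, ← zpow_zero D.q]
      exact D.zpow_mem_values (by omega) (by omega)
  refine ⟨fun i hi => ?_, fun α v hv hw => ?_⟩
  · obtain rfl : i = 0 := by omega
    exact isControlled_zero.isDiag hn fun α v _ _ => ⟨_, hFs, by rw [hF, zero_mul]⟩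
  · have := eval_eq_zero_of_weight hv (hw 0 (by omega)) (by rw [hF, zero_mul])
    have h0 : IsContentWord (fun _ => none) 0 := fun k hk => by
      obtain rfl : k = 0 := by omega
      exact isProfile_zero
    rcases Finset.mem_insert.mp this with h | h
    · exact exists_contentWord_of_addable h0 (fun k hk => absurd hk (by omega)) (d := none)
        (isProfile_addLetter_none isProfile_zero) h
    · rw [Finset.mem_singleton] at h
      refine exists_contentWord_of_addable h0 (fun k hk => absurd hk (by omega)) (d := some 0)
        (fun c => ?_) (by rw [h, letterValue, zpow_zero])
      simp only [letterCount, addLetter, Pi.zero_apply, Option.some.injEq]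
      split_ifs <;> omega

theorem IsControlled.succ (hq : ∀ i : ℕ, 1 ≤ i → i ≤ n → D.q ^ i ≠ 1) {i : ℕ} (hi : i + 1 < n)
    (hc : D.IsControlled (i + 1)) : D.IsControlled (i + 2) := by
  have hn : 2 ≤ n := by omega
  have hq1 : D.q ≠ 1 := by simpa using hq 1 le_rfl (by omega)
  have hq2 : D.q ^ 2 ≠ 1 := hq 2 (by omega) hn
  have hd : ∀ k < i + 2, D.IsDiag k := by
    intro k hk
    rcases Nat.lt_succ_iff_lt_or_eq.mp hk with h | rfl
    · exact hc.1 k h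
    · refine hc.isDiag hi fun α v hv hw => ?_
      obtain ⟨γ, hγ, hα⟩ := hc.2 α v hv hw
      obtain ⟨F, h1, -, h2⟩ := hc.exists_roots hq hn hi hv hw hγ hα
      exact ⟨F, h1, h2⟩
  refine ⟨hd, fun α v hv hw => ?_⟩
  have hw' := hw.mono (show i + 1 ≤ i + 2 by omega)
  obtain ⟨γ, hγ, hα⟩ := hc.2 α v hv hw'
  obtain ⟨F, -, h1, h2⟩ := hc.exists_roots hq hn hi hv hw' hγ hα
  have hp : IsProfile (addLetter (letterCount γ i) (γ i)) := hγ (i + 1) le_rfl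
  have hg : IsProfile (letterCount γ i) := hγ i (by omega)
  rcases h1 _ (eval_eq_zero_of_weight hv (hw (i + 1) (by omega)) h2) with
    ⟨d, hd1, e⟩ | ⟨c, d, hγi, hcd, e⟩
  · by_cases hne : γ i = d
    · subst hne
      rcases hγi : γ i with _ | c
      · rw [hγi] at e
        exact exists_contentWord_of_addable hγ hα (isProfile_addLetter_none hp) e
      · refine absurd (hw.eq_zero_of_eq (hd i (by omega)) hq1 (by omega) (by omega) ?_ ?_) hv
        · rw [e, hα i (by omega)]
        · rw [hα i (by omega), hγi]
          exact letterValue_some_ne_zero D.q_ne_zero c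
    · exact exists_contentWord_of_addable hγ hα
        (IsProfile.of_indep (indep_of_addable hne hp hd1) (Or.inl hg) hp hd1).2 e
  · by_cases hadd : IsProfile (addLetter (letterCount γ (i + 1)) (some d))
    · exact exists_contentWord_of_addable hγ hα hadd e
    · exfalso
      rw [letterCount, hγi] at hadd
      rw [hγi] at hp
      obtain ⟨g', hg', hg'e⟩ := removable_of_not_addable hcd hg hp hadd
      rcases i with _ | i
      · have := congrFun hg'e (some d)
        rw [addLetter_self, letterCount] at this
        exact absurd this.symm (by simp)
      -- Moving a letter `d` next to the last letter produces the weight `d, c, d`.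
      obtain ⟨γ', hl, hlast⟩ := exists_linked_last i (hγ.mono (by omega)) hg' hg'e
      obtain ⟨a, α', b1, b2, b3, b4⟩ := exists_weight_of_linked hq (N := i + 3) (by omega)
        (by omega) hl (hγ.mono (by omega)) hv hw (fun k hk => hα k (by omega))
      have v0 : α' i = letterValue D.q (some d) := by rw [b3 i (by omega), hlast]
      have v1 : α' (i + 1) = D.q ^ c := by
        rw [b4 (i + 1) le_rfl, hα (i + 1) (by omega), hγi]; rfl
      have v2 : α' (i + 2) = letterValue D.q (some d) := by rw [b4 (i + 2) (by omega), e]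
      refine b1 (b2.eq_zero_of_alternating (i := i) (hd i (by omega)) (hd (i + 1) (by omega)) hq1
        hq2 (by omega) (by omega) (v0.trans v2.symm) ?_ ?_)
      · rw [v0]
        exact letterValue_some_ne_zero D.q_ne_zero d
      · rw [v0, v1, letterValue, ← zpow_one_add₀ D.q_ne_zero, ← zpow_one_add₀ D.q_ne_zero]
        rcases hcd with rfl | rfl
        · exact Or.inr (by rw [add_comm])
        · exact Or.inl (by rw [add_comm])

/-- If `q` is not a root of unity of order at most `n`, all Jucys-Murphy elements are
diagonalizable and their weights are the values of content words. -/
theorem isControlled (hn : 2 ≤ n) (hq : ∀ i : ℕ, 1 ≤ i → i ≤ n → D.q ^ i ≠ 1) :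
    D.IsControlled n := by
  have : ∀ i, i + 1 ≤ n → D.IsControlled (i + 1) := by
    intro i
    induction i with
    | zero => exact fun _ => isControlled_one (by omega)
    | succ i ih => exact fun h => (ih (by omega)).succ hq h
  have h := this (n - 1) (by omega)
  rwa [Nat.sub_add_cancel (by omega)] at h

end MirabolicSystem

namespace MirabolicSystem

variable {K A : Type} [Field K] [Ring A] [Algebra K A] {n : ℕ} {D : MirabolicSystem K A n}

/-! ### Weight spaces of the weight projections are one-dimensional -/

open Polynomial in
theorem IsDiag.proj_mul_self {i : ℕ} (h : D.IsDiag i) (y : K) :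
    D.proj i y * D.proj i y = D.proj i y := by
  classical
  have h0 : aeval (D.L i) (Lagrange.basis D.values id y * Lagrange.basis D.values id y
      - Lagrange.basis D.values id y) = 0 :=
    h.aeval_eq_zero fun z hz => by
      rw [eval_sub, eval_mul]
      by_cases hzy : y = z
      · subst hzy
        have := Lagrange.eval_basis_self (v := id) (Set.injOn_id (D.values : Set K)) hz
        rw [id] at this
        rw [this, mul_one, sub_self]
      · have := Lagrange.eval_basis_of_ne (v := id) hzy hz
        rw [id] at this
        rw [this, mul_zero, sub_zero]
  rw [map_sub, map_mul] at h0
  exact sub_eq_zero.mp h0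

theorem commute_weightProj_L {M k : ℕ} (hM : M ≤ n) (hk : k < n) (α : ℕ → K) :
    Commute (D.weightProj M α) (D.L k) :=
  (D.commute_weightProj fun _ hi => D.commute_L_L hk (by omega)).symm

theorem weightProj_mul_self {M : ℕ} (hM : M ≤ n) (hd : ∀ i < M, D.IsDiag i) (α : ℕ → K) :
    D.weightProj M α * D.weightProj M α = D.weightProj M α := by
  induction M with
  | zero => exact one_mul _
  | succ M ih =>
    have hc : Commute (D.weightProj M α) (D.proj M (α M)) :=
      commute_proj (commute_weightProj_L (by omega) (by omega) α) _
    rw [weightProj, mul_assoc, ← mul_assoc (D.proj M (α M)), ← hc.eq, mul_assoc,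
      (hd M (by omega)).proj_mul_self, ← mul_assoc, ih (by omega) fun i hi => hd i (by omega)]

theorem weightProj_mul_L {M k : ℕ} (hM : M ≤ n) (hd : ∀ i < M, D.IsDiag i) (hk : k < M)
    (α : ℕ → K) : D.weightProj M α * D.L k = α k • D.weightProj M α := by
  rw [(commute_weightProj_L hM (by omega) α).eq]
  exact D.isWeight_weightProj hM hd α k hk

theorem weightProj_mul_of_weight_ne {M k : ℕ} (hM : M ≤ n) (hd : ∀ i < M, D.IsDiag i) (hk : k < M)
    {α β : ℕ → K} (h : α k ≠ β k) {w : A} (hw : D.IsWeight M β w) : D.weightProj M α * w = 0 := by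
  have h1 : D.weightProj M α * (D.L k * w) = α k • (D.weightProj M α * w) := by
    rw [← mul_assoc, weightProj_mul_L hM hd hk, smul_mul_assoc]
  rw [hw k hk, mul_smul_comm, ← sub_eq_zero, ← sub_smul, smul_eq_zero] at h1
  exact h1.resolve_left (sub_ne_zero.mpr h.symm)

/-- The generator `T_i` maps a weight space to the sum of itself and the one with the weights in
the positions `i` and `i + 1` exchanged. -/
theorem eq_or_eq_swapAt {M i : ℕ} (hM : M ≤ n) (hd : ∀ i < M, D.IsDiag i) (hi : i + 1 < M)
    {α β : ℕ → K} (h : D.weightProj M α * D.T i * D.weightProj M β ≠ 0) :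
    (∀ k < M, α k = β k) ∨ ∀ k < M, α k = swapAt β i k := by
  by_cases hαβ : ∀ k < M, α k = β k
  · exact Or.inl hαβ
  right
  push Not at hαβ
  obtain ⟨k₀, hk₀, hne⟩ := hαβ
  have hβ := D.isWeight_weightProj hM hd β
  have horth := weightProj_mul_of_weight_ne hM hd hk₀ hne hβ
  have cancel : ∀ c d : K, c • (D.weightProj M α * D.T i * D.weightProj M β) =
      d • (D.weightProj M α * D.T i * D.weightProj M β) → c = d := fun c d e => by
    rw [← sub_eq_zero, ← sub_smul, smul_eq_zero] at e
    exact sub_eq_zero.mp (e.resolve_right h)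
  have left : ∀ k < M, D.weightProj M α * (D.L k * D.T i) * D.weightProj M β =
      α k • (D.weightProj M α * D.T i * D.weightProj M β) := fun k hk => by
    rw [← mul_assoc, weightProj_mul_L hM hd hk, smul_mul_assoc, smul_mul_assoc]
  have right : ∀ k < M, D.weightProj M α * (D.T i * D.L k) * D.weightProj M β =
      β k • (D.weightProj M α * D.T i * D.weightProj M β) := fun k hk => by
    rw [mul_assoc, mul_assoc (D.T i), hβ k hk, mul_smul_comm, mul_smul_comm, mul_assoc]
  have zero : ∀ k < M, D.weightProj M α * D.L k * D.weightProj M β = 0 := fun k hk => by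
    rw [mul_assoc, hβ k hk, mul_smul_comm, horth, smul_zero]
  intro k hk
  by_cases k1 : k = i
  · subst k1
    rw [swapAt_left]
    refine cancel _ _ ?_
    rw [← left k hk, ← right (k + 1) hi, D.L_mul_T' (by omega), mul_sub, sub_mul, mul_smul_comm,
      smul_mul_assoc, zero (k + 1) hi, smul_zero, sub_zero]
  · by_cases k2 : k = i + 1
    · subst k2
      rw [swapAt_right]
      refine cancel _ _ ?_
      rw [← left (i + 1) hk, ← right i (by omega), D.L_succ_mul_T (by omega), mul_add, add_mul,
        mul_smul_comm, smul_mul_assoc, zero (i + 1) hi, smul_zero, add_zero]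
    · rw [swapAt_of_ne β k1 k2]
      refine cancel _ _ ?_
      rw [← left k hk, ← right k hk]
      have hc : Commute (D.T i) (D.L k) := by
        rcases Nat.lt_or_ge k i with hlt | hge
        · exact D.commute_T_L_of_lt hlt (by omega)
        · exact D.commute_T_L_of_gt (by omega) (by omega)
      rw [hc.eq]

theorem weightProj_T_weightProj {M i : ℕ} (hM : M ≤ n) (hd : ∀ i < M, D.IsDiag i)
    (hq1 : D.q ≠ 1) (hi : i + 1 < M) (α : ℕ → K) :
    ∃ c : K, D.weightProj M α * D.T i * D.weightProj M α = c • D.weightProj M α := by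
  have hα := D.isWeight_weightProj hM hd α
  have hsq := weightProj_mul_self hM hd α
  by_cases hne : α i = α (i + 1)
  · by_cases h0 : α i = 0
    · refine ⟨-1, ?_⟩
      rw [mul_assoc, (hα.mono hi).T_mul_of_zero_zero (by omega) h0 (hne ▸ h0), mul_neg, hsq,
        neg_one_smul]
    · refine ⟨0, ?_⟩
      rw [hα.eq_zero_of_eq (hd i (by omega)) hq1 hi hM hne h0, mul_zero, smul_zero]
  · refine ⟨(α i - α (i + 1))⁻¹ * -((D.q - 1) * α (i + 1)), ?_⟩
    have hne' := sub_ne_zero.mpr hne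
    have e1 : D.weightProj M α * (D.L i * D.T i) * D.weightProj M α =
        α i • (D.weightProj M α * D.T i * D.weightProj M α) := by
      rw [← mul_assoc, weightProj_mul_L hM hd (by omega), smul_mul_assoc, smul_mul_assoc]
    rw [D.L_mul_T' (by omega), mul_sub, sub_mul, mul_assoc, mul_assoc (D.T i), hα _ hi,
      mul_smul_comm, mul_smul_comm, mul_smul_comm, smul_mul_assoc, mul_assoc _ (D.L (i + 1)),
      hα _ hi, mul_smul_comm, hsq, ← mul_assoc] at e1
    rw [mul_smul, ← smul_right_injective A hne' |>.eq_iff, smul_smul, smul_smul,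
      mul_inv_cancel₀ hne', one_mul, sub_smul, ← e1]
    module

variable (D)

/-- The double coset decomposition: `level i · L_i^k` and `level i · T_{i-1} · level i` span
`level (i + 1)`. -/
def cosetSpan (i : ℕ) : Submodule K A :=
  Submodule.span K ({z | ∃ x ∈ D.level i, ∃ k : ℕ, z = x * D.L i ^ k} ∪
    {z | ∃ x ∈ D.level i, ∃ y ∈ D.level i, ∃ j, j + 1 = i ∧ z = x * D.T j * y})

variable {D}

theorem level_mul_mem_cosetSpan {i : ℕ} {x z : A} (hx : x ∈ D.level i)
    (hz : z ∈ D.cosetSpan i) : x * z ∈ D.cosetSpan i := by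
  induction hz using Submodule.span_induction with
  | mem z hz =>
    refine Submodule.subset_span ?_
    rcases hz with ⟨x', hx', k, rfl⟩ | ⟨x', hx', y, hy, j, hj, rfl⟩
    · exact Or.inl ⟨x * x', mul_mem hx hx', k, by rw [mul_assoc]⟩
    · exact Or.inr ⟨x * x', mul_mem hx hx', y, hy, j, hj, by simp only [mul_assoc]⟩
  | zero => rw [mul_zero]; exact zero_mem _
  | add a b _ _ ha hb => rw [mul_add]; exact add_mem ha hb
  | smul c a _ ha => rw [mul_smul_comm]; exact Submodule.smul_mem _ _ ha

theorem mul_level_mem_cosetSpan {i : ℕ} (hi : i < n) {x z : A} (hx : x ∈ D.level i)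
    (hz : z ∈ D.cosetSpan i) : z * x ∈ D.cosetSpan i := by
  induction hz using Submodule.span_induction with
  | mem z hz =>
    refine Submodule.subset_span ?_
    rcases hz with ⟨x', hx', k, rfl⟩ | ⟨x', hx', y, hy, j, hj, rfl⟩
    · refine Or.inl ⟨x' * x, mul_mem hx' hx, k, ?_⟩
      rw [mul_assoc, mul_assoc, ((D.commute_level_L hi hx).pow_right k).eq]
    · exact Or.inr ⟨x', hx', y * x, mul_mem hy hx, j, hj, by simp only [mul_assoc]⟩
  | zero => rw [zero_mul]; exact zero_mem _
  | add a b _ _ ha hb => rw [add_mul]; exact add_mem ha hb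
  | smul c a _ ha => rw [smul_mul_assoc]; exact Submodule.smul_mem _ _ ha

theorem adjoin_le_submodule {s : Set A} {N : Submodule K A} (h1 : 1 ∈ N)
    (hs : ∀ x ∈ s, ∀ z ∈ N, x * z ∈ N) {x : A} (hx : x ∈ Algebra.adjoin K s) : x ∈ N := by
  have : ∀ z ∈ N, x * z ∈ N := by
    induction hx using Algebra.adjoin_induction with
    | mem x hx => exact hs x hx
    | algebraMap r =>
      intro z hz
      rw [← Algebra.smul_def]
      exact N.smul_mem r hz
    | add x y _ _ hx hy => intro z hz; rw [add_mul]; exact add_mem (hx z hz) (hy z hz)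
    | mul x y _ _ hx hy => intro z hz; rw [mul_assoc]; exact hx _ (hy z hz)
  simpa using this 1 h1

theorem level_le_cosetSpan {i : ℕ} (hi : i < n) {x : A} (hx : x ∈ D.level (i + 1)) :
    x ∈ D.cosetSpan i := by
  have hone : ∀ i, (1 : A) ∈ D.cosetSpan i := fun i =>
    Submodule.subset_span (Or.inl ⟨1, one_mem _, 0, by simp⟩)
  induction i generalizing x with
  | zero =>
    refine adjoin_le_submodule (hone 0) ?_ hx
    rintro x (⟨rfl, -⟩ | ⟨j, hj, rfl⟩) z hz
    · induction hz using Submodule.span_induction with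
      | mem z hz =>
        refine Submodule.subset_span ?_
        rcases hz with ⟨x', hx', k, rfl⟩ | ⟨x', hx', y, hy, j, hj, rfl⟩
        · refine Or.inl ⟨x', hx', k + 1, ?_⟩
          rw [pow_succ', ← mul_assoc, ← mul_assoc, ← D.L_zero, (D.commute_level_L hi hx').eq]
        · omega
      | zero => rw [mul_zero]; exact zero_mem _
      | add a b _ _ ha hb => rw [mul_add]; exact add_mem ha hb
      | smul c a _ ha => rw [mul_smul_comm]; exact Submodule.smul_mem _ _ ha
    · omega
  | succ i ih =>
    set a := D.L i
    set b := D.L (i + 1)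
    set T := D.T i
    have haT : a * T = T * b - (D.q - 1) • b := D.L_mul_T' hi
    have haB : a ∈ D.level (i + 1) := D.L_mem_level (Nat.lt_succ_self i)
    have hTmem : ∀ x ∈ D.level (i + 1), ∀ y ∈ D.level (i + 1), x * T * y ∈ D.cosetSpan (i + 1) :=
      fun x hx y hy => Submodule.subset_span (Or.inr ⟨x, hx, y, hy, i, rfl, rfl⟩)
    -- the part of the span without Hecke generator
    set N : Submodule K A :=
      Submodule.span K {z | ∃ x ∈ D.level (i + 1), ∃ k : ℕ, z = x * b ^ k}
    have hNle : N ≤ D.cosetSpan (i + 1) := Submodule.span_mono Set.subset_union_left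
    have hNb : ∀ z ∈ N, z * b ∈ N := by
      intro z hz
      induction hz using Submodule.span_induction with
      | mem z hz =>
        obtain ⟨x, hx, k, rfl⟩ := hz
        exact Submodule.subset_span ⟨x, hx, k + 1, by rw [pow_succ, mul_assoc]⟩
      | zero => rw [zero_mul]; exact zero_mem _
      | add u v _ _ hu hv => rw [add_mul]; exact add_mem hu hv
      | smul c u _ hu => rw [smul_mul_assoc]; exact Submodule.smul_mem _ _ hu
    have hTb : ∀ k : ℕ, T * b ^ k - a ^ k * T ∈ N := by
      intro k
      induction k with
      | zero => simp
      | succ k ihk =>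
        have e : T * b ^ (k + 1) - a ^ (k + 1) * T =
            (T * b ^ k - a ^ k * T) * b + (D.q - 1) • (a ^ k * b ^ 1) := by
          rw [pow_succ, pow_succ, mul_assoc (a ^ k), haT, sub_mul, mul_sub, pow_one,
            mul_smul_comm, mul_assoc, mul_assoc]
          abel
        rw [e]
        exact add_mem (hNb _ ihk) (N.smul_mem _ (Submodule.subset_span
          ⟨a ^ k, pow_mem haB k, 1, rfl⟩))
    have hTN : ∀ z ∈ N, T * z ∈ D.cosetSpan (i + 1) := by
      intro z hz
      induction hz using Submodule.span_induction with
      | mem z hz =>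
        obtain ⟨x, hx, k, rfl⟩ := hz
        have e : T * (x * b ^ k) = (T * b ^ k - a ^ k * T) * x + a ^ k * T * x := by
          rw [((D.commute_level_L hi hx).pow_right k).eq]
          noncomm_ring
        rw [e]
        exact add_mem (mul_level_mem_cosetSpan hi hx (hNle (hTb k)))
          (hTmem _ (pow_mem haB k) _ hx)
      | zero => rw [mul_zero]; exact zero_mem _
      | add u v _ _ hu hv => rw [mul_add]; exact add_mem hu hv
      | smul c u _ hu => rw [mul_smul_comm]; exact Submodule.smul_mem _ _ hu
    have hTaT : ∀ k : ℕ, T * (a ^ k * T) ∈ D.cosetSpan (i + 1) := by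
      intro k
      have e : T * (a ^ k * T) = (D.q - 1) • (T * (1 * b ^ k)) + D.q • (1 * b ^ k)
          - T * (T * b ^ k - a ^ k * T) := by
        rw [mul_sub, ← mul_assoc T T, D.quad i hi, add_mul, smul_mul_assoc, smul_mul_assoc, one_mul]
        abel
      rw [e]
      have hb : (1 : A) * b ^ k ∈ N := Submodule.subset_span ⟨1, one_mem _, k, rfl⟩
      exact sub_mem (add_mem (Submodule.smul_mem _ _ (hTN _ hb))
        (Submodule.smul_mem _ _ (hNle hb))) (hTN _ (hTb k))
    have hTxT : ∀ x ∈ D.level (i + 1), T * x * T ∈ D.cosetSpan (i + 1) := by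
      intro x hx
      have hx' := ih (by omega) hx
      clear hx
      induction hx' using Submodule.span_induction with
      | mem z hz =>
        have hsub : D.level i ≤ D.level (i + 1) := D.level_mono (Nat.le_succ i)
        rcases hz with ⟨x', hx', k, rfl⟩ | ⟨x', hx', y, hy, j, rfl, rfl⟩
        · have e : T * (x' * a ^ k) * T = x' * (T * (a ^ k * T)) := by
            rw [← mul_assoc T, ← (D.commute_level_T le_rfl hi hx').eq]
            noncomm_ring
          rw [e]
          exact level_mul_mem_cosetSpan (hsub hx') (hTaT k)
        · have e : T * (x' * D.T j * y) * T = (x' * D.T j) * T * (D.T j * y) := by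
            rw [← mul_assoc T, ← mul_assoc T, ← (D.commute_level_T le_rfl hi hx').eq,
              mul_assoc _ y, (D.commute_level_T le_rfl hi hy).eq]
            calc _ = x' * (T * D.T j * T) * y := by noncomm_ring
              _ = _ := by rw [← D.braid j hi]; noncomm_ring
          rw [e]
          exact hTmem _ (mul_mem (hsub hx') (D.T_mem_level (by omega))) _
            (mul_mem (D.T_mem_level (by omega)) (hsub hy))
      | zero => simp
      | add u v _ _ hu hv => rw [mul_add, add_mul]; exact add_mem hu hv
      | smul c u _ hu =>
        rw [mul_smul_comm, smul_mul_assoc]; exact Submodule.smul_mem _ _ hu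
    refine adjoin_le_submodule (hone (i + 1)) ?_ hx
    rintro x (⟨rfl, -⟩ | ⟨j, hj, rfl⟩) z hz
    · exact level_mul_mem_cosetSpan (D.e_mem_level (by omega)) hz
    · rcases Nat.lt_succ_iff_lt_or_eq.mp hj with h | h
      · exact level_mul_mem_cosetSpan (D.T_mem_level h) hz
      · obtain rfl : j = i := by omega
        induction hz using Submodule.span_induction with
        | mem z hz =>
          rcases hz with ⟨x', hx', k, rfl⟩ | ⟨x', hx', y, hy, j', hj', rfl⟩
          · exact hTN _ (Submodule.subset_span ⟨x', hx', k, rfl⟩)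
          · obtain rfl : j' = j := by omega
            rw [← mul_assoc, ← mul_assoc]
            exact mul_level_mem_cosetSpan hi hy (hTxT x' hx')
        | zero => rw [mul_zero]; exact zero_mem _
        | add u v _ _ hu hv => rw [mul_add]; exact add_mem hu hv
        | smul c u _ hu => rw [mul_smul_comm]; exact Submodule.smul_mem _ _ hu

/-- The weight projections of length `m` are primitive in `level m`. -/
theorem weightProj_mul_mul_weightProj (hq1 : D.q ≠ 1) (hd : ∀ i < n, D.IsDiag i) {m : ℕ}
    (hm : m ≤ n) {a : A} (ha : a ∈ D.level m) (α : ℕ → K) :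
    D.weightProj m α * a * D.weightProj m α ∈ Submodule.span K {D.weightProj m α} := by
  induction m generalizing a α with
  | zero =>
    rw [weightProj, one_mul, mul_one]
    refine adjoin_le_submodule (Submodule.mem_span_singleton_self _) ?_ ha
    rintro x (⟨-, h⟩ | ⟨j, hj, -⟩) <;> omega
  | succ m ih =>
    have hdm : ∀ i < m, D.IsDiag i := fun i hi => hd i (by omega)
    have hdm1 : ∀ i < m + 1, D.IsDiag i := fun i hi => hd i (by omega)
    set p := D.weightProj m α
    set π := D.proj m (α m)
    have hπ : π * π = π := (hd m (by omega)).proj_mul_self _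
    have hcomm : ∀ x ∈ D.level m, x * π = π * x := fun x hx =>
      (commute_proj (D.commute_level_L (by omega) hx) _).eq
    have hp : p ∈ D.level m := D.weightProj_mem_level m α
    have key : ∀ x ∈ D.level m, p * x * p * π ∈ Submodule.span K {p * π} := by
      intro x hx
      obtain ⟨c, hc⟩ := Submodule.mem_span_singleton.mp (ih (by omega) hx α)
      rw [← hc, smul_mul_assoc]
      exact Submodule.smul_mem _ _ (Submodule.mem_span_singleton_self _)
    have ha' := level_le_cosetSpan (by omega) ha
    change p * π * a * (p * π) ∈ Submodule.span K {p * π}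
    clear ha
    induction ha' using Submodule.span_induction with
    | mem z hz =>
      rcases hz with ⟨x, hx, k, rfl⟩ | ⟨x, hx, y, hy, j, rfl, rfl⟩
      · have e : D.L m ^ k * (p * π) = α m ^ k • (p * π) := by
          have h1 := D.isWeight_weightProj hm hdm1 α m (Nat.lt_succ_self m)
          have h2 := aeval_mul_of_mul_eq_smul h1 (Polynomial.X ^ k)
          rw [map_pow, Polynomial.aeval_X, Polynomial.eval_pow, Polynomial.eval_X] at h2
          exact h2
        have e2 : p * π * (x * D.L m ^ k) * (p * π) = α m ^ k • (p * x * p * π) := by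
          rw [mul_assoc (p * π), mul_assoc x, e, mul_smul_comm, mul_smul_comm]
          congr 1
          calc p * π * (x * (p * π)) = p * ((π * x) * (p * π)) := by noncomm_ring
            _ = p * x * (π * p) * π := by rw [← hcomm x hx]; noncomm_ring
            _ = p * x * p * (π * π) := by rw [← hcomm p hp]; noncomm_ring
            _ = _ := by rw [hπ]
        rw [e2]
        exact Submodule.smul_mem _ _ (key x hx)
      · have e : p * π * (x * D.T j * y) * (p * π) = (p * x) * (π * D.T j * π * (y * p)) := by
          calc _ = p * (π * x) * D.T j * ((y * p) * π) := by noncomm_ring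
            _ = _ := by rw [← hcomm x hx, hcomm _ (mul_mem hy hp)]; noncomm_ring
        rw [e]
        refine D.mul_mem_of_forall_weightProj (j + 1) fun β _ => ?_
        have e3 : p * x * D.weightProj (j + 1) β * (π * D.T j * π * (y * p)) =
            (p * x * D.weightProj (j + 1) β * (π * D.T j)) * (π * (y * p)) := by noncomm_ring
        rw [e3]
        refine D.mul_mem_of_forall_weightProj (j + 1) fun γ _ => ?_
        have hwp : ∀ δ, D.weightProj (j + 1) δ * π =
            D.weightProj (j + 1 + 1) (Function.update δ (j + 1) (α (j + 1))) := by
          intro δ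
          have h1 : D.weightProj (j + 1) (Function.update δ (j + 1) (α (j + 1))) =
              D.weightProj (j + 1) δ :=
            D.weightProj_congr fun i hi => Function.update_of_ne (by omega) _ _
          conv_rhs => rw [weightProj, h1, Function.update_self]
        set β' := Function.update β (j + 1) (α (j + 1))
        set γ' := Function.update γ (j + 1) (α (j + 1))
        have e4 : p * x * D.weightProj (j + 1) β * (π * D.T j) * D.weightProj (j + 1) γ *
            (π * (y * p)) = (p * x) * (D.weightProj (j + 1 + 1) β' * D.T j *
              D.weightProj (j + 1 + 1) γ') * (y * p) := by
          rw [← hwp, ← hwp]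
          noncomm_ring
        rw [e4]
        by_cases h0 : D.weightProj (j + 1 + 1) β' * D.T j * D.weightProj (j + 1 + 1) γ' = 0
        · rw [h0, mul_zero, zero_mul]; exact zero_mem _
        have hββ : ∀ k < j + 1 + 1, γ' k = β' k := by
          rcases eq_or_eq_swapAt hm hdm1 (Nat.lt_succ_self _) h0 with h | h
          · exact fun k hk => (h k hk).symm
          · have u1 : β' (j + 1) = α (j + 1) := Function.update_self _ _ _
            have u2 : γ' (j + 1) = α (j + 1) := Function.update_self _ _ _
            have s1 := h j (by omega)
            have s2 := h (j + 1) (by omega)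
            rw [swapAt_left] at s1
            rw [swapAt_right] at s2
            intro k hk
            by_cases k1 : k = j
            · subst k1; rw [s1, ← s2, u1, u2]
            · by_cases k2 : k = j + 1
              · subst k2; rw [u1, u2]
              · rw [h k hk, swapAt_of_ne _ k1 k2]
        rw [D.weightProj_congr hββ]
        obtain ⟨c, hc⟩ := weightProj_T_weightProj hm hdm1 hq1 (Nat.lt_succ_self _) β'
        rw [hc, mul_smul_comm, smul_mul_assoc, ← hwp]
        refine Submodule.smul_mem _ _ ?_
        have hβ := D.weightProj_mem_level (j + 1) β
        have e5 : p * x * (D.weightProj (j + 1) β * π) * (y * p) =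
            p * (x * D.weightProj (j + 1) β * y) * p * π := by
          calc _ = p * x * D.weightProj (j + 1) β * (π * (y * p)) := by noncomm_ring
            _ = _ := by rw [← hcomm _ (mul_mem hy hp)]; noncomm_ring
        rw [e5]
        exact key _ (mul_mem (mul_mem hx hβ) hy)
    | zero => simp
    | add u v _ _ hu hv => rw [mul_add, add_mul]; exact add_mem hu hv
    | smul c u _ hu =>
      rw [mul_smul_comm, smul_mul_assoc]; exact Submodule.smul_mem _ _ hu

end MirabolicSystem

/-! ### Evaluation of symmetric polynomials and interpolation -/

section evalTuple

variable {K A : Type} [Field K] [Ring A] [Algebra K A] {n : ℕ}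

theorem prod_ofFn_mul {n : ℕ} {x : Fin n → A} {c : Fin n → K} {v : A}
    (h : ∀ i, x i * v = c i • v) : (List.ofFn x).prod * v = (∏ i, c i) • v := by
  induction n with
  | zero => simp
  | succ n ih =>
    rw [List.ofFn_succ, List.prod_cons, mul_assoc, ih fun i => h i.succ, mul_smul_comm, h 0,
      smul_smul, Fin.prod_univ_succ, mul_comm]

theorem evalTuple_mul {x : Fin n → A} {c : Fin n → K} {v : A} (h : ∀ i, x i * v = c i • v)
    (p : MvPolynomial (Fin n) K) : evalTuple x p * v = MvPolynomial.eval c p • v := by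
  rw [evalTuple, MvPolynomial.eval_eq', Finset.sum_mul, Finset.sum_smul]
  refine Finset.sum_congr rfl fun m _ => ?_
  rw [smul_mul_assoc, mul_smul, prod_ofFn_mul (c := fun i => c i ^ m i)]
  intro i
  have := aeval_mul_of_mul_eq_smul (h i) (Polynomial.X ^ m i)
  rwa [map_pow, Polynomial.aeval_X, Polynomial.eval_pow, Polynomial.eval_X] at this

theorem commute_evalTuple {x : Fin n → A} {y : A} (h : ∀ i, Commute y (x i))
    (p : MvPolynomial (Fin n) K) : Commute y (evalTuple x p) := by
  refine Commute.sum_right _ _ _ fun m _ => Commute.smul_right ?_ _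
  refine Commute.list_prod_right _ _ fun z hz => ?_
  obtain ⟨i, rfl⟩ := (List.mem_ofFn' _ _).mp hz
  exact (h i).pow_right _

open Classical in
/-- A function on a grid that is invariant under permutations of the coordinates is interpolated by
a symmetric polynomial: the Lagrange interpolation polynomial is symmetric. -/
theorem exists_symmetric_interpolation (s : Finset K) (g : (Fin n → K) → K)
    (hg : ∀ (a : Fin n → K) (σ : Equiv.Perm (Fin n)), g (a ∘ σ) = g a) :
    ∃ p : MvPolynomial (Fin n) K, p.IsSymmetric ∧
      ∀ a : Fin n → K, (∀ i, a i ∈ s) → MvPolynomial.eval a p = g a := by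
  refine ⟨∑ a ∈ Fintype.piFinset fun _ => s, MvPolynomial.C (g a) *
    ∏ i, Polynomial.aeval (MvPolynomial.X i) (Lagrange.basis s id (a i)), fun σ => ?_,
    fun b hb => ?_⟩
  · rw [map_sum]
    refine Finset.sum_bij' (fun a _ => a ∘ σ.symm) (fun a _ => a ∘ σ) ?_ ?_ ?_ ?_ ?_
    · intro a ha
      rw [Fintype.mem_piFinset] at ha ⊢
      exact fun i => ha _
    · intro a ha
      rw [Fintype.mem_piFinset] at ha ⊢
      exact fun i => ha _
    · intro a _; funext i; simp
    · intro a _; funext i; simp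
    · intro a _
      rw [map_mul, MvPolynomial.algHom_C, map_prod, hg]
      congr 1
      rw [← Equiv.prod_comp σ fun i => Polynomial.aeval (MvPolynomial.X i)
        (Lagrange.basis s id ((a ∘ σ.symm) i))]
      refine Finset.prod_congr rfl fun i _ => ?_
      rw [← Polynomial.aeval_algHom_apply, MvPolynomial.rename_X]
      simp
  · rw [map_sum, Finset.sum_eq_single b]
    · rw [map_mul, MvPolynomial.eval_C, map_prod, Finset.prod_eq_one, mul_one]
      intro i _
      rw [← MvPolynomial.coe_aeval_eq_eval, RingHom.coe_coe, ← Polynomial.aeval_algHom_apply,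
        MvPolynomial.aeval_X, Polynomial.coe_aeval_eq_eval]
      exact Lagrange.eval_basis_self (v := id) (Set.injOn_id _) (hb i)
    · intro a _ hab
      obtain ⟨i, hi⟩ : ∃ i, a i ≠ b i := by
        by_contra hcon
        push Not at hcon
        exact hab (funext hcon)
      rw [map_mul, map_prod, Finset.prod_eq_zero (Finset.mem_univ i), mul_zero]
      rw [← MvPolynomial.coe_aeval_eq_eval, RingHom.coe_coe, ← Polynomial.aeval_algHom_apply,
        MvPolynomial.aeval_X, Polynomial.coe_aeval_eq_eval]
      exact Lagrange.eval_basis_of_ne (v := id) hi (hb i)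
    · intro h
      exact absurd (Fintype.mem_piFinset.mpr hb) h

end evalTuple

namespace MirabolicSystem

variable {K A : Type} [Field K] [Ring A] [Algebra K A] {n : ℕ} {D : MirabolicSystem K A n}

/-! ### The center -/

/-- A weight as a function on `ℕ`, by extending it by `0`. -/
def extendZero (a : Fin n → K) (k : ℕ) : K := if h : k < n then a ⟨k, h⟩ else 0

theorem extendZero_apply (a : Fin n → K) (k : Fin n) : extendZero a k = a k := by
  simp [extendZero]

theorem weightProj_extendZero (α : ℕ → K) :
    D.weightProj n (extendZero fun i : Fin n => α i) = D.weightProj n α :=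
  D.weightProj_congr fun i hi => by simp [extendZero, hi]

/-- Values of symmetric polynomials at the Jucys-Murphy elements are central. -/
theorem commute_T_evalTuple (hd : ∀ i < n, D.IsDiag i) {p : MvPolynomial (Fin n) K}
    (hp : p.IsSymmetric) {i : ℕ} (hi : i + 1 < n) :
    Commute (D.T i) (evalTuple (fun j : Fin n => D.L j) p) := by
  set P := evalTuple (fun j : Fin n => D.L j) p
  have hP : ∀ α : ℕ → K, P * D.weightProj n α =
      MvPolynomial.eval (fun j : Fin n => α j) p • D.weightProj n α := fun α =>
    evalTuple_mul (fun j => D.isWeight_weightProj le_rfl hd α j j.2) p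
  have hPc : ∀ α : ℕ → K, D.weightProj n α * P = P * D.weightProj n α := fun α =>
    (commute_evalTuple (fun j => commute_weightProj_L le_rfl j.2 α) p).eq
  rw [Commute, SemiconjBy, ← sub_eq_zero, ← Submodule.mem_bot K, ← one_mul (_ - _)]
  refine D.mul_mem_of_forall_weightProj n fun α _ => ?_
  rw [one_mul, ← mul_one (_ * _)]
  refine D.mul_mem_of_forall_weightProj n fun β _ => ?_
  rw [mul_one, Submodule.mem_bot]
  have e : D.weightProj n α * (D.T i * P - P * D.T i) * D.weightProj n β =
      (MvPolynomial.eval (fun j : Fin n => β j) p - MvPolynomial.eval (fun j : Fin n => α j) p) •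
        (D.weightProj n α * D.T i * D.weightProj n β) := by
    calc _ = D.weightProj n α * D.T i * (P * D.weightProj n β) -
          (D.weightProj n α * P) * D.T i * D.weightProj n β := by noncomm_ring
      _ = _ := by
        rw [hPc, hP, hP, mul_smul_comm, smul_mul_assoc, smul_mul_assoc, sub_smul]
  rw [e]
  by_cases h0 : D.weightProj n α * D.T i * D.weightProj n β = 0
  · rw [h0, smul_zero]
  rw [sub_eq_zero.mpr, zero_smul]
  rcases eq_or_eq_swapAt le_rfl hd hi h0 with h | h
  · congr 2
    funext j
    exact (h j j.2).symm
  · set σ : Equiv.Perm (Fin n) := Equiv.swap ⟨i, by omega⟩ ⟨i + 1, hi⟩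
    have hσ : (fun j : Fin n => α j) = (fun j : Fin n => β j) ∘ σ := by
      funext j
      rw [h j j.2]
      simp only [swapAt, Function.comp_apply]
      congr 1
      by_cases j1 : j = ⟨i, by omega⟩
      · subst j1; simp [σ]
      · by_cases j2 : j = ⟨i + 1, hi⟩
        · subst j2; simp [σ]
        · rw [Equiv.swap_apply_of_ne_of_ne j1 j2, Equiv.swap_apply_of_ne_of_ne]
          · exact fun e => j1 (Fin.ext e)
          · exact fun e => j2 (Fin.ext e)
    rw [hσ, ← MvPolynomial.eval_rename, hp σ]

/-- A central element acts by the same scalar on weight spaces whose weights agree up to a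
permutation. -/
theorem central_scalar_eq (hn : 2 ≤ n) (hq : ∀ i : ℕ, 1 ≤ i → i ≤ n → D.q ^ i ≠ 1) {z : A}
    (hz : ∀ x, Commute x z) {α β : ℕ → K} (σ : Equiv.Perm (Fin n))
    (hσ : ∀ k : Fin n, β k = α (σ k)) (hα : D.weightProj n α ≠ 0) (hβ : D.weightProj n β ≠ 0)
    {c d : K} (hc : z * D.weightProj n α = c • D.weightProj n α)
    (hd : z * D.weightProj n β = d • D.weightProj n β) : c = d := by
  have hC := D.isControlled hn hq
  obtain ⟨γ, hγ, eγ⟩ := hC.2 α _ hα (D.isWeight_weightProj le_rfl hC.1 α)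
  obtain ⟨γ', hγ', eγ'⟩ := hC.2 β _ hβ (D.isWeight_weightProj le_rfl hC.1 β)
  have hcount := letterCount_eq_of_perm D.q_ne_zero hq hγ hγ' σ fun k => by
    rw [← eγ' k k.2, ← eγ _ (σ k).2, hσ]
  obtain ⟨γ'', hl, e''⟩ := exists_linked_of_letterCount_eq n hγ hγ' hcount
  obtain ⟨a, α', h1, h2, h3, -⟩ := exists_weight_of_linked hq le_rfl le_rfl hl hγ hα
    (D.isWeight_weightProj le_rfl hC.1 α) eγ
  have h2 : D.IsWeight n β (a * D.weightProj n α) := h2.congr fun k hk => by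
    rw [h3 k hk, e'' k hk, eγ' k hk]
  have hza : z * (a * D.weightProj n α) = c • (a * D.weightProj n α) := by
    rw [← mul_assoc, ← (hz a).eq, mul_assoc, hc, mul_smul_comm]
  have hzd : (z - d • 1) * (a * D.weightProj n α) ∈ (⊥ : Submodule K A) := by
    refine D.mul_mem_of_forall_weightProj n fun δ _ => ?_
    rw [Submodule.mem_bot, mul_assoc]
    by_cases hδ : ∀ k < n, δ k = β k
    · rw [D.weightProj_congr hδ, ← mul_assoc, sub_mul, hd, smul_mul_assoc, one_mul, sub_self,
        zero_mul]
    · push Not at hδ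
      obtain ⟨k, hk, hne⟩ := hδ
      rw [weightProj_mul_of_weight_ne le_rfl hC.1 hk hne h2, mul_zero]
  rw [Submodule.mem_bot, sub_mul, hza, smul_mul_assoc, one_mul, ← sub_smul, smul_eq_zero] at hzd
  exact sub_eq_zero.mp (hzd.resolve_right h1)

/-- If `q` is not a root of unity of order at most `n`, the center of the algebra consists of the
symmetric polynomials in the Jucys-Murphy elements. -/
theorem center_eq (hn : 2 ≤ n) (hq : ∀ i : ℕ, 1 ≤ i → i ≤ n → D.q ^ i ≠ 1) :
    (Subalgebra.center K A : Set A) =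
      {z | ∃ p : MvPolynomial (Fin n) K, p.IsSymmetric ∧
        z = evalTuple (fun j : Fin n => D.L j) p} := by
  have hd := (D.isControlled hn hq).1
  have hq1 : D.q ≠ 1 := by simpa using hq 1 le_rfl (by omega)
  ext z
  constructor
  · intro hz
    have hz : ∀ x, Commute x z := fun x => Subalgebra.mem_center_iff.mp hz x
    have hscal : ∀ α : ℕ → K, ∃ c : K, z * D.weightProj n α = c • D.weightProj n α := by
      intro α
      obtain ⟨c, hc⟩ := Submodule.mem_span_singleton.mp
        (weightProj_mul_mul_weightProj hq1 hd le_rfl (D.level_top ▸ Algebra.mem_top : z ∈ _) α)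
      refine ⟨c, ?_⟩
      rw [hc, (hz _).eq, mul_assoc, weightProj_mul_self le_rfl hd]
    choose f hf using hscal
    classical
    set g : (Fin n → K) → K := fun a =>
      if h : ∃ σ : Equiv.Perm (Fin n), D.weightProj n (extendZero (a ∘ σ)) ≠ 0 then
        f (extendZero (a ∘ h.choose)) else 0 with hg
    have hperm : ∀ (a : Fin n → K) (σ τ : Equiv.Perm (Fin n)),
        D.weightProj n (extendZero (a ∘ σ)) ≠ 0 → D.weightProj n (extendZero (a ∘ τ)) ≠ 0 →
        f (extendZero (a ∘ σ)) = f (extendZero (a ∘ τ)) := fun a σ τ h1 h2 =>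
      central_scalar_eq hn hq hz (τ.trans σ.symm)
        (fun k => by rw [extendZero_apply, extendZero_apply]; simp) h1 h2 (hf _) (hf _)
    have hginv : ∀ (a : Fin n → K) (σ : Equiv.Perm (Fin n)), g (a ∘ σ) = g a := by
      intro a σ
      by_cases h : ∃ τ : Equiv.Perm (Fin n), D.weightProj n (extendZero (a ∘ τ)) ≠ 0
      · have h' : ∃ τ : Equiv.Perm (Fin n), D.weightProj n (extendZero ((a ∘ σ) ∘ τ)) ≠ 0 := by
          obtain ⟨τ, hτ⟩ := h
          refine ⟨τ.trans σ.symm, ?_⟩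
          convert hτ using 3
          funext k; simp
        rw [hg]
        simp only [dif_pos h, dif_pos h']
        exact hperm a (h'.choose.trans σ) h.choose h'.choose_spec h.choose_spec
      · have h' : ¬ ∃ τ : Equiv.Perm (Fin n), D.weightProj n (extendZero ((a ∘ σ) ∘ τ)) ≠ 0 := by
          rintro ⟨τ, hτ⟩
          exact h ⟨τ.trans σ, hτ⟩
        rw [hg]
        simp only [dif_neg h, dif_neg h']
    obtain ⟨p, hp, hpe⟩ := exists_symmetric_interpolation D.values g hginv
    refine ⟨p, hp, ?_⟩
    rw [← sub_eq_zero, ← Submodule.mem_bot K, ← mul_one (_ - _)]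
    refine D.mul_mem_of_forall_weightProj n fun α hα => ?_
    rw [mul_one, Submodule.mem_bot, sub_mul,
      evalTuple_mul (fun j => D.isWeight_weightProj le_rfl hd α j j.2) p, hf, ← sub_smul]
    by_cases h0 : D.weightProj n α = 0
    · rw [h0, smul_zero]
    have h : ∃ σ : Equiv.Perm (Fin n),
        D.weightProj n (extendZero ((fun j : Fin n => α j) ∘ σ)) ≠ 0 :=
      ⟨1, by simpa [weightProj_extendZero] using h0⟩
    rw [hpe _ fun j => hα j j.2, hg]
    simp only [dif_pos h]
    rw [central_scalar_eq hn hq hz h.choose (fun k => by rw [extendZero_apply]; rfl) h0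
      h.choose_spec (hf _) (hf _), sub_self, zero_smul]
  · rintro ⟨p, hp, rfl⟩
    refine Subalgebra.mem_center_iff.mpr fun x => ?_
    have hx : x ∈ D.level n := D.level_top ▸ Algebra.mem_top
    exact D.commute_of_mem_level
      (fun _ => commute_evalTuple (fun j => D.commute_e_L j.2) p)
      (fun i hi => commute_T_evalTuple hd hp hi) hx

end MirabolicSystem

/-! ### Flags and adapted bases -/

section Flags

variable {n : ℕ} {F : Type} [Field F]

/-- The `k`-th vector of the family `b` lies in the `(k+1)`-st but not in the `k`-th space of the
flag, for all `k`. Such a family is a basis, and the spaces of the flag are the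
spans of its initial segments. -/
def Adapted (b : Fin n → Fin n → F) (X : CompleteFlag n F) : Prop :=
  ∀ k : Fin n, b k ∈ X.space k.succ ∧ b k ∉ X.space k.castSucc

theorem CompleteFlag.space_last (X : CompleteFlag n F) : X.space (Fin.last n) = ⊤ := by
  refine Submodule.eq_top_of_finrank_eq ?_
  rw [X.finrank_space]
  simp

theorem CompleteFlag.space_zero (X : CompleteFlag n F) : X.space 0 = ⊥ := by
  rw [← Submodule.finrank_eq_zero (R := F), X.finrank_space]
  rfl

theorem CompleteFlag.space_mono (X : CompleteFlag n F) {i j : Fin (n + 1)} (h : i.val ≤ j.val) :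
    X.space i ≤ X.space j := X.mono h

theorem CompleteFlag.exists_adapted (X : CompleteFlag n F) : ∃ b, Adapted b X := by
  have : ∀ k : Fin n, ∃ u, u ∈ X.space k.succ ∧ u ∉ X.space k.castSucc := by
    intro k
    by_contra hcon
    push Not at hcon
    have h := Submodule.finrank_mono (R := F) (show X.space k.succ ≤ X.space k.castSucc from hcon)
    rw [X.finrank_space, X.finrank_space] at h
    simp at h
  choose b hb using this
  exact ⟨b, hb⟩

theorem Adapted.space_eq {b : Fin n → Fin n → F} {X : CompleteFlag n F} (hb : Adapted b X)
    (i : Fin (n + 1)) : X.space i = Submodule.span F (b '' {k | k.val < i.val}) := by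
  induction i using Fin.induction with
  | zero => rw [X.space_zero]; simp
  | succ k ih =>
    have e : {j : Fin n | j.val < k.succ.val} = insert k {j : Fin n | j.val < k.castSucc.val} := by
      ext j
      simp only [Set.mem_ofPred_eq, Set.mem_insert_iff, Fin.val_succ, Fin.val_castSucc, Fin.ext_iff]
      omega
    rw [e, Set.image_insert_eq, Submodule.span_insert, ← ih, eq_comm]
    have hle : Submodule.span F {b k} ⊔ X.space k.castSucc ≤ X.space k.succ :=
      sup_le (by simpa using (hb k).1) (X.space_mono (by simp))
    refine Submodule.eq_of_le_of_finrank_le hle ?_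
    have hlt : X.space k.castSucc < Submodule.span F {b k} ⊔ X.space k.castSucc := by
      refine lt_of_le_of_ne le_sup_right fun h => (hb k).2 ?_
      rw [h]
      exact (le_sup_left : Submodule.span F {b k} ≤ _) (Submodule.mem_span_singleton_self _)
    have := Submodule.finrank_lt_finrank_of_lt hlt
    rw [X.finrank_space] at this ⊢
    simpa using this

theorem Adapted.top_le_span {b : Fin n → Fin n → F} {X : CompleteFlag n F} (hb : Adapted b X) :
    ⊤ ≤ Submodule.span F (Set.range b) := by
  rw [← X.space_last, hb.space_eq]
  exact Submodule.span_mono (Set.image_subset_range _ _)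

theorem Adapted.exists_basis {b : Fin n → Fin n → F} {X : CompleteFlag n F} (hb : Adapted b X) :
    ∃ B : Module.Basis (Fin n) F (Fin n → F), ⇑B = b :=
  ⟨basisOfTopLeSpanOfCardEqFinrank b hb.top_le_span (by simp), by simp⟩

theorem mem_span_image_iff (b : Module.Basis (Fin n) F (Fin n → F)) (I : Set (Fin n))
    (u : Fin n → F) : u ∈ Submodule.span F (b '' I) ↔ ∀ k ∉ I, b.repr u k = 0 := by
  rw [Module.Basis.mem_span_image]
  constructor
  · intro h k hk
    by_contra hne
    exact hk (h (by simpa using hne))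
  · intro h k hk
    by_contra hne
    exact (by simpa using hk : b.repr u k ≠ 0) (h k hne)

theorem Adapted.mem_iff {b : Module.Basis (Fin n) F (Fin n → F)} {X : CompleteFlag n F}
    (hb : Adapted b X) {i : Fin (n + 1)} {u : Fin n → F} :
    u ∈ X.space i ↔ ∀ k : Fin n, i.val ≤ k.val → b.repr u k = 0 := by
  rw [hb.space_eq, mem_span_image_iff]
  simp

/-- The same description for a flag to which a reordering of the basis is adapted. -/
theorem Adapted.mem_iff_comp {b : Module.Basis (Fin n) F (Fin n → F)} {w : Equiv.Perm (Fin n)}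
    {Y : CompleteFlag n F} (hb : Adapted (b ∘ w) Y) {j : Fin (n + 1)} {u : Fin n → F} :
    u ∈ Y.space j ↔ ∀ k : Fin n, j.val ≤ k.val → b.repr u (w k) = 0 := by
  have h : Adapted (b.reindex w.symm) Y := by
    convert hb using 1
    funext k
    simp
  rw [h.mem_iff]
  simp

theorem adapted_iff (b : Module.Basis (Fin n) F (Fin n → F)) (X : CompleteFlag n F) :
    Adapted b X ↔ ∀ i : Fin (n + 1), X.space i = Submodule.span F (b '' {k | k.val < i.val}) := by
  refine ⟨fun h => h.space_eq, fun h k => ?_⟩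
  rw [h, h]
  refine ⟨Submodule.subset_span ⟨k, by simp, rfl⟩, fun hk => ?_⟩
  rw [mem_span_image_iff] at hk
  simpa using hk k (by simp)

theorem inOrbit_iff (w : Equiv.Perm (Fin n)) (β : Finset (Fin n)) (X Y : CompleteFlag n F)
    (v : Fin n → F) : InOrbit w β X Y v ↔
      ∃ b : Module.Basis (Fin n) F (Fin n → F), Adapted b X ∧ Adapted (b ∘ w) Y ∧
        v = ∑ i ∈ β, b i := by
  refine exists_congr fun b => ?_
  rw [adapted_iff]
  have e : (b ∘ w : Fin n → Fin n → F) = b.reindex w.symm := by funext k; simp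
  rw [e, adapted_iff]
  have e2 : ((b.reindex w.symm : Module.Basis (Fin n) F (Fin n → F)) : Fin n → Fin n → F) =
    fun k => b (w k) := by funext k; simp
  rw [e2]

/-- The flag spanned by the initial segments of a basis. -/
def flagOfBasis (b : Module.Basis (Fin n) F (Fin n → F)) : CompleteFlag n F where
  space i := Submodule.span F (b '' {k | k.val < i.val})
  mono i j h := Submodule.span_mono (Set.image_mono fun k (hk : k.val < i.val) =>
    lt_of_lt_of_le hk h)
  finrank_space i := by
    have hli : LinearIndependent F (fun k : {k : Fin n | k.val < i.val} => b k) :=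
      b.linearIndependent.comp _ Subtype.val_injective
    have h := finrank_span_eq_card hli
    rw [Set.image_eq_range]
    rw [h]
    have e : Fintype.card {k : Fin n | k.val < i.val} = i.val := by
      rw [Fintype.card_subtype]
      have hi := i.2
      rcases Nat.lt_or_ge i.val n with h2 | h2
      · have := Fin.card_filter_val_lt (n := n) (m := i.val)
        simpa [h2.le] using this
      · have := Fin.card_filter_val_lt (n := n) (m := i.val)
        simp at this ⊢
        omega
    exact e

theorem adapted_flagOfBasis (b : Module.Basis (Fin n) F (Fin n → F)) :
    Adapted b (flagOfBasis b) := (adapted_iff b _).2 fun _ => rfl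

/-! ### Adjacent flags -/

/-- Two flags are adjacent at `i` if they differ exactly in the space of dimension `i + 1`. -/
def Adjacent (i : ℕ) (X Y : CompleteFlag n F) : Prop :=
  X ≠ Y ∧ ∀ j : Fin (n + 1), j.val ≠ i + 1 → X.space j = Y.space j

theorem Adjacent.symm {i : ℕ} {X Y : CompleteFlag n F} (h : Adjacent i X Y) : Adjacent i Y X :=
  ⟨h.1.symm, fun j hj => (h.2 j hj).symm⟩

theorem flag_eq_of_space_eq {i : ℕ} (hi : i + 1 < n + 1) {X Y : CompleteFlag n F}
    (h : ∀ j : Fin (n + 1), j.val ≠ i + 1 → X.space j = Y.space j)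
    (h1 : X.space ⟨i + 1, hi⟩ = Y.space ⟨i + 1, hi⟩) : X = Y := by
  refine CompleteFlag.ext (funext fun j => ?_)
  by_cases hj : j.val = i + 1
  · rwa [show j = ⟨i + 1, hi⟩ from Fin.ext hj]
  · exact h j hj

theorem Adjacent.mem_of_mem {i : ℕ} (hi : i + 1 < n + 1) {X Y : CompleteFlag n F}
    (h : Adjacent i X Y) {u : Fin n → F} (h1 : u ∈ X.space ⟨i + 1, hi⟩)
    (h2 : u ∈ Y.space ⟨i + 1, hi⟩) : u ∈ X.space ⟨i, by omega⟩ := by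
  have hle : X.space ⟨i, by omega⟩ ≤ X.space ⟨i + 1, hi⟩ ⊓ Y.space ⟨i + 1, hi⟩ := by
    refine le_inf (X.space_mono (by simp)) ?_
    rw [h.2 _ (by simp)]
    exact Y.space_mono (by simp)
  have hlt : X.space ⟨i + 1, hi⟩ ⊓ Y.space ⟨i + 1, hi⟩ < X.space ⟨i + 1, hi⟩ := by
    refine lt_of_le_of_ne inf_le_left fun e => h.1 (flag_eq_of_space_eq hi h.2 ?_)
    refine Submodule.eq_of_le_of_finrank_eq (inf_eq_left.mp e) ?_
    rw [X.finrank_space, Y.finrank_space]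
  have h3 := Submodule.finrank_lt_finrank_of_lt hlt
  rw [X.finrank_space] at h3
  rw [Submodule.eq_of_le_of_finrank_le hle (by rw [X.finrank_space]; simp at h3 ⊢; omega)]
  exact ⟨h1, h2⟩

theorem Adjacent.exists_mem {i : ℕ} (hi : i + 1 < n + 1) {X Y : CompleteFlag n F}
    (h : Adjacent i X Y) : ∃ u ∈ Y.space ⟨i + 1, hi⟩, u ∉ X.space ⟨i + 1, hi⟩ := by
  by_contra hcon
  push Not at hcon
  refine h.1 (flag_eq_of_space_eq hi h.2 (Eq.symm ?_))
  refine Submodule.eq_of_le_of_finrank_eq hcon ?_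
  rw [X.finrank_space, Y.finrank_space]

theorem apply_perm_inv {α : Type*} (w : Equiv.Perm α) (k : α) : w (w⁻¹ k) = k :=
  w.apply_symm_apply k

/-- The transposition of the points `i` and `i + 1`, counted from `0`. -/
def sw (n : ℕ) {i : ℕ} (hi : i + 1 < n) : Equiv.Perm (Fin n) :=
  Equiv.swap ⟨i, by omega⟩ ⟨i + 1, hi⟩

section sw
variable {i : ℕ} (hi : i + 1 < n)

@[simp] theorem sw_left : sw n hi ⟨i, by omega⟩ = ⟨i + 1, hi⟩ := Equiv.swap_apply_left _ _

@[simp] theorem sw_right : sw n hi ⟨i + 1, hi⟩ = ⟨i, by omega⟩ := Equiv.swap_apply_right _ _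

theorem sw_of_ne {k : Fin n} (h1 : k.val ≠ i) (h2 : k.val ≠ i + 1) : sw n hi k = k :=
  Equiv.swap_apply_of_ne_of_ne (fun e => h1 (congrArg Fin.val e)) fun e => h2 (congrArg Fin.val e)

@[simp] theorem sw_sw (k : Fin n) : sw n hi (sw n hi k) = k := Equiv.swap_apply_self _ _ _

@[simp] theorem sw_mul_self : sw n hi * sw n hi = 1 := Equiv.swap_mul_self _ _

theorem le_sw_iff {j : ℕ} (hj : j ≠ i + 1) (k : Fin n) : j ≤ (sw n hi k).val ↔ j ≤ k.val := by
  by_cases h1 : k.val = i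
  · rw [show k = ⟨i, Nat.lt_of_succ_lt hi⟩ from Fin.ext h1, sw_left]
    simp only
    omega
  · by_cases h2 : k.val = i + 1
    · obtain rfl : k = ⟨i + 1, hi⟩ := Fin.ext h2
      rw [sw_right]
      simp only
      omega
    · rw [sw_of_ne hi h1 h2]

end sw

theorem adjacent_of_adapted {i : ℕ} (hi : i + 1 < n) {b : Module.Basis (Fin n) F (Fin n → F)}
    {X Y : CompleteFlag n F} (hX : Adapted b X) (hY : Adapted (b ∘ sw n hi) Y) :
    Adjacent i X Y := by
  constructor
  · rintro rfl
    have h1 := (hX ⟨i, by omega⟩).1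
    have h2 := (hY ⟨i + 1, hi⟩).2
    rw [Function.comp_apply, sw_right] at h2
    exact h2 h1
  · intro j hj
    ext u
    rw [hX.mem_iff, hY.mem_iff_comp]
    constructor
    · intro h k hk
      exact h _ ((le_sw_iff hi hj k).2 hk)
    · intro h k hk
      have := h (sw n hi k) ((le_sw_iff hi hj k).2 hk)
      rwa [sw_sw] at this

theorem exists_adapted_of_adjacent {i : ℕ} (hi : i + 1 < n) {X Y : CompleteFlag n F}
    (h : Adjacent i X Y) : ∃ b : Module.Basis (Fin n) F (Fin n → F),
      Adapted b X ∧ Adapted (b ∘ sw n hi) Y := by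
  obtain ⟨b, hb⟩ := X.exists_adapted
  obtain ⟨u, huY, huX⟩ := h.exists_mem (by omega)
  set c := Function.update b ⟨i + 1, hi⟩ u
  have hca : c ⟨i + 1, hi⟩ = u := Function.update_self _ _ _
  have hc : ∀ k : Fin n, k.val ≠ i + 1 → c k = b k := fun k hk =>
    Function.update_of_ne (fun e => hk (congrArg Fin.val e)) _ _
  have hcX : Adapted c X := by
    intro k
    by_cases hk : k.val = i + 1
    · obtain rfl : k = ⟨i + 1, hi⟩ := Fin.ext hk
      rw [hca]
      refine ⟨?_, huX⟩
      rw [h.2 _ (by simp)]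
      exact Y.space_mono (by simp) huY
    · rw [hc k hk]
      exact hb k
  obtain ⟨B, hB⟩ := hcX.exists_basis
  refine ⟨B, hB ▸ hcX, ?_⟩
  rw [hB]
  intro k
  rw [Function.comp_apply]
  by_cases k1 : k.val = i
  · rw [show k = ⟨i, Nat.lt_of_succ_lt hi⟩ from Fin.ext k1, sw_left, hca]
    refine ⟨huY, fun hu => huX ?_⟩
    rw [← h.2 _ (by simp)] at hu
    exact X.space_mono (by simp) hu
  · by_cases k2 : k.val = i + 1
    · obtain rfl : k = ⟨i + 1, hi⟩ := Fin.ext k2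
      rw [sw_right, hc _ (by simp)]
      have hbi := hb ⟨i, by omega⟩
      refine ⟨?_, fun hu => hbi.2 (h.mem_of_mem (by omega) hbi.1 hu)⟩
      rw [← h.2 _ (by simp)]
      exact X.space_mono (by simp) hbi.1
    · rw [sw_of_ne hi k1 k2, hc k k2, ← h.2 _ (by simpa using k1), ← h.2 _ (by simpa using k2)]
      exact hb k

theorem inOrbit_sw_iff {i : ℕ} (hi : i + 1 < n) (X Y : CompleteFlag n F) (v : Fin n → F) :
    InOrbit (sw n hi) ∅ X Y v ↔ Adjacent i X Y ∧ v = 0 := by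
  rw [inOrbit_iff]
  constructor
  · rintro ⟨b, h1, h2, h3⟩
    exact ⟨adjacent_of_adapted hi h1 h2, by simpa using h3⟩
  · rintro ⟨h, rfl⟩
    obtain ⟨b, h1, h2⟩ := exists_adapted_of_adjacent hi h
    exact ⟨b, h1, h2, by simp⟩

/-! ### Subspaces spanned by parts of a basis adapted to two flags -/

/-- The flags are in relative position `w`, and `v` lies in the span of the vectors with index in
`I` of a basis adapted to both flags. -/
def InSub (w : Equiv.Perm (Fin n)) (I : Set (Fin n)) (X Y : CompleteFlag n F)
    (v : Fin n → F) : Prop :=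
  ∃ b : Module.Basis (Fin n) F (Fin n → F), Adapted b X ∧ Adapted (b ∘ w) Y ∧
    v ∈ Submodule.span F (b '' I)

/-- Exchanging the basis vectors `i` and `i + 1` leads to an adjacent flag. -/
theorem exists_adjacent_of_inSub {i : ℕ} (hi : i + 1 < n) {w : Equiv.Perm (Fin n)}
    {I : Set (Fin n)} {X Y : CompleteFlag n F} {v : Fin n → F} (h : InSub w I X Y v) :
    ∃ H, Adjacent i X H ∧ InSub (sw n hi * w) (sw n hi ⁻¹' I) H Y v := by
  obtain ⟨b, hX, hY, hv⟩ := h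
  set c := b.reindex (sw n hi).symm
  have hc : (c : Fin n → Fin n → F) = b ∘ sw n hi := by funext k; simp [c]
  have hH : Adapted (b ∘ sw n hi) (flagOfBasis c) := hc ▸ adapted_flagOfBasis c
  refine ⟨flagOfBasis c, adjacent_of_adapted hi hX hH, c, adapted_flagOfBasis c, ?_, ?_⟩
  · rw [hc]
    convert hY using 1
    funext k
    simp
  · rw [hc]
    convert hv using 2
    ext u
    constructor
    · rintro ⟨k, hk, rfl⟩
      exact ⟨_, hk, rfl⟩
    · rintro ⟨k, hk, rfl⟩
      exact ⟨sw n hi k, by simpa using hk, by simp⟩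

/-- Conversely, if `b` is adapted to an adjacent flag `H`, then the line of `X_{i+1}` modulo `X_i`
is spanned by a combination of `b (i + 1)` and `b i` with nonzero coefficient at `b (i + 1)`. Since
`w` has a descent at `i`, the flag `Y` is not affected when `b (i + 1)` is replaced by this
vector. -/
theorem inSub_of_adjacent {i : ℕ} (hi : i + 1 < n) {w : Equiv.Perm (Fin n)}
    (hw : w⁻¹ ⟨i + 1, hi⟩ < w⁻¹ ⟨i, by omega⟩) {I : Set (Fin n)}
    (hI : (⟨i, by omega⟩ : Fin n) ∈ I → (⟨i + 1, hi⟩ : Fin n) ∈ I)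
    {X H Y : CompleteFlag n F} {v : Fin n → F} (hadj : Adjacent i X H)
    (h : InSub (sw n hi * w) (sw n hi ⁻¹' I) H Y v) : InSub w I X Y v := by
  obtain ⟨b, hH, hY, hv⟩ := h
  obtain ⟨u, huX, huH⟩ := hadj.symm.exists_mem (by omega)
  set a : Fin n := ⟨i, by omega⟩ with ha
  set a' : Fin n := ⟨i + 1, hi⟩ with ha'
  have hne : a ≠ a' := by simp [a, a']
  -- `u` has a nonzero coordinate at `a'` and its coordinates beyond `a'` vanish
  have hu2 : ∀ k : Fin n, i + 2 ≤ k.val → b.repr u k = 0 := by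
    have : u ∈ H.space a'.succ := by
      rw [← hadj.2 _ (by simp [a'])]
      exact X.space_mono (by simp [a']) huX
    exact fun k hk => hH.mem_iff.mp this k (by simp [a']; omega)
  have hx : b.repr u a' ≠ 0 := by
    intro h0
    refine huH (hH.mem_iff.mpr fun k hk => ?_)
    rcases Nat.lt_or_ge k.val (i + 2) with h | h
    · obtain rfl : k = a' := Fin.ext (by simp [a'] at hk ⊢; omega)
      exact h0
    · exact hu2 k h
  set x := b.repr u a'
  set y := b.repr u a
  set t := x • b a' + y • b a
  have ht : t ∈ X.space a.succ := by
    have hlow : u - t ∈ X.space a.castSucc := by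
      rw [hadj.2 _ (by simp [a]), hH.mem_iff]
      intro k hk
      by_cases k1 : k = a
      · subst k1; simp [t, y, hne]
      · by_cases k2 : k = a'
        · subst k2; simp [t, x, Ne.symm hne]
        · have h3 := hu2 k (by
            have h1 : k.val ≠ i := fun e => k1 (Fin.ext e)
            have h2 : k.val ≠ i + 1 := fun e => k2 (Fin.ext e)
            simp [a] at hk
            omega)
          simp [t, h3, Ne.symm k1, Ne.symm k2]
    have := sub_mem (show u ∈ X.space a.succ from huX) (X.space_mono (by simp) hlow)
    rwa [sub_sub_cancel] at this
  set c : Fin n → Fin n → F := Function.update (b ∘ sw n hi) a t with hc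
  have hca : c a = t := Function.update_self _ _ _
  have hck : ∀ k, k ≠ a → c k = b (sw n hi k) := fun k hk => Function.update_of_ne hk _ _
  have hta : b.repr t a' = x := by simp [t, Ne.symm hne]
  have hcX : Adapted c X := by
    intro k
    by_cases k1 : k = a
    · subst k1
      rw [hca]
      refine ⟨ht, fun h0 => hx ?_⟩
      rw [hadj.2 _ (by simp [a]), hH.mem_iff] at h0
      rw [← hta]
      exact h0 a' (by simp [a, a'])
    · rw [hck k k1]
      by_cases k2 : k = a'
      · subst k2
        have hba := hH a
        rw [ha', sw_right]
        refine ⟨?_, fun h0 => hba.2 (hadj.symm.mem_of_mem (by omega) hba.1 h0)⟩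
        rw [hadj.2 _ (by simp)]
        exact H.space_mono (by simp [a]) hba.1
      · have h1 : k.val ≠ i := fun e => k1 (Fin.ext e)
        have h2 : k.val ≠ i + 1 := fun e => k2 (Fin.ext e)
        rw [sw_of_ne hi h1 h2, hadj.2 _ (by simpa using h1), hadj.2 _ (by simpa using h2)]
        exact hH k
  have hcY : Adapted (c ∘ w) Y := by
    intro k
    rw [Function.comp_apply]
    have hYk := hY k
    rw [Function.comp_apply, Equiv.Perm.mul_apply] at hYk
    by_cases k1 : w k = a
    · rw [k1, hca]
      rw [k1, ha, sw_left] at hYk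
      have hk : w⁻¹ a = k := by rw [← k1]; simp
      have hYj := hY (w⁻¹ a')
      rw [Function.comp_apply, Equiv.Perm.mul_apply, apply_perm_inv, ha', sw_right]
        at hYj
      have hlt : (w⁻¹ a').val < k.val := by rw [← hk]; exact hw
      have hya : y • b a ∈ Y.space k.castSucc :=
        Submodule.smul_mem _ _ (Y.space_mono (by simpa using hlt) hYj.1)
      refine ⟨add_mem (Submodule.smul_mem _ _ hYk.1) (Y.space_mono (by simp) hya), fun h0 => ?_⟩
      have h1 := sub_mem h0 hya
      rw [add_sub_cancel_right] at h1
      exact hYk.2 ((Submodule.smul_mem_iff _ hx).mp h1)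
    · rw [hck _ k1]
      exact hYk
  obtain ⟨B, hB⟩ := hcX.exists_basis
  refine ⟨B, hB ▸ hcX, hB ▸ hcY, ?_⟩
  rw [hB]
  refine (Submodule.span_le.mpr ?_) hv
  rintro _ ⟨m, hm, rfl⟩
  by_cases hma : sw n hi m = a
  · obtain rfl : m = a' := by
      rw [← sw_sw hi m, hma, ha, sw_left]
    rw [Set.mem_preimage, hma] at hm
    have h1 : c a ∈ Submodule.span F (c '' I) := Submodule.subset_span ⟨a, hm, rfl⟩
    have h2 : c a' ∈ Submodule.span F (c '' I) := Submodule.subset_span ⟨a', hI hm, rfl⟩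
    rw [hck a' (Ne.symm hne), ha', sw_right] at h2
    have h3 := sub_mem h1 (Submodule.smul_mem _ y h2)
    rw [hca, add_sub_cancel_right] at h3
    exact (Submodule.smul_mem_iff _ hx).mp h3
  · have h1 : c (sw n hi m) ∈ Submodule.span F (c '' I) := Submodule.subset_span ⟨_, hm, rfl⟩
    rwa [hck _ hma, sw_sw] at h1

/-- Under a descent of `w` at `i` there is only one adjacent flag in relative position `s_i w`
to `Y`. -/
theorem adjacent_unique_of_inSub {i : ℕ} (hi : i + 1 < n) {w : Equiv.Perm (Fin n)}
    (hw : w⁻¹ ⟨i + 1, hi⟩ < w⁻¹ ⟨i, by omega⟩) {I J : Set (Fin n)}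
    {X H H' Y : CompleteFlag n F} {v v' : Fin n → F} (hadj : Adjacent i X H)
    (hadj' : Adjacent i X H') (h : InSub (sw n hi * w) I H Y v)
    (h' : InSub (sw n hi * w) J H' Y v') : H = H' := by
  obtain ⟨b, hH, hY, -⟩ := h
  obtain ⟨b', hH', hY', -⟩ := h'
  by_contra hne
  have hadj2 : Adjacent i H' H := ⟨Ne.symm hne, fun j hj => by rw [← hadj.2 j hj, hadj'.2 j hj]⟩
  have h1 := hH' ⟨i, by omega⟩
  refine h1.2 (hadj2.mem_of_mem (by omega) h1.1 ?_)
  have h2 : b' ⟨i, by omega⟩ ∈ H.space ⟨i + 2, by omega⟩ := by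
    rw [← hadj2.2 _ (by simp)]
    exact H'.space_mono (by simp) h1.1
  have h3 := (hY' (w⁻¹ ⟨i + 1, hi⟩)).1
  rw [Function.comp_apply, Equiv.Perm.mul_apply, apply_perm_inv, sw_right] at h3
  refine hH.mem_iff.mpr fun k hk => ?_
  rcases Nat.lt_or_ge k.val (i + 2) with hk2 | hk2
  · obtain rfl : k = ⟨i + 1, hi⟩ := Fin.ext (by simp at hk ⊢; omega)
    have := hY.mem_iff_comp.mp h3 (w⁻¹ ⟨i, by omega⟩) (by simpa using hw)
    rwa [Equiv.Perm.mul_apply, apply_perm_inv, sw_left] at this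
  · exact hH.mem_iff.mp h2 k hk2

end Flags

/-! ### Convolution with the Hecke generators -/

section Convolution

variable {n : ℕ} {F : Type} [Field F]

open Classical in
theorem orbitFun_apply (w : Equiv.Perm (Fin n)) (β : Finset (Fin n)) (X Y : CompleteFlag n F)
    (v : Fin n → F) : orbitFun F w β X Y v = if InOrbit w β X Y v then 1 else 0 := rfl

/-- The characteristic function of `InSub w I`. -/
def subFun (F : Type) [Field F] (w : Equiv.Perm (Fin n)) (I : Set (Fin n)) : FlagFun n F := by
  classical
  exact fun X Y v => if InSub w I X Y v then 1 else 0

open Classical in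
theorem subFun_apply (w : Equiv.Perm (Fin n)) (I : Set (Fin n)) (X Y : CompleteFlag n F)
    (v : Fin n → F) : subFun F w I X Y v = if InSub w I X Y v then 1 else 0 := rfl

theorem inSub_empty_iff (w : Equiv.Perm (Fin n)) (X Y : CompleteFlag n F) (v : Fin n → F) :
    InSub w ∅ X Y v ↔ InOrbit w ∅ X Y v := by
  rw [inOrbit_iff, InSub]
  simp

theorem subFun_empty (w : Equiv.Perm (Fin n)) : subFun F w ∅ = orbitFun F w ∅ := by
  classical
  ext X Y v
  rw [subFun_apply, orbitFun_apply]
  exact if_congr (inSub_empty_iff w X Y v) rfl rfl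

open Classical in
theorem hecke_mul_apply [Fintype F] {i : ℕ} (hi : i + 1 < n) (β : FlagFun n F)
    (X Y : CompleteFlag n F) (v : Fin n → F) : (orbitFun F (sw n hi) ∅ * β) X Y v =
      ∑ H : CompleteFlag n F, if Adjacent i X H then β H Y v else 0 := by
  rw [FlagFun.mul_apply]
  refine Finset.sum_congr rfl fun H _ => ?_
  rw [Finset.sum_eq_single 0]
  · simp [orbitFun_apply, inOrbit_sw_iff]
  · intro u _ hu
    simp [orbitFun_apply, inOrbit_sw_iff, hu]
  · simp

/-- If `w` has a descent at `i` on the left which is compatible with `I`, then the orbits described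
by `(w, I)` are reached from those described by `(s_i w, s_i I)` through a unique adjacent flag. -/
theorem hecke_mul_subFun [Fintype F] {i : ℕ} (hi : i + 1 < n) {w : Equiv.Perm (Fin n)}
    (hw : w⁻¹ ⟨i + 1, hi⟩ < w⁻¹ ⟨i, by omega⟩) {I : Set (Fin n)}
    (hI : (⟨i, by omega⟩ : Fin n) ∈ I → (⟨i + 1, hi⟩ : Fin n) ∈ I) :
    orbitFun F (sw n hi) ∅ * subFun F (sw n hi * w) (sw n hi ⁻¹' I) = subFun F w I := by
  classical
  ext X Y v
  rw [hecke_mul_apply, subFun_apply]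
  split_ifs with h
  · obtain ⟨H, hH, hs⟩ := exists_adjacent_of_inSub hi h
    rw [Finset.sum_eq_single H]
    · rw [if_pos hH, subFun_apply, if_pos hs]
    · intro H' _ hne
      split_ifs with h'
      · rw [subFun_apply, if_neg]
        exact fun h2 => hne (adjacent_unique_of_inSub hi hw h' hH h2 hs)
      · rfl
    · simp
  · refine Finset.sum_eq_zero fun H _ => ?_
    split_ifs with h'
    · rw [subFun_apply, if_neg]
      exact fun h2 => h (inSub_of_adjacent hi hw hI h' h2)
    · rfl

/-- Interchanging the two flags is an anti-automorphism of the convolution algebra. -/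
def transpose (f : FlagFun n F) : FlagFun n F := fun X Y v => f Y X v

theorem transpose_mul [Fintype F] (f g : FlagFun n F) :
    transpose (f * g) = transpose g * transpose f := by
  classical
  ext X Y v
  rw [FlagFun.mul_apply]
  change (f * g) Y X v = _
  rw [FlagFun.mul_apply]
  refine Finset.sum_congr rfl fun H _ => ?_
  refine Fintype.sum_equiv (Equiv.subLeft v) _ _ fun u => ?_
  simp [transpose, mul_comm]

theorem inSub_swap {w : Equiv.Perm (Fin n)} {I : Set (Fin n)} {X Y : CompleteFlag n F}
    {v : Fin n → F} (h : InSub w I X Y v) : InSub w⁻¹ (w ⁻¹' I) Y X v := by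
  obtain ⟨b, hX, hY, hv⟩ := h
  have e : (b.reindex w.symm : Fin n → Fin n → F) = b ∘ w := by funext k; simp
  refine ⟨b.reindex w.symm, e ▸ hY, ?_, ?_⟩
  · rw [e]
    convert hX using 1
    funext k
    simp
  · rw [e]
    convert hv using 2
    rw [Set.image_comp, Set.image_preimage_eq _ w.surjective]

theorem transpose_subFun (w : Equiv.Perm (Fin n)) (I : Set (Fin n)) :
    transpose (subFun F w I) = subFun F w⁻¹ (w ⁻¹' I) := by
  classical
  ext X Y v
  change subFun F w I Y X v = _
  rw [subFun_apply, subFun_apply]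
  refine if_congr ⟨inSub_swap, fun h => ?_⟩ rfl rfl
  have h2 := inSub_swap h
  rw [inv_inv] at h2
  convert h2 using 1
  ext k
  simp

theorem transpose_hecke {i : ℕ} (hi : i + 1 < n) :
    transpose (orbitFun F (sw n hi) ∅) = orbitFun F (sw n hi) ∅ := by
  classical
  ext X Y v
  change orbitFun F (sw n hi) ∅ Y X v = _
  rw [orbitFun_apply, orbitFun_apply]
  refine if_congr ?_ rfl rfl
  rw [inOrbit_sw_iff, inOrbit_sw_iff]
  exact and_congr_left fun _ => ⟨Adjacent.symm, Adjacent.symm⟩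

theorem sw_inv {i : ℕ} (hi : i + 1 < n) : (sw n hi)⁻¹ = sw n hi := Equiv.swap_inv _ _

/-- The mirror image of `hecke_mul_subFun`. -/
theorem subFun_mul_hecke [Fintype F] {i : ℕ} (hi : i + 1 < n) {w : Equiv.Perm (Fin n)}
    (hw : w ⟨i + 1, hi⟩ < w ⟨i, by omega⟩) {I : Set (Fin n)}
    (hI : w ⟨i, by omega⟩ ∈ I → w ⟨i + 1, hi⟩ ∈ I) :
    subFun F (w * sw n hi) I * orbitFun F (sw n hi) ∅ = subFun F w I := by
  have h := hecke_mul_subFun (F := F) hi (w := w⁻¹) (I := w ⁻¹' I) (by simpa using hw) hI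
  have h2 := congrArg transpose h
  rw [transpose_mul, transpose_hecke, transpose_subFun, transpose_subFun] at h2
  convert h2 using 2
  · congr 1
    ext k
    simp
  · rw [inv_inv]
  · ext k
    simp

/-! ### The quadratic relation -/

/-- The flags have the same spaces except possibly in dimension `i + 1`. -/
def Agree (i : ℕ) (X Y : CompleteFlag n F) : Prop :=
  ∀ j : Fin (n + 1), j.val ≠ i + 1 → X.space j = Y.space j

theorem Agree.trans {i : ℕ} {X Y Z : CompleteFlag n F} (h : Agree i X Y) (h' : Agree i Y Z) :
    Agree i X Z := fun j hj => (h j hj).trans (h' j hj)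

theorem Agree.symm {i : ℕ} {X Y : CompleteFlag n F} (h : Agree i X Y) :
    Agree i Y X := fun j hj => (h j hj).symm

theorem agree_iff (i : ℕ) (X Y : CompleteFlag n F) : Agree i X Y ↔ X = Y ∨ Adjacent i X Y := by
  constructor
  · intro h
    by_cases e : X = Y
    · exact Or.inl e
    · exact Or.inr ⟨e, h⟩
  · rintro (rfl | h)
    · exact fun _ _ => rfl
    · exact h.2

/-- For every `c` there is a flag adjacent to `X` whose `(i+1)`-st space contains the vector
`b (i + 1) + c • b i`. -/
theorem exists_adjacent_through {i : ℕ} (hi : i + 1 < n) {X : CompleteFlag n F}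
    {b : Fin n → Fin n → F} (hb : Adapted b X) (c : F) :
    ∃ H, Adjacent i X H ∧
      b ⟨i + 1, hi⟩ + c • b ⟨i, by omega⟩ ∈ H.space ⟨i + 1, by omega⟩ := by
  set t := b ⟨i + 1, hi⟩ + c • b ⟨i, by omega⟩ with ht
  set d := Function.update b ⟨i + 1, hi⟩ t
  have hda : d ⟨i + 1, hi⟩ = t := Function.update_self _ _ _
  have hbi : c • b ⟨i, by omega⟩ ∈ X.space ⟨i + 1, by omega⟩ :=
    Submodule.smul_mem _ _ (hb ⟨i, by omega⟩).1
  have hdX : Adapted d X := by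
    intro k
    by_cases hk : k = ⟨i + 1, hi⟩
    · subst hk
      rw [hda]
      refine ⟨add_mem (hb _).1 (X.space_mono (by simp) hbi), fun h => (hb ⟨i + 1, hi⟩).2 ?_⟩
      have := sub_mem h (show c • b ⟨i, by omega⟩ ∈ X.space (Fin.castSucc ⟨i + 1, hi⟩) from hbi)
      rwa [ht, add_sub_cancel_right] at this
    · rw [show d k = b k from Function.update_of_ne hk _ _]
      exact hb k
  obtain ⟨B, hB⟩ := hdX.exists_basis
  set B' := B.reindex (sw n hi).symm
  have hB' : (B' : Fin n → Fin n → F) = B ∘ sw n hi := by funext k; simp [B']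
  have hH : Adapted (B ∘ sw n hi) (flagOfBasis B') := hB' ▸ adapted_flagOfBasis B'
  refine ⟨flagOfBasis B', adjacent_of_adapted hi (hB ▸ hdX) hH, ?_⟩
  have := (hH ⟨i, by omega⟩).1
  rwa [Function.comp_apply, sw_left, hB, hda] at this

theorem not_mem_of_adapted {i : ℕ} (hi : i + 1 < n) {X : CompleteFlag n F}
    {b : Fin n → Fin n → F} (hb : Adapted b X) (c : F) :
    b ⟨i + 1, hi⟩ + c • b ⟨i, by omega⟩ ∉ X.space ⟨i + 1, by omega⟩ := by
  intro h
  have := sub_mem h (Submodule.smul_mem _ c (hb ⟨i, by omega⟩).1)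
  rw [add_sub_cancel_right] at this
  exact (hb ⟨i + 1, hi⟩).2 this

/-- Two flags that agree off dimension `i + 1` and share there a vector which does not lie in the
smaller spaces are equal. -/
theorem Agree.eq_of_mem {i : ℕ} (hi : i + 1 < n + 1) {H H' : CompleteFlag n F} (h : Agree i H H')
    {t : Fin n → F} (h1 : t ∈ H.space ⟨i + 1, hi⟩) (h2 : t ∈ H'.space ⟨i + 1, hi⟩)
    (h3 : t ∉ H.space ⟨i, by omega⟩) : H = H' := by
  by_contra hne
  exact h3 (Adjacent.mem_of_mem hi ⟨hne, h⟩ h1 h2)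

theorem card_adjacent {i : ℕ} (hi : i + 1 < n) (X : CompleteFlag n F) :
    Nat.card {H : CompleteFlag n F // Adjacent i X H} = Nat.card F := by
  obtain ⟨b, hb⟩ := X.exists_adapted
  choose g hg hgm using exists_adjacent_through hi hb
  symm
  refine Nat.card_congr (Equiv.ofBijective (fun c => ⟨g c, hg c⟩) ⟨?_, ?_⟩)
  · intro c d hcd
    have hcd' : g c = g d := congrArg Subtype.val hcd
    by_contra hne
    have h1 := sub_mem (hcd' ▸ hgm c) (hgm d)
    rw [add_sub_add_left_eq_sub, ← sub_smul, Submodule.smul_mem_iff _ (sub_ne_zero.mpr hne)] at h1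
    exact (hb ⟨i, by omega⟩).2 ((hg d).mem_of_mem (by omega) (hb ⟨i, by omega⟩).1 h1)
  · rintro ⟨H, hH⟩
    obtain ⟨B, rfl⟩ := hb.exists_basis
    obtain ⟨u, huH, huX⟩ := hH.exists_mem (by omega)
    set a : Fin n := ⟨i, by omega⟩ with ha
    set a' : Fin n := ⟨i + 1, hi⟩ with ha'
    have hne : a ≠ a' := by simp [a, a']
    have hu2 : ∀ k : Fin n, i + 2 ≤ k.val → B.repr u k = 0 := by
      have : u ∈ X.space a'.succ := by
        rw [hH.2 _ (by simp [a'])]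
        exact H.space_mono (by simp [a']) huH
      exact fun k hk => hb.mem_iff.mp this k (by simp [a']; omega)
    have hx : B.repr u a' ≠ 0 := by
      intro h0
      refine huX (hb.mem_iff.mpr fun k hk => ?_)
      rcases Nat.lt_or_ge k.val (i + 2) with h | h
      · obtain rfl : k = a' := Fin.ext (by simp [a'] at hk ⊢; omega)
        exact h0
      · exact hu2 k h
    set c := (B.repr u a')⁻¹ * B.repr u a with hc
    refine ⟨c, Subtype.ext ?_⟩
    have hlow : B a' + c • B a - (B.repr u a')⁻¹ • u ∈ X.space a.castSucc := by
      rw [hb.mem_iff]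
      intro k hk
      by_cases k1 : k = a
      · subst k1; simp [hne, hc]
      · by_cases k2 : k = a'
        · subst k2; simp [Ne.symm hne, hx]
        · have h3 := hu2 k (by
            have h1 : k.val ≠ i := fun e => k1 (Fin.ext e)
            have h2 : k.val ≠ i + 1 := fun e => k2 (Fin.ext e)
            simp [a] at hk
            omega)
          simp [h3, Ne.symm k1, Ne.symm k2]
    have htH : B a' + c • B a ∈ H.space ⟨i + 1, by omega⟩ := by
      rw [hH.2 _ (by simp [a])] at hlow
      have := add_mem (H.space_mono (j := ⟨i + 1, by omega⟩) (by simp [a]) hlow)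
        (Submodule.smul_mem _ (B.repr u a')⁻¹ huH)
      rwa [sub_add_cancel] at this
    refine Agree.eq_of_mem (by omega) (Agree.trans (hg c).symm.2 hH.2) (hgm c) htH ?_
    intro h0
    rw [← (hg c).2 _ (by simp)] at h0
    exact not_mem_of_adapted hi hb c (X.space_mono (by simp) h0)

open Classical in
theorem sum_adjacent [Fintype F] {i : ℕ} (hi : i + 1 < n) (X : CompleteFlag n F) :
    (∑ H : CompleteFlag n F, if Adjacent i X H then (1 : ℂ) else 0) = Fintype.card F := by
  rw [Finset.sum_boole]
  congr 1
  rw [← Fintype.card_subtype, ← Nat.card_eq_fintype_card, card_adjacent hi,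
    Nat.card_eq_fintype_card]

open Classical in
theorem agree_ite (i : ℕ) (X Y : CompleteFlag n F) : (if Agree i X Y then (1 : ℂ) else 0) =
    (if X = Y then 1 else 0) + if Adjacent i X Y then 1 else 0 := by
  rw [if_congr (agree_iff i X Y) rfl rfl]
  by_cases h : X = Y
  · have : ¬ Adjacent i X Y := fun h' => h'.1 h
    rw [if_pos (Or.inl h), if_pos h, if_neg this, add_zero]
  · simp [h]

open Classical in
theorem one_add_hecke_apply {i : ℕ} (hi : i + 1 < n) (X Y : CompleteFlag n F) (v : Fin n → F) :
    (1 + orbitFun F (sw n hi) ∅) X Y v = if Agree i X Y ∧ v = 0 then 1 else 0 := by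
  rw [FlagFun.add_apply, FlagFun.one_apply, orbitFun_apply,
    if_congr (inOrbit_sw_iff hi X Y v) rfl rfl]
  by_cases hv : v = 0
  · simp [hv, agree_ite]
  · simp [hv]

open Classical in
theorem one_add_hecke_mul_apply [Fintype F] {i : ℕ} (hi : i + 1 < n) (β : FlagFun n F)
    (X Y : CompleteFlag n F) (v : Fin n → F) : ((1 + orbitFun F (sw n hi) ∅) * β) X Y v =
      ∑ H : CompleteFlag n F, if Agree i X H then β H Y v else 0 := by
  rw [FlagFun.mul_apply]
  refine Finset.sum_congr rfl fun H _ => ?_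
  rw [Finset.sum_eq_single 0]
  · simp [one_add_hecke_apply hi]
  · intro u _ hu
    simp [one_add_hecke_apply hi, hu]
  · simp

open Classical in
theorem sum_agree [Fintype F] {i : ℕ} (hi : i + 1 < n) (X : CompleteFlag n F) :
    (∑ H : CompleteFlag n F, if Agree i X H then (1 : ℂ) else 0) = Fintype.card F + 1 := by
  simp only [agree_ite]
  rw [Finset.sum_add_distrib, sum_adjacent hi, Finset.sum_ite_eq, if_pos (Finset.mem_univ X),
    add_comm]

theorem hecke_quad [Fintype F] {i : ℕ} (hi : i + 1 < n) :
    (1 + orbitFun F (sw n hi) ∅) * (1 + orbitFun F (sw n hi) ∅) =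
      ((Fintype.card F : ℂ) + 1) • (1 + orbitFun F (sw n hi) ∅) := by
  classical
  ext X Y v
  rw [one_add_hecke_mul_apply, FlagFun.smul_apply, ← sum_agree hi X, Finset.sum_mul]
  refine Finset.sum_congr rfl fun H _ => ?_
  rw [one_add_hecke_apply, one_add_hecke_apply]
  by_cases h : Agree i X H
  · have : Agree i H Y ↔ Agree i X Y := ⟨h.trans, h.symm.trans⟩
    simp [h, this]
  · simp [h]

end Convolution

/-! ### Averaging over the spaces of a flag -/

section Level

variable {n : ℕ} {F : Type} [Field F]

open Classical in
/-- The characteristic function of the triples `(X, X, v)` with `v` in the `k`-th space of `X`. -/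
def levelFun (F : Type) [Field F] (k : Fin (n + 1)) : FlagFun n F :=
  fun X Y v => if X = Y ∧ v ∈ X.space k then 1 else 0

open Classical in
theorem levelFun_apply (k : Fin (n + 1)) (X Y : CompleteFlag n F) (v : Fin n → F) :
    levelFun F k X Y v = if X = Y ∧ v ∈ X.space k then 1 else 0 := rfl

theorem eq_of_adapted {b : Fin n → Fin n → F} {X Y : CompleteFlag n F} (hX : Adapted b X)
    (hY : Adapted b Y) : X = Y :=
  CompleteFlag.ext (funext fun i => by rw [hX.space_eq, hY.space_eq])

theorem subFun_one (k : Fin (n + 1)) :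
    subFun F 1 {j : Fin n | j.val < k.val} = levelFun F k := by
  classical
  ext X Y v
  rw [subFun_apply, levelFun_apply]
  refine if_congr ⟨?_, ?_⟩ rfl rfl
  · rintro ⟨b, hX, hY, hv⟩
    rw [← hX.space_eq] at hv
    exact ⟨eq_of_adapted hX (by simpa using hY), hv⟩
  · rintro ⟨rfl, hv⟩
    obtain ⟨b, hb⟩ := X.exists_adapted
    obtain ⟨B, rfl⟩ := hb.exists_basis
    refine ⟨B, hb, by simpa using hb, ?_⟩
    rwa [← hb.space_eq]

theorem levelFun_zero : levelFun F (0 : Fin (n + 1)) = 1 := by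
  classical
  ext X Y v
  rw [levelFun_apply, FlagFun.one_apply, X.space_zero]
  simp

theorem sub_mem_iff_left {V : Submodule F (Fin n → F)} {u v : Fin n → F} (hu : u ∈ V) :
    v - u ∈ V ↔ v ∈ V :=
  ⟨fun h => by simpa using add_mem h hu, fun h => sub_mem h hu⟩

theorem Adjacent.sup_eq {i : ℕ} (hi : i + 1 < n) {X Y : CompleteFlag n F} (h : Adjacent i X Y) :
    X.space ⟨i + 1, by omega⟩ ⊔ Y.space ⟨i + 1, by omega⟩ = X.space ⟨i + 2, by omega⟩ := by
  refine Submodule.eq_of_le_of_finrank_le (sup_le (X.space_mono (by simp)) ?_) ?_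
  · rw [h.2 _ (by simp)]
    exact Y.space_mono (by simp)
  · have hlt : X.space ⟨i + 1, by omega⟩ <
        X.space ⟨i + 1, by omega⟩ ⊔ Y.space ⟨i + 1, by omega⟩ := by
      refine lt_of_le_of_ne le_sup_left fun e => ?_
      obtain ⟨u, hu, hu'⟩ := h.exists_mem (by omega)
      exact hu' (e ▸ (le_sup_right : Y.space _ ≤ _) hu)
    have := Submodule.finrank_lt_finrank_of_lt hlt
    rw [X.finrank_space] at this ⊢
    exact this

/-- Every vector of `X_{i+2}` lies in the `(i+1)`-st space of a flag that agrees with `X` in the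
other dimensions. -/
theorem exists_agree_mem {i : ℕ} (hi : i + 1 < n) (X : CompleteFlag n F) {v : Fin n → F}
    (hv : v ∈ X.space ⟨i + 2, by omega⟩) : ∃ H, Agree i X H ∧ v ∈ H.space ⟨i + 1, by omega⟩ := by
  by_cases hvX : v ∈ X.space ⟨i + 1, by omega⟩
  · exact ⟨X, fun _ _ => rfl, hvX⟩
  obtain ⟨b, hb⟩ := X.exists_adapted
  set d := Function.update b ⟨i + 1, hi⟩ v
  have hd : Adapted d X := by
    intro k
    by_cases hk : k = ⟨i + 1, hi⟩
    · subst hk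
      rw [show d ⟨i + 1, hi⟩ = v from Function.update_self _ _ _]
      exact ⟨hv, hvX⟩
    · rw [show d k = b k from Function.update_of_ne hk _ _]
      exact hb k
  obtain ⟨H, hH, hm⟩ := exists_adjacent_through hi hd 0
  rw [zero_smul, add_zero, show d ⟨i + 1, hi⟩ = v from Function.update_self _ _ _] at hm
  exact ⟨H, hH.2, hm⟩

variable [Fintype F]

theorem card_space (X : CompleteFlag n F) (k : Fin (n + 1)) :
    Nat.card (X.space k) = Fintype.card F ^ k.val := by
  classical
  rw [Nat.card_eq_fintype_card, Module.card_eq_pow_finrank (K := F), X.finrank_space]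

open Classical in
theorem sum_mem_space (X : CompleteFlag n F) (k : Fin (n + 1)) :
    (∑ u : Fin n → F, if u ∈ X.space k then (1 : ℂ) else 0) = (Fintype.card F : ℂ) ^ k.val := by
  rw [Finset.sum_boole, ← Nat.cast_pow, ← card_space X k, ← Fintype.card_subtype,
    Nat.card_eq_fintype_card]

open Classical in
theorem levelFun_mul_apply (k : Fin (n + 1)) (β : FlagFun n F) (X Y : CompleteFlag n F)
    (v : Fin n → F) : (levelFun F k * β) X Y v =
      ∑ u : Fin n → F, if u ∈ X.space k then β X Y (v - u) else 0 := by
  rw [FlagFun.mul_apply, Finset.sum_eq_single X]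
  · exact Finset.sum_congr rfl fun u _ => by simp [levelFun_apply]
  · intro H _ hH
    exact Finset.sum_eq_zero fun u _ => by simp [levelFun_apply, Ne.symm hH]
  · simp

theorem levelFun_mul_levelFun (k l : Fin (n + 1)) (h : k.val ≤ l.val) :
    levelFun F k * levelFun F l = ((Fintype.card F : ℂ) ^ k.val) • levelFun F l := by
  classical
  ext X Y v
  rw [levelFun_mul_apply, FlagFun.smul_apply, ← sum_mem_space X k, Finset.sum_mul]
  refine Finset.sum_congr rfl fun u _ => ?_
  by_cases hu : u ∈ X.space k
  · simp [hu, levelFun_apply, sub_mem_iff_left (X.space_mono h hu)]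
  · simp [hu]

open Classical in
theorem levelFun_mul_hecke_apply (k : Fin (n + 1)) {i : ℕ} (hi : i + 1 < n)
    (X Y : CompleteFlag n F) (v : Fin n → F) :
    (levelFun F k * orbitFun F (sw n hi) ∅) X Y v =
      if Adjacent i X Y ∧ v ∈ X.space k then 1 else 0 := by
  rw [levelFun_mul_apply, Finset.sum_eq_single v]
  · simp [orbitFun_apply, inOrbit_sw_iff, ← ite_and, and_comm]
  · intro u _ hu
    simp [orbitFun_apply, inOrbit_sw_iff, sub_eq_zero, Ne.symm hu]
  · simp

open Classical in
theorem hecke_mul_levelFun_apply (k : Fin (n + 1)) {i : ℕ} (hi : i + 1 < n)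
    (X Y : CompleteFlag n F) (v : Fin n → F) :
    (orbitFun F (sw n hi) ∅ * levelFun F k) X Y v =
      if Adjacent i X Y ∧ v ∈ Y.space k then 1 else 0 := by
  rw [hecke_mul_apply, Finset.sum_eq_single Y]
  · simp [levelFun_apply, ← ite_and]
  · intro H _ hH
    simp [levelFun_apply, hH]
  · simp

theorem levelFun_mul_hecke_comm (k : Fin (n + 1)) {i : ℕ} (hi : i + 1 < n) (hk : k.val ≠ i + 1) :
    levelFun F k * orbitFun F (sw n hi) ∅ = orbitFun F (sw n hi) ∅ * levelFun F k := by
  classical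
  ext X Y v
  rw [levelFun_mul_hecke_apply, hecke_mul_levelFun_apply]
  refine if_congr (and_congr_right fun h => ?_) rfl rfl
  rw [h.2 k hk]

/-- The sum of the spaces of dimension `i + 1` of two adjacent flags is the space of dimension
`i + 2`, and their intersection has dimension `i`. -/
theorem levelFun_mul_hecke_mul_levelFun {i : ℕ} (hi : i + 1 < n) :
    levelFun F ⟨i + 1, by omega⟩ * (orbitFun F (sw n hi) ∅ * levelFun F ⟨i + 1, by omega⟩) =
      ((Fintype.card F : ℂ) ^ i) • (orbitFun F (sw n hi) ∅ * levelFun F ⟨i + 2, by omega⟩) := by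
  classical
  ext X Y v
  rw [levelFun_mul_apply, FlagFun.smul_apply, hecke_mul_levelFun_apply]
  simp only [hecke_mul_levelFun_apply]
  by_cases h : Adjacent i X Y
  · simp only [h, true_and]
    rw [← h.2 ⟨i + 2, by omega⟩ (by simp), ← h.sup_eq hi]
    split_ifs with hv
    · obtain ⟨u₀, hu₀, y, hy, rfl⟩ := Submodule.mem_sup.mp hv
      have := sum_mem_space X ⟨i, by omega⟩
      simp only at this
      rw [mul_one, ← this]
      symm
      refine Fintype.sum_equiv (Equiv.addLeft u₀) _ _ fun u => ?_
      rw [Equiv.coe_addLeft, ← ite_and]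
      refine if_congr ⟨fun hu => ⟨add_mem hu₀ (X.space_mono (by simp) hu), ?_⟩, ?_⟩ rfl rfl
      · rw [add_sub_add_left_eq_sub]
        rw [h.2 _ (by simp)] at hu
        exact sub_mem hy (Y.space_mono (by simp) hu)
      · rintro ⟨h1, h2⟩
        rw [add_sub_add_left_eq_sub] at h2
        refine h.mem_of_mem (by omega) ((Submodule.add_mem_iff_right _ hu₀).mp h1) ?_
        simpa using sub_mem hy h2
    · rw [mul_zero]
      refine Finset.sum_eq_zero fun u _ => ?_
      rw [← ite_and, if_neg]
      rintro ⟨h1, h2⟩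
      exact hv (by simpa using Submodule.add_mem_sup h1 h2)
  · simp [h]

open Classical in
/-- The number of flags that agree with `X` except possibly for their line and whose line
contains `v`. -/
theorem sum_agree_mem (hi : 0 + 1 < n) (X : CompleteFlag n F) (v : Fin n → F) :
    (∑ H : CompleteFlag n F, if Agree 0 X H ∧ v ∈ H.space ⟨1, by omega⟩ then (1 : ℂ) else 0) =
      (if v = 0 then (Fintype.card F : ℂ) else 0) +
        if v ∈ X.space ⟨2, by omega⟩ then 1 else 0 := by
  by_cases hv : v = 0
  · subst hv
    simpa using sum_agree hi X
  · rw [if_neg hv, zero_add]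
    split_ifs with h
    · obtain ⟨H, hH, hm⟩ := exists_agree_mem hi X h
      rw [Finset.sum_eq_single H, if_pos ⟨hH, hm⟩]
      · intro H' _ hne
        rw [if_neg]
        rintro ⟨hH', hm'⟩
        refine hne (Agree.eq_of_mem (by omega) (hH'.symm.trans hH) hm' hm fun h0 => hv ?_)
        change v ∈ H'.space 0 at h0
        rw [H'.space_zero] at h0
        simpa using h0
      · simp
    · refine Finset.sum_eq_zero fun H _ => ?_
      rw [if_neg]
      rintro ⟨hH, hm⟩
      refine h ?_
      rw [hH _ (by simp)]
      exact H.space_mono (by simp) hm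

/-- The geometric form of the relation `rook`. -/
theorem one_add_hecke_mul_levelFun_mul (hi : 0 + 1 < n) :
    (1 + orbitFun F (sw n hi) ∅) * (levelFun F ⟨1, by omega⟩ * (1 + orbitFun F (sw n hi) ∅)) =
      (Fintype.card F : ℂ) • (1 + orbitFun F (sw n hi) ∅) +
        (1 + orbitFun F (sw n hi) ∅) * levelFun F ⟨2, by omega⟩ := by
  classical
  have h2 : ∀ (k : Fin (n + 1)) (X Y : CompleteFlag n F) (v : Fin n → F),
      (levelFun F k * (1 + orbitFun F (sw n hi) ∅)) X Y v =
        if Agree 0 X Y ∧ v ∈ X.space k then 1 else 0 := by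
    intro k X Y v
    rw [mul_add, mul_one, FlagFun.add_apply, levelFun_mul_hecke_apply, levelFun_apply]
    by_cases hv : v ∈ X.space k
    · simp [hv, agree_ite]
    · simp [hv]
  have h3 : (1 + orbitFun F (sw n hi) ∅) * levelFun F ⟨2, by omega⟩ =
      levelFun F ⟨2, by omega⟩ * (1 + orbitFun F (sw n hi) ∅) := by
    rw [add_mul, mul_add, one_mul, mul_one, levelFun_mul_hecke_comm _ _ (by simp)]
  ext X Y v
  rw [one_add_hecke_mul_apply, FlagFun.add_apply, FlagFun.smul_apply, one_add_hecke_apply, h3, h2]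
  simp only [h2]
  by_cases h : Agree 0 X Y
  · have e : ∀ H, Agree 0 X H → Agree 0 H Y := fun H hH => hH.symm.trans h
    have := sum_agree_mem hi X v
    simp only [h, true_and]
    rw [mul_ite, mul_one, mul_zero, ← this]
    refine Finset.sum_congr rfl fun H _ => ?_
    by_cases hH : Agree 0 X H
    · simp [hH, e H hH]
    · simp [hH]
  · simp only [h, false_and, if_false, mul_zero, add_zero]
    refine Finset.sum_eq_zero fun H _ => ?_
    split_ifs with h4 h5
    · exact absurd (h4.trans h5.1) h
    · rfl
    · rfl

end Level

/-! ### Relations in the integral algebra -/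

section Families

open LaurentPolynomial (T)

variable {n : ℕ}

theorem evalAt_T (q : ℂˣ) (k : ℤ) : evalAt q (T k) = (q : ℂ) ^ k := by
  simp [evalAt]

theorem card_field (r : PrimePower) : (Fintype.card r.field : ℂ) = r.card := by
  rw [← Nat.card_eq_fintype_card, GaloisField.card _ _ r.pos.ne']
  simp [PrimePower.card]

/-- The indeterminate acts on the convolution algebra over the field with `r` elements as `r`. -/
theorem smul_family_apply (c : ℂ[T;T⁻¹]) (x : ∀ r : PrimePower, ConvAlg n r) (r : PrimePower) :
    (c • x) r = @HSMul.hSMul ℂ (FlagFun n r.field) _ _ (evalAt r.card c) (x r) := by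
  rw [Pi.smul_apply, Algebra.smul_def]
  exact (Algebra.smul_def (R := ℂ) (A := FlagFun n r.field) _ _).symm

/-- The families of characteristic functions of `InSub w I`. -/
def subFam (w : Equiv.Perm (Fin n)) (I : Set (Fin n)) : ∀ r : PrimePower, ConvAlg n r :=
  fun r => subFun r.field w I

/-- The families of functions `levelFun k`. -/
def levelFam (k : Fin (n + 1)) : ∀ r : PrimePower, ConvAlg n r :=
  fun r => levelFun r.field k

/-- The families of the Hecke generators. -/
def heckeFam {i : ℕ} (hi : i + 1 < n) : ∀ r : PrimePower, ConvAlg n r :=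
  orbitFamily (sw n hi) ∅

theorem subFam_empty (w : Equiv.Perm (Fin n)) : subFam w ∅ = orbitFamily w ∅ :=
  funext fun _ => subFun_empty w

theorem levelFam_zero : levelFam (0 : Fin (n + 1)) = 1 := funext fun _ => levelFun_zero

theorem subFam_one (k : Fin (n + 1)) : subFam 1 {j : Fin n | j.val < k.val} = levelFam k :=
  funext fun _ => subFun_one k

theorem heckeFam_mul_subFam {i : ℕ} (hi : i + 1 < n) {w : Equiv.Perm (Fin n)}
    (hw : w⁻¹ ⟨i + 1, hi⟩ < w⁻¹ ⟨i, by omega⟩) {I : Set (Fin n)}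
    (hI : (⟨i, by omega⟩ : Fin n) ∈ I → (⟨i + 1, hi⟩ : Fin n) ∈ I) :
    heckeFam hi * subFam (sw n hi * w) (sw n hi ⁻¹' I) = subFam w I :=
  funext fun _ => hecke_mul_subFun hi hw hI

theorem subFam_mul_heckeFam {i : ℕ} (hi : i + 1 < n) {w : Equiv.Perm (Fin n)}
    (hw : w ⟨i + 1, hi⟩ < w ⟨i, by omega⟩) {I : Set (Fin n)}
    (hI : w ⟨i, by omega⟩ ∈ I → w ⟨i + 1, hi⟩ ∈ I) :
    subFam (w * sw n hi) I * heckeFam hi = subFam w I :=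
  funext fun _ => subFun_mul_hecke hi hw hI

/-- `hecke_mul_subFun` in terms of the permutation before the multiplication. -/
theorem heckeFam_mul_subFam' {i : ℕ} (hi : i + 1 < n) {w : Equiv.Perm (Fin n)}
    (hw : w⁻¹ ⟨i, by omega⟩ < w⁻¹ ⟨i + 1, hi⟩) {I : Set (Fin n)}
    (hI : (⟨i + 1, hi⟩ : Fin n) ∈ I → (⟨i, by omega⟩ : Fin n) ∈ I) :
    heckeFam hi * subFam w I = subFam (sw n hi * w) (sw n hi ⁻¹' I) := by
  have h := heckeFam_mul_subFam hi (w := sw n hi * w) (I := sw n hi ⁻¹' I)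
    (by simpa [mul_inv_rev, sw_inv] using hw) (by simpa using hI)
  rw [← mul_assoc, sw_mul_self, one_mul] at h
  convert h using 3
  ext k
  simp

theorem heckeFam_quad {i : ℕ} (hi : i + 1 < n) :
    heckeFam hi * heckeFam hi = (T 1 - 1 : ℂ[T;T⁻¹]) • heckeFam hi + (T 1 : ℂ[T;T⁻¹]) • 1 := by
  have h : ((1 + heckeFam hi) * (1 + heckeFam hi) : ∀ r : PrimePower, ConvAlg n r) =
      (T 1 + 1 : ℂ[T;T⁻¹]) • (1 + heckeFam hi) := by
    funext r
    rw [smul_family_apply, map_add, evalAt_T, map_one, zpow_one, ← card_field]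
    exact hecke_quad hi
  have h2 : heckeFam hi * heckeFam hi =
      (1 + heckeFam hi) * (1 + heckeFam hi) - 1 - heckeFam hi - heckeFam hi := by
    noncomm_ring
  rw [h2, h]
  module

theorem swap_braid {α : Type*} [DecidableEq α] {a b c : α} (hab : a ≠ b) (hbc : b ≠ c)
    (hac : a ≠ c) : Equiv.swap a b * (Equiv.swap b c * Equiv.swap a b) =
      Equiv.swap b c * (Equiv.swap a b * Equiv.swap b c) := by
  have h := Equiv.swap_mul_swap_mul_swap hbc.symm hac.symm
  rw [Equiv.swap_comm b a, Equiv.swap_comm c b] at h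
  rw [← mul_assoc, ← mul_assoc, Equiv.swap_mul_swap_mul_swap hab hac, h, Equiv.swap_comm]

theorem heckeFam_braid {i : ℕ} (hi : i + 2 < n) :
    heckeFam (n := n) (i := i) (by omega) *
        (heckeFam (i := i + 1) hi * heckeFam (i := i) (by omega)) =
      heckeFam (i := i + 1) hi * (heckeFam (i := i) (by omega) * heckeFam (i := i + 1) hi) := by
  have hA : i + 1 < n := by omega
  have e1 : heckeFam hA = subFam (sw n hA) ∅ := (subFam_empty _).symm
  have e2 : heckeFam (i := i + 1) hi = subFam (sw n (i := i + 1) hi) ∅ := (subFam_empty _).symm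
  set s := sw n hA with hs
  set t := sw n (i := i + 1) hi with ht
  have s0 : s ⟨i, by omega⟩ = ⟨i + 1, hA⟩ := sw_left hA
  have s1 : s ⟨i + 1, hA⟩ = ⟨i, by omega⟩ := sw_right hA
  have s2 : s ⟨i + 2, hi⟩ = ⟨i + 2, hi⟩ := sw_of_ne hA (by simp) (by simp)
  have t0 : t ⟨i, by omega⟩ = ⟨i, by omega⟩ := sw_of_ne (i := i + 1) hi (by simp) (by simp; omega)
  have t1 : t ⟨i + 1, hA⟩ = ⟨i + 2, hi⟩ := sw_left (i := i + 1) hi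
  have t2 : t ⟨i + 2, hi⟩ = ⟨i + 1, hA⟩ := sw_right (i := i + 1) hi
  have si : s⁻¹ = s := sw_inv hA
  have ti : t⁻¹ = t := sw_inv (i := i + 1) hi
  have hts : heckeFam (i := i + 1) hi * subFam s ∅ = subFam (t * s) ∅ := by
    have := heckeFam_mul_subFam' (i := i + 1) hi (w := s) (I := ∅)
      (by rw [si, s1, s2]; exact Fin.mk_lt_mk.mpr (by omega)) (by simp)
    simpa using this
  have hst : heckeFam hA * subFam t ∅ = subFam (s * t) ∅ := by
    have := heckeFam_mul_subFam' hA (w := t) (I := ∅)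
      (by rw [ti, t0, t1]; exact Fin.mk_lt_mk.mpr (by omega)) (by simp)
    simpa using this
  have hsts : heckeFam hA * subFam (t * s) ∅ = subFam (s * (t * s)) ∅ := by
    have := heckeFam_mul_subFam' hA (w := t * s) (I := ∅)
      (by rw [mul_inv_rev, si, ti, Equiv.Perm.mul_apply, Equiv.Perm.mul_apply, t0, s0, t1, s2]
          exact Fin.mk_lt_mk.mpr (by omega)) (by simp)
    simpa using this
  have htst : heckeFam (i := i + 1) hi * subFam (s * t) ∅ = subFam (t * (s * t)) ∅ := by
    have := heckeFam_mul_subFam' (i := i + 1) hi (w := s * t) (I := ∅)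
      (by rw [mul_inv_rev, si, ti, Equiv.Perm.mul_apply, Equiv.Perm.mul_apply, s1, t0, s2, t2]
          exact Fin.mk_lt_mk.mpr (by omega)) (by simp)
    simpa using this
  have hb : s * (t * s) = t * (s * t) := swap_braid (by simp) (by simp) (by simp; omega)
  have l1 : heckeFam (i := i + 1) hi * heckeFam hA = subFam (t * s) ∅ := by rw [e1, hts]
  have l2 : heckeFam hA * heckeFam (i := i + 1) hi = subFam (s * t) ∅ := by rw [e2, hst]
  rw [l1, l2, hsts, htst, hb]

theorem heckeFam_comm {i j : ℕ} (hij : i + 1 < j) (hj : j + 1 < n) :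
    heckeFam (n := n) (i := i) (by omega) * heckeFam hj =
      heckeFam hj * heckeFam (i := i) (by omega) := by
  have hi : i + 1 < n := by omega
  have e1 : heckeFam hi = subFam (sw n hi) ∅ := (subFam_empty _).symm
  have e2 : heckeFam hj = subFam (sw n hj) ∅ := (subFam_empty _).symm
  have h1 := heckeFam_mul_subFam' hi (w := sw n hj) (I := ∅)
    (by rw [sw_inv, sw_of_ne hj (by simp; omega) (by simp; omega),
          sw_of_ne hj (by simp; omega) (by simp; omega)]; simp) (by simp)
  have h2 := heckeFam_mul_subFam' hj (w := sw n hi) (I := ∅)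
    (by rw [sw_inv, sw_of_ne hi (by simp; omega) (by simp; omega),
          sw_of_ne hi (by simp; omega) (by simp; omega)]; simp) (by simp)
  have hc : sw n hi * sw n hj = sw n hj * sw n hi :=
    (Equiv.Perm.disjoint_swap_swap (by simp; omega)).commute.eq
  rw [← e2] at h1
  rw [← e1] at h2
  rw [h1, h2, hc]
  rfl

theorem levelFam_mul_levelFam (k l : Fin (n + 1)) (h : k.val ≤ l.val) :
    levelFam k * levelFam l = (T (k.val : ℤ) : ℂ[T;T⁻¹]) • levelFam l := by
  funext r
  rw [smul_family_apply, evalAt_T, zpow_natCast, ← card_field]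
  exact levelFun_mul_levelFun k l h

theorem levelFam_mul_heckeFam (k : Fin (n + 1)) {i : ℕ} (hi : i + 1 < n) (hk : k.val ≠ i + 1) :
    levelFam k * heckeFam hi = heckeFam hi * levelFam k :=
  funext fun _ => levelFun_mul_hecke_comm k hi hk

theorem levelFam_mul_heckeFam_mul_levelFam {i : ℕ} (hi : i + 1 < n) :
    levelFam ⟨i + 1, by omega⟩ * (heckeFam hi * levelFam ⟨i + 1, by omega⟩) =
      (T (i : ℤ) : ℂ[T;T⁻¹]) • (heckeFam hi * levelFam ⟨i + 2, by omega⟩) := by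
  funext r
  rw [smul_family_apply, evalAt_T, zpow_natCast, ← card_field]
  exact levelFun_mul_hecke_mul_levelFun hi

theorem one_add_heckeFam_mul_levelFam_mul (hi : 0 + 1 < n) :
    (1 + heckeFam hi) * (levelFam ⟨1, by omega⟩ * (1 + heckeFam hi)) =
      (T 1 : ℂ[T;T⁻¹]) • (1 + heckeFam hi) + (1 + heckeFam hi) * levelFam ⟨2, by omega⟩ := by
  funext r
  rw [Pi.add_apply, smul_family_apply, evalAt_T, zpow_one, ← card_field]
  exact one_add_hecke_mul_levelFun_mul hi

/-- `T_0 + 1` is the family of characteristic functions of the triples `(X, X, v)`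
with `v` in the line of `X`. -/
theorem heckeZero_add_one (hn : 0 < n) :
    orbitFamily (1 : Equiv.Perm (Fin n)) {i | i.val = 0} + 1 = levelFam ⟨1, by omega⟩ := by
  classical
  have hset : ({i | i.val = 0} : Finset (Fin n)) = {⟨0, hn⟩} := by ext k; simp [Fin.ext_iff]
  funext r
  refine FlagFun.ext fun X Y v => ?_
  change orbitFun r.field 1 _ X Y v + (1 : FlagFun n r.field) X Y v = levelFun r.field _ X Y v
  rw [orbitFun_apply, levelFun_apply, FlagFun.one_apply, hset]
  have key : InOrbit 1 {⟨0, hn⟩} X Y v ↔ X = Y ∧ v ∈ X.space ⟨1, by omega⟩ ∧ v ≠ 0 := by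
    rw [inOrbit_iff]
    constructor
    · rintro ⟨b, hX, hY, hv⟩
      refine ⟨eq_of_adapted hX (by simpa using hY), ?_, ?_⟩
      · rw [hv, Finset.sum_singleton]
        exact (hX ⟨0, hn⟩).1
      · rw [hv, Finset.sum_singleton]
        exact b.ne_zero _
    · rintro ⟨rfl, hv, hv0⟩
      obtain ⟨b, hb⟩ := X.exists_adapted
      have hd : Adapted (Function.update b ⟨0, hn⟩ v) X := by
        intro k
        by_cases hk : k = ⟨0, hn⟩
        · subst hk
          rw [Function.update_self]
          refine ⟨hv, fun h => hv0 ?_⟩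
          change v ∈ X.space 0 at h
          rw [X.space_zero] at h
          simpa using h
        · rw [Function.update_of_ne hk]
          exact hb k
      obtain ⟨B, hB⟩ := hd.exists_basis
      refine ⟨B, hB ▸ hd, by simpa [hB] using hd, ?_⟩
      rw [Finset.sum_singleton, hB, Function.update_self]
  rw [if_congr key rfl rfl]
  by_cases h0 : v = 0
  · simp [h0]
  · simp [h0]

end Families

/-! ### Inversions -/

section Inversions

variable {n : ℕ}

/-- The number of inversions of a permutation. -/
def inversions (w : Equiv.Perm (Fin n)) : ℕ :=
  ∑ a : Fin n, ∑ b : Fin n, if a < b ∧ w b < w a then 1 else 0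

theorem inversions_inv (w : Equiv.Perm (Fin n)) : inversions w⁻¹ = inversions w := by
  unfold inversions
  rw [Finset.sum_comm]
  rw [← Equiv.sum_comp w]
  refine Finset.sum_congr rfl fun a _ => ?_
  rw [← Equiv.sum_comp w]
  refine Finset.sum_congr rfl fun b _ => ?_
  simp [and_comm]

/-- Multiplication by an adjacent transposition only affects the inversion of the two
exchanged points. -/
theorem inversions_mul_sw {i : ℕ} (hi : i + 1 < n) {w : Equiv.Perm (Fin n)}
    (hw : w ⟨i + 1, hi⟩ < w ⟨i, by omega⟩) :
    inversions w = inversions (w * sw n hi) + 1 := by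
  have hs : inversions (w * sw n hi) = ∑ a : Fin n, ∑ b : Fin n,
      if sw n hi a < sw n hi b ∧ w b < w a then 1 else 0 := by
    unfold inversions
    rw [← Equiv.sum_comp (sw n hi)]
    refine Finset.sum_congr rfl fun a _ => ?_
    rw [← Equiv.sum_comp (sw n hi)]
    refine Finset.sum_congr rfl fun b _ => ?_
    simp
  have h1 : (1 : ℕ) = ∑ a : Fin n, ∑ b : Fin n,
      if a = ⟨i, by omega⟩ ∧ b = ⟨i + 1, hi⟩ then 1 else 0 := by
    simp [ite_and]
  rw [hs]
  nth_rw 2 [h1]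
  unfold inversions
  simp only [← Finset.sum_add_distrib]
  refine Finset.sum_congr rfl fun a _ => Finset.sum_congr rfl fun b _ => ?_
  by_cases ha : a.val = i
  · have ha' : a = ⟨i, Nat.lt_of_succ_lt hi⟩ := Fin.ext ha
    by_cases hb : b.val = i + 1
    · have hb' : b = ⟨i + 1, hi⟩ := Fin.ext hb
      rw [ha', hb', sw_left, sw_right]
      simp [hw]
    · by_cases hb2 : b.val = i
      · have hb' : b = ⟨i, Nat.lt_of_succ_lt hi⟩ := Fin.ext hb2
        rw [ha', hb']
        simp
      · rw [sw_of_ne hi hb2 hb, ha', sw_left,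
          if_neg (c := _ ∧ b = _) (fun h => hb (congrArg Fin.val h.2)), add_zero]
        refine if_congr (and_congr_left fun _ => ?_) rfl rfl
        rw [Fin.lt_def, Fin.lt_def]
        simp only
        omega
  · rw [if_neg (c := a = _ ∧ _) (fun h => ha (congrArg Fin.val h.1)), add_zero]
    by_cases ha1 : a.val = i + 1
    · have ha' : a = ⟨i + 1, hi⟩ := Fin.ext ha1
      by_cases hb : b.val = i
      · have hb' : b = ⟨i, Nat.lt_of_succ_lt hi⟩ := Fin.ext hb
        have hw' := hw.not_gt
        rw [ha', hb']
        simp [hw']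
      · by_cases hb2 : b.val = i + 1
        · have hb' : b = ⟨i + 1, hi⟩ := Fin.ext hb2
          rw [ha', hb']
          simp
        · rw [sw_of_ne hi hb hb2, ha', sw_right]
          refine if_congr (and_congr_left fun _ => ?_) rfl rfl
          rw [Fin.lt_def, Fin.lt_def]
          simp only
          omega
    · rw [sw_of_ne hi ha ha1]
      refine if_congr (and_congr_left fun _ => ?_) rfl rfl
      rw [Fin.lt_def, Fin.lt_def]
      by_cases hb : b.val = i
      · rw [show b = ⟨i, Nat.lt_of_succ_lt hi⟩ from Fin.ext hb, sw_left]
        simp only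
        omega
      · by_cases hb2 : b.val = i + 1
        · rw [show b = ⟨i + 1, hi⟩ from Fin.ext hb2, sw_right]
          simp only
          omega
        · rw [sw_of_ne hi hb hb2]

theorem inversions_sw_mul {i : ℕ} (hi : i + 1 < n) {w : Equiv.Perm (Fin n)}
    (hw : w⁻¹ ⟨i + 1, hi⟩ < w⁻¹ ⟨i, by omega⟩) :
    inversions w = inversions (sw n hi * w) + 1 := by
  rw [← inversions_inv w, inversions_mul_sw hi hw, ← inversions_inv (sw n hi * w), mul_inv_rev,
    sw_inv]

/-- A permutation without descents is the identity. -/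
theorem eq_one_of_forall_lt {w : Equiv.Perm (Fin n)}
    (h : ∀ i (hi : i + 1 < n), w ⟨i, by omega⟩ < w ⟨i + 1, hi⟩) : w = 1 := by
  have hm : StrictMono w := by
    cases n with
    | zero => exact fun a => a.elim0
    | succ m => exact Fin.strictMono_iff_lt_succ.mpr fun i => h i.val (by omega)
  have := Subsingleton.elim (hm.orderIsoOfSurjective w w.surjective) (OrderIso.refl (Fin n))
  ext k
  exact congrArg Fin.val (DFunLike.congr_fun this k)

end Inversions

/-! ### The generators generate -/

section Generation

open LaurentPolynomial (T)

variable {n : ℕ}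

/-- `I` is closed downwards in the partial order in which `k` precedes `l` if `k ≤ l` and
`w⁻¹ k ≤ w⁻¹ l`. These are the sets for which the span of the vectors with
index in `I` depends only on the two flags and not on the adapted basis. -/
def IsLowerFor (w : Equiv.Perm (Fin n)) (I : Set (Fin n)) : Prop :=
  ∀ k l, l ∈ I → k ≤ l → w⁻¹ k ≤ w⁻¹ l → k ∈ I

theorem IsLowerFor.inv {w : Equiv.Perm (Fin n)} {I : Set (Fin n)} (h : IsLowerFor w I) :
    IsLowerFor w⁻¹ (w ⁻¹' I) := by
  intro k l hl hkl hw
  rw [inv_inv] at hw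
  exact h _ _ hl hw (by simpa using hkl)

theorem IsLowerFor.sw_mul {i : ℕ} (hi : i + 1 < n) {w : Equiv.Perm (Fin n)} {I : Set (Fin n)}
    (h : IsLowerFor w I) (hI : (⟨i, by omega⟩ : Fin n) ∈ I → (⟨i + 1, hi⟩ : Fin n) ∈ I) :
    IsLowerFor (sw n hi * w) (sw n hi ⁻¹' I) := by
  intro k l hl hkl hw
  rw [mul_inv_rev, sw_inv, Equiv.Perm.mul_apply, Equiv.Perm.mul_apply] at hw
  rw [Set.mem_preimage] at hl ⊢
  by_cases hs : sw n hi k ≤ sw n hi l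
  · exact h _ _ hl hs hw
  have hk : k.val = i ∧ l.val = i + 1 := by
    rw [Fin.le_def] at hs hkl
    by_contra hcon
    apply hs
    by_cases k1 : k.val = i
    · rw [show k = ⟨i, Nat.lt_of_succ_lt hi⟩ from Fin.ext k1, sw_left]
      by_cases l1 : l.val = i
      · rw [show l = ⟨i, Nat.lt_of_succ_lt hi⟩ from Fin.ext l1, sw_left]
      · rw [sw_of_ne hi l1 (by omega)]
        simp only
        omega
    · by_cases k2 : k.val = i + 1
      · rw [show k = ⟨i + 1, hi⟩ from Fin.ext k2, sw_right]
        by_cases l2 : l.val = i + 1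
        · rw [show l = ⟨i + 1, hi⟩ from Fin.ext l2, sw_right]
        · rw [sw_of_ne hi (by omega) l2]
          simp only
          omega
      · rw [sw_of_ne hi k1 k2]
        by_cases l1 : l.val = i
        · rw [show l = ⟨i, Nat.lt_of_succ_lt hi⟩ from Fin.ext l1, sw_left]
          simp only
          omega
        · by_cases l2 : l.val = i + 1
          · rw [show l = ⟨i + 1, hi⟩ from Fin.ext l2, sw_right]
            simp only
            omega
          · rw [sw_of_ne hi l1 l2]
            exact hkl
  obtain ⟨k1, l1⟩ := hk
  rw [show l = ⟨i + 1, hi⟩ from Fin.ext l1, sw_right] at hl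
  rw [show k = ⟨i, Nat.lt_of_succ_lt hi⟩ from Fin.ext k1, sw_left]
  exact hI hl

theorem IsLowerFor.mul_sw {i : ℕ} (hi : i + 1 < n) {w : Equiv.Perm (Fin n)} {I : Set (Fin n)}
    (h : IsLowerFor w I) (hI : w ⟨i, by omega⟩ ∈ I → w ⟨i + 1, hi⟩ ∈ I) :
    IsLowerFor (w * sw n hi) I := by
  have h2 := (h.inv.sw_mul hi hI).inv
  rw [mul_inv_rev, inv_inv, sw_inv] at h2
  convert h2 using 1
  ext k
  simp

/-- A down closed set of `Fin n` is an initial segment. -/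
theorem exists_eq_lt_of_down_closed {I : Set (Fin n)}
    (h : ∀ i (hi : i + 1 < n), (⟨i + 1, hi⟩ : Fin n) ∈ I → (⟨i, by omega⟩ : Fin n) ∈ I) :
    ∃ k : Fin (n + 1), I = {j | j.val < k.val} := by
  have hd : ∀ (d : ℕ) (a : Fin n) (hd : a.val + d < n), (⟨a.val + d, hd⟩ : Fin n) ∈ I → a ∈ I := by
    intro d
    induction d with
    | zero => exact fun a _ h => h
    | succ d ih => exact fun a ha hm => ih a (by omega) (h _ ha hm)
  have hd' : ∀ a b : Fin n, a ≤ b → b ∈ I → a ∈ I := fun a b hab hb =>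
    hd (b.val - a.val) a (by omega) (by
      rw [Fin.le_def] at hab
      convert hb using 1
      exact Fin.ext (by simp only; omega))
  by_cases hall : ∀ a, a ∈ I
  · exact ⟨Fin.last n, by ext a; simp [hall a]⟩
  · push Not at hall
    obtain ⟨a, ha, hmin⟩ := WellFounded.has_min (wellFounded_lt (α := Fin n)) {a | a ∉ I} hall
    refine ⟨a.castSucc, ?_⟩
    ext b
    constructor
    · intro hb
      by_contra hcon
      exact ha (hd' a b (not_lt.mp hcon) hb)
    · intro hb
      by_contra hcon
      exact hmin b hcon hb

variable {S : Subalgebra ℂ[T;T⁻¹] (∀ r : PrimePower, ConvAlg n r)}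
  (hT : ∀ i (hi : i + 1 < n), heckeFam hi ∈ S)
  (hL : ∀ hn : 0 < n, levelFam (⟨1, by omega⟩ : Fin (n + 1)) ∈ S)

theorem smul_T_cancel {M : Type*} [AddCommGroup M] [Module ℂ[T;T⁻¹] M] (k : ℤ) (x : M) :
    (T (-k) : ℂ[T;T⁻¹]) • (T k : ℂ[T;T⁻¹]) • x = x := by
  rw [smul_smul, ← LaurentPolynomial.T_add, neg_add_cancel, LaurentPolynomial.T_zero, one_smul]

/-- The inverse of a Hecke generator is a combination of the generator and the identity. -/
theorem inv_mul_heckeFam {i : ℕ} (hi : i + 1 < n) (x : ∀ r : PrimePower, ConvAlg n r) :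
    (T (-1) : ℂ[T;T⁻¹]) • ((heckeFam hi - (T 1 - 1 : ℂ[T;T⁻¹]) • 1) * (heckeFam hi * x)) = x := by
  rw [← mul_assoc, sub_mul, heckeFam_quad, smul_mul_assoc, one_mul, add_sub_cancel_left,
    smul_mul_assoc, one_mul, smul_T_cancel]

include hT hL in
theorem levelFam_mem (k : ℕ) (hk : k < n + 1) : levelFam ⟨k, hk⟩ ∈ S := by
  induction k with
  | zero => exact levelFam_zero (n := n) ▸ S.one_mem
  | succ k ih =>
    cases k with
    | zero => exact hL (by omega)
    | succ k =>
      have hi : k + 1 < n := by omega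
      have h1 := S.mul_mem (ih (by omega)) (S.mul_mem (hT k hi) (ih (by omega)))
      rw [levelFam_mul_heckeFam_mul_levelFam hi] at h1
      have h2 := S.smul_mem h1 (T (-(k : ℤ)))
      rw [smul_T_cancel] at h2
      rw [← inv_mul_heckeFam hi (levelFam _)]
      exact S.smul_mem (S.mul_mem (S.sub_mem (hT k hi) (S.smul_mem S.one_mem _)) h2) _

include hT hL in
/-- If no descent of `w` on either side is compatible with `I`, then `w = 1` and `I` is an initial
segment, so that the function is a `levelFam`; otherwise the number of inversions drops. -/
theorem subFam_mem (N : ℕ) (w : Equiv.Perm (Fin n)) (I : Set (Fin n)) (hN : inversions w = N)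
    (h : IsLowerFor w I) : subFam w I ∈ S := by
  induction N using Nat.strong_induction_on generalizing w I with
  | _ N ih =>
  by_cases hl : ∃ (i : ℕ) (hi : i + 1 < n), w⁻¹ ⟨i + 1, hi⟩ < w⁻¹ ⟨i, by omega⟩ ∧
      ((⟨i, by omega⟩ : Fin n) ∈ I → (⟨i + 1, hi⟩ : Fin n) ∈ I)
  · obtain ⟨i, hi, hw, hI⟩ := hl
    rw [← heckeFam_mul_subFam hi hw hI]
    have := inversions_sw_mul hi hw
    exact S.mul_mem (hT i hi) (ih _ (by omega) _ _ rfl (h.sw_mul hi hI))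
  by_cases hr : ∃ (i : ℕ) (hi : i + 1 < n), w ⟨i + 1, hi⟩ < w ⟨i, by omega⟩ ∧
      (w ⟨i, by omega⟩ ∈ I → w ⟨i + 1, hi⟩ ∈ I)
  · obtain ⟨i, hi, hw, hI⟩ := hr
    rw [← subFam_mul_heckeFam hi hw hI]
    have := inversions_mul_sw hi hw
    exact S.mul_mem (ih _ (by omega) _ _ rfl (h.mul_sw hi hI)) (hT i hi)
  push Not at hl hr
  have hne : ∀ (u : Equiv.Perm (Fin n)) i (hi : i + 1 < n),
      u ⟨i + 1, hi⟩ < u ⟨i, by omega⟩ ∨ u ⟨i, by omega⟩ < u ⟨i + 1, hi⟩ := fun u i hi =>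
    lt_or_gt_of_ne fun e => by simpa using u.injective e
  obtain ⟨k, hk⟩ := exists_eq_lt_of_down_closed (I := I) fun i hi hm => by
    rcases hne w⁻¹ i hi with h1 | h1
    · exact (hl i hi h1).1
    · exact h _ _ hm (Fin.mk_le_mk.mpr (by omega)) h1.le
  obtain ⟨l, hl2⟩ := exists_eq_lt_of_down_closed (I := w ⁻¹' I) fun i hi hm => by
    rcases hne w i hi with h1 | h1
    · exact (hr i hi h1).1
    · exact h _ _ hm h1.le (by simp)
  have hw1 : w⁻¹ = 1 := by
    refine eq_one_of_forall_lt fun i hi => ?_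
    rcases hne w⁻¹ i hi with h1 | h1
    · exfalso
      obtain ⟨h2, h3⟩ := hl i hi h1
      have h4 : w⁻¹ ⟨i, by omega⟩ ∈ w ⁻¹' I := by simpa using h2
      have h5 : w⁻¹ ⟨i + 1, hi⟩ ∈ w ⁻¹' I := by
        rw [hl2] at h4 ⊢
        exact lt_trans (Fin.lt_def.mp h1) h4
      exact h3 (by simpa using h5)
    · exact h1
  rw [inv_eq_one.mp hw1, hk, subFam_one]
  exact levelFam_mem hT hL k.val k.isLt

end Generation

/-! ### Orbit functions as combinations of functions of subspaces -/

section Orbits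

variable {n : ℕ} {F : Type} [Field F]

/-- A vector of an adapted basis is a combination of the vectors of any other adapted basis which
precede it in the order of `IsLowerFor`. -/
theorem span_le_of_adapted {w : Equiv.Perm (Fin n)} {I : Set (Fin n)} (hI : IsLowerFor w I)
    {X Y : CompleteFlag n F} {b b' : Module.Basis (Fin n) F (Fin n → F)} (hX : Adapted b X)
    (hY : Adapted (b ∘ w) Y) (hX' : Adapted b' X) (hY' : Adapted (b' ∘ w) Y) :
    Submodule.span F (b' '' I) ≤ Submodule.span F (b '' I) := by
  rw [Submodule.span_le]
  rintro _ ⟨k, hk, rfl⟩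
  rw [SetLike.mem_coe, mem_span_image_iff]
  intro l hl
  by_contra hne
  have h1 : l ≤ k := by
    by_contra hcon
    exact hne (hX.mem_iff.mp (hX' k).1 l (by simpa using Fin.lt_def.mp (not_le.mp hcon)))
  have h2 : w⁻¹ l ≤ w⁻¹ k := by
    by_contra hcon
    have h3 := (hY' (w⁻¹ k)).1
    rw [Function.comp_apply, apply_perm_inv] at h3
    have := hY.mem_iff_comp.mp h3 (w⁻¹ l) (by simpa using Fin.lt_def.mp (not_le.mp hcon))
    rw [apply_perm_inv] at this
    exact hne this
  exact hl (hI l k hk h1 h2)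

/-- For a set that is closed downwards, any basis adapted to both flags can be used to test
`InSub`. -/
theorem inSub_iff_of_adapted {w : Equiv.Perm (Fin n)} {I : Set (Fin n)} (hI : IsLowerFor w I)
    {X Y : CompleteFlag n F} {b : Module.Basis (Fin n) F (Fin n → F)} (hX : Adapted b X)
    (hY : Adapted (b ∘ w) Y) {v : Fin n → F} :
    InSub w I X Y v ↔ v ∈ Submodule.span F (b '' I) := by
  constructor
  · rintro ⟨b', hX', hY', hv⟩
    exact span_le_of_adapted hI hX hY hX' hY' hv
  · intro hv
    exact ⟨b, hX, hY, hv⟩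

/-- `k` is a maximal element of `I` for the order of `IsLowerFor`. -/
def IsMaxFor (w : Equiv.Perm (Fin n)) (I : Set (Fin n)) (k : Fin n) : Prop :=
  k ∈ I ∧ ∀ l ∈ I, k ≤ l → w⁻¹ k ≤ w⁻¹ l → l = k

theorem IsLowerFor.diff {w : Equiv.Perm (Fin n)} {I : Set (Fin n)} (hI : IsLowerFor w I)
    {m : Fin n} (hm : IsMaxFor w I m) : IsLowerFor w (I \ {m}) := by
  rintro k l ⟨hl, hlm⟩ hkl hw
  refine ⟨hI k l hl hkl hw, ?_⟩
  rintro rfl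
  exact hlm (hm.2 l hl hkl hw)

theorem IsMaxFor.diff {w : Equiv.Perm (Fin n)} {I : Set (Fin n)} {a m : Fin n}
    (hm : IsMaxFor w I m) (hne : m ≠ a) : IsMaxFor w (I \ {a}) m :=
  ⟨⟨hm.1, hne⟩, fun l hl => hm.2 l hl.1⟩

/-- The vector lies in the span of the basis vectors with index in `I`, and its coordinates at `M`
do not vanish. The second condition is expressed without a basis, which is adequate when the
elements of `M` are maximal in `I`. -/
def StrictSub (w : Equiv.Perm (Fin n)) (I : Set (Fin n)) (M : Finset (Fin n))
    (X Y : CompleteFlag n F) (v : Fin n → F) : Prop :=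
  InSub w I X Y v ∧ ∀ m ∈ M, ¬ InSub w (I \ {m}) X Y v

theorem strictSub_diff_iff {w : Equiv.Perm (Fin n)} {I : Set (Fin n)} (hI : IsLowerFor w I)
    {M : Finset (Fin n)} (hM : ∀ m ∈ M, IsMaxFor w I m) (a : Fin n)
    (X Y : CompleteFlag n F) (v : Fin n → F) :
    StrictSub w (I \ {a}) M X Y v ↔ StrictSub w I M X Y v ∧ InSub w (I \ {a}) X Y v := by
  have mono : ∀ {J K : Set (Fin n)}, J ⊆ K → InSub w J X Y v → InSub w K X Y v := by
    rintro J K hJK ⟨b, hX, hY, hv⟩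
    exact ⟨b, hX, hY, Submodule.span_mono (Set.image_mono hJK) hv⟩
  constructor
  · rintro ⟨h1, h2⟩
    refine ⟨⟨mono Set.sdiff_subset h1, fun m hm h3 => h2 m hm ?_⟩, h1⟩
    obtain ⟨b, hX, hY, hv⟩ := h1
    rw [inSub_iff_of_adapted (hI.diff (hM m hm)) hX hY, mem_span_image_iff] at h3
    refine ⟨b, hX, hY, ?_⟩
    rw [mem_span_image_iff] at hv ⊢
    intro k hk
    by_cases hka : k ∈ I \ {a}
    · exact h3 k fun h => hk ⟨hka, h.2⟩
    · exact hv k hka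
  · rintro ⟨⟨-, h2⟩, h3⟩
    exact ⟨h3, fun m hm h4 => h2 m hm (mono (Set.sdiff_subset_sdiff_left Set.sdiff_subset) h4)⟩

open Classical in
/-- The families of characteristic functions of `StrictSub w I M`. -/
def strictFam (w : Equiv.Perm (Fin n)) (I : Set (Fin n)) (M : Finset (Fin n)) :
    ∀ r : PrimePower, ConvAlg n r :=
  fun r => (fun X Y v => if StrictSub w I M X Y v then 1 else 0 : FlagFun n r.field)

theorem strictFam_empty (w : Equiv.Perm (Fin n)) (I : Set (Fin n)) :
    strictFam w I ∅ = subFam w I := by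
  classical
  funext r
  refine FlagFun.ext fun X Y v => ?_
  change (if StrictSub w I ∅ X Y v then (1 : ℂ) else 0) = subFun r.field w I X Y v
  rw [subFun_apply]
  exact if_congr (by simp [StrictSub]) rfl rfl

/-- One step of inclusion and exclusion over the maximal elements. -/
theorem strictFam_insert {w : Equiv.Perm (Fin n)} {I : Set (Fin n)} (hI : IsLowerFor w I)
    {M : Finset (Fin n)} (hM : ∀ m ∈ M, IsMaxFor w I m) (a : Fin n) :
    strictFam w I (insert a M) = strictFam w I M - strictFam w (I \ {a}) M := by
  classical
  rw [eq_sub_iff_add_eq]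
  funext r
  refine FlagFun.ext fun X Y v => ?_
  change (if StrictSub w I (insert a M) X Y v then (1 : ℂ) else 0) +
    (if StrictSub w (I \ {a}) M X Y v then (1 : ℂ) else 0) =
      if StrictSub w I M X Y v then (1 : ℂ) else 0
  have h1 : StrictSub w I (insert a M) X Y v ↔
      StrictSub w I M X Y v ∧ ¬ InSub w (I \ {a}) X Y v := by
    simp only [StrictSub, Finset.mem_insert, forall_eq_or_imp]
    tauto
  rw [if_congr h1 rfl rfl, if_congr (strictSub_diff_iff hI hM a X Y v) rfl rfl]
  by_cases h2 : StrictSub w I M X Y v <;> by_cases h3 : InSub w (I \ {a}) X Y v <;> simp [h2, h3]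

/-- The lower closure of the index set of an orbit. -/
def lowerClosureFor (w : Equiv.Perm (Fin n)) (β : Finset (Fin n)) : Set (Fin n) :=
  {k | ∃ l ∈ β, k ≤ l ∧ w⁻¹ k ≤ w⁻¹ l}

theorem isLowerFor_lowerClosureFor (w : Equiv.Perm (Fin n)) (β : Finset (Fin n)) :
    IsLowerFor w (lowerClosureFor w β) := by
  rintro k l ⟨m, hm, h1, h2⟩ hkl hw
  exact ⟨m, hm, hkl.trans h1, hw.trans h2⟩

open Classical in
/-- The maximal elements of the lower closure of the index set of an orbit. -/
def maxFor (w : Equiv.Perm (Fin n)) (β : Finset (Fin n)) : Finset (Fin n) :=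
  {k | IsMaxFor w (lowerClosureFor w β) k}

theorem mem_maxFor {w : Equiv.Perm (Fin n)} {β : Finset (Fin n)} {k : Fin n} :
    k ∈ maxFor w β ↔ IsMaxFor w (lowerClosureFor w β) k := by
  classical
  simp [maxFor]

theorem mem_of_mem_maxFor {w : Equiv.Perm (Fin n)} {β : Finset (Fin n)} {k : Fin n}
    (hk : k ∈ maxFor w β) : k ∈ β := by
  rw [mem_maxFor] at hk
  obtain ⟨⟨l, hl, h1, h2⟩, hmax⟩ := hk
  rw [← hmax l ⟨l, hl, le_rfl, le_rfl⟩ h1 h2]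
  exact hl

theorem exists_maxFor_ge {w : Equiv.Perm (Fin n)} {β : Finset (Fin n)} {k : Fin n}
    (hk : k ∈ lowerClosureFor w β) : ∃ m ∈ maxFor w β, k ≤ m ∧ w⁻¹ k ≤ w⁻¹ m := by
  obtain ⟨N, hN⟩ : ∃ N, N + k.val = n := ⟨n - k.val, by omega⟩
  induction N using Nat.strong_induction_on generalizing k with
  | _ N ih =>
  by_cases hm : k ∈ maxFor w β
  · exact ⟨k, hm, le_rfl, le_rfl⟩
  · rw [mem_maxFor, IsMaxFor] at hm
    push Not at hm
    obtain ⟨l, hl, h1, h2, h3⟩ := hm hk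
    have hlt : k.val < l.val := lt_of_le_of_ne h1 fun e => h3 (Fin.ext e.symm)
    obtain ⟨m, hm, h4, h5⟩ := ih (n - l.val) (by omega) hl (by omega)
    exact ⟨m, hm, h1.trans h4, h2.trans h5⟩

/-- The coordinates at the maximal indices being nonzero, the corresponding basis vectors
can be changed so as to absorb all other coordinates. -/
theorem inOrbit_iff_strictSub (w : Equiv.Perm (Fin n)) (β : Finset (Fin n))
    (X Y : CompleteFlag n F) (v : Fin n → F) :
    InOrbit w β X Y v ↔ StrictSub w (lowerClosureFor w β) (maxFor w β) X Y v := by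
  classical
  set I := lowerClosureFor w β with hIdef
  have hI : IsLowerFor w I := isLowerFor_lowerClosureFor w β
  have hβI : ∀ k ∈ β, k ∈ I := fun k hk => ⟨k, hk, le_rfl, le_rfl⟩
  rw [inOrbit_iff]
  constructor
  · rintro ⟨b, hX, hY, hv⟩
    have hr : ∀ k, b.repr v k = if k ∈ β then 1 else 0 := by
      intro k
      rw [hv, map_sum, Finset.sum_apply']
      simp [Finsupp.single_apply]
    refine ⟨⟨b, hX, hY, ?_⟩, fun m hm => ?_⟩
    · rw [mem_span_image_iff]
      intro k hk
      rw [hr, if_neg fun h => hk (hβI k h)]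
    · rw [inSub_iff_of_adapted (hI.diff (mem_maxFor.mp hm)) hX hY, mem_span_image_iff]
      intro h
      have := h m (by simp)
      rw [hr, if_pos (mem_of_mem_maxFor hm)] at this
      exact one_ne_zero this
  · rintro ⟨⟨b, hX, hY, hv⟩, hM⟩
    rw [mem_span_image_iff] at hv
    have hne : ∀ m ∈ maxFor w β, b.repr v m ≠ 0 := by
      intro m hm h0
      refine hM m hm ⟨b, hX, hY, ?_⟩
      rw [mem_span_image_iff]
      intro k hk
      by_cases hkI : k ∈ I
      · have : k = m := by
          by_contra hkm
          exact hk ⟨hkI, hkm⟩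
        rw [this, h0]
      · exact hv k hkI
    have hch : ∀ k, ∃ m, k ∈ I → m ∈ maxFor w β ∧ k ≤ m ∧ w⁻¹ k ≤ w⁻¹ m := by
      intro k
      by_cases hk : k ∈ I
      · obtain ⟨m, hm⟩ := exists_maxFor_ge hk
        exact ⟨m, fun _ => hm⟩
      · exact ⟨k, fun h => absurd h hk⟩
    choose f hf using hch
    set M := maxFor w β with hMdef
    -- the coordinate at `k`, not maximal, is absorbed by the vector with index `f k`
    set J : Finset (Fin n) := {k | k ∈ I ∧ k ∉ M} with hJ
    set g : Fin n → F := fun k => b.repr v k - if k ∈ β then 1 else 0 with hg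
    set d : Fin n → Fin n → F := fun m =>
      if m ∈ M then b.repr v m • b m + ∑ k ∈ J with f k = m, g k • b k else b m with hd
    have hlow : ∀ m ∈ M, ∀ k ∈ J.filter (fun k => f k = m), k < m ∧ w⁻¹ k < w⁻¹ m := by
      intro m hm k hk
      rw [Finset.mem_filter, hJ, Finset.mem_filter] at hk
      obtain ⟨⟨-, hkI, hkM⟩, hfk⟩ := hk
      obtain ⟨-, h1, h2⟩ := hf k hkI
      rw [hfk] at h1 h2
      have hkm : k ≠ m := fun e => hkM (e ▸ hm)
      exact ⟨lt_of_le_of_ne h1 hkm, lt_of_le_of_ne h2 fun e => hkm (by simpa using e)⟩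
    have hdX : Adapted d X := by
      intro m
      by_cases hm : m ∈ M
      · have hs : ∑ k ∈ J with f k = m, g k • b k ∈ X.space m.castSucc :=
          Submodule.sum_mem _ fun k hk => Submodule.smul_mem _ _
            (X.space_mono (by simpa using (hlow m hm k hk).1) (hX k).1)
        simp only [hd, if_pos hm]
        refine ⟨add_mem (Submodule.smul_mem _ _ (hX m).1) (X.space_mono (by simp) hs), fun h => ?_⟩
        rw [Submodule.add_mem_iff_left _ hs, Submodule.smul_mem_iff _ (hne m hm)] at h
        exact (hX m).2 h
      · simp only [hd, if_neg hm]
        exact hX m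
    have hdY : Adapted (d ∘ w) Y := by
      intro j
      have hYj := hY j
      rw [Function.comp_apply] at hYj ⊢
      by_cases hm : w j ∈ M
      · have hs : ∑ k ∈ J with f k = w j, g k • b k ∈ Y.space j.castSucc := by
          refine Submodule.sum_mem _ fun k hk => Submodule.smul_mem _ _ ?_
          have h1 := (hlow (w j) hm k hk).2
          have h2 := (hY (w⁻¹ k)).1
          rw [Function.comp_apply, apply_perm_inv] at h2
          refine Y.space_mono ?_ h2
          simpa using h1
        simp only [hd, if_pos hm]
        refine ⟨add_mem (Submodule.smul_mem _ _ hYj.1) (Y.space_mono (by simp) hs), fun h => ?_⟩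
        rw [Submodule.add_mem_iff_left _ hs, Submodule.smul_mem_iff _ (hne _ hm)] at h
        exact hYj.2 h
      · simp only [hd, if_neg hm]
        exact hYj
    obtain ⟨B, hB⟩ := hdX.exists_basis
    refine ⟨B, hB ▸ hdX, hB ▸ hdY, ?_⟩
    rw [hB]
    have hMβ : M ⊆ β := fun m hm => mem_of_mem_maxFor hm
    have hMI : ∀ m ∈ M, m ∈ I := fun m hm => hβI m (hMβ hm)
    have hsumd : ∑ i ∈ β, d i = ∑ m ∈ M, b.repr v m • b m + ∑ k ∈ J, g k • b k +
        ∑ k ∈ β \ M, b k := by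
      rw [← Finset.sum_sdiff hMβ, add_comm]
      congr 1
      · rw [Finset.sum_congr rfl fun m hm => show d m = _ from if_pos hm,
          Finset.sum_add_distrib]
        congr 1
        refine Finset.sum_fiberwise_of_maps_to (fun k hk => ?_) _
        rw [hJ, Finset.mem_filter] at hk
        exact (hf k hk.2.1).1
      · exact Finset.sum_congr rfl fun k hk => if_neg (Finset.mem_sdiff.mp hk).2
    have hβJ : ∑ k ∈ β \ M, b k = ∑ k ∈ J, (if k ∈ β then (1 : F) else 0) • b k := by
      simp only [ite_smul, one_smul, zero_smul]
      rw [← Finset.sum_filter]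
      refine Finset.sum_congr ?_ fun _ _ => rfl
      ext k
      simp only [Finset.mem_sdiff, Finset.mem_filter, hJ, Finset.mem_univ, true_and]
      exact ⟨fun h => ⟨⟨hβI k h.1, h.2⟩, h.1⟩, fun h => ⟨h.2, h.1.2⟩⟩
    rw [hsumd, hβJ, add_assoc, ← Finset.sum_add_distrib]
    have hJs : ∀ k ∈ J, g k • b k + (if k ∈ β then (1 : F) else 0) • b k = b.repr v k • b k := by
      intro k _
      rw [← add_smul, hg]
      simp
    rw [Finset.sum_congr rfl hJs]
    have hdisj : Disjoint M J := by
      rw [Finset.disjoint_left]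
      intro k hk hkJ
      rw [hJ, Finset.mem_filter] at hkJ
      exact hkJ.2.2 hk
    rw [← Finset.sum_union hdisj]
    nth_rw 1 [← b.sum_repr v]
    symm
    refine Finset.sum_subset (Finset.subset_univ _) fun k _ hk => ?_
    rw [hv k, zero_smul]
    intro hkI
    refine hk ?_
    by_cases hkM : k ∈ M
    · exact Finset.mem_union_left _ hkM
    · exact Finset.mem_union_right _ (by simp [hJ, hkI, hkM])

theorem orbitFamily_eq (w : Equiv.Perm (Fin n)) (β : Finset (Fin n)) :
    orbitFamily w β = strictFam w (lowerClosureFor w β) (maxFor w β) := by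
  classical
  funext r
  refine FlagFun.ext fun X Y v => ?_
  change orbitFun r.field w β X Y v =
    if StrictSub w (lowerClosureFor w β) (maxFor w β) X Y v then (1 : ℂ) else 0
  rw [orbitFun_apply]
  exact if_congr (inOrbit_iff_strictSub w β X Y v) rfl rfl

section

variable {S : Subalgebra ℂ[T;T⁻¹] (∀ r : PrimePower, ConvAlg n r)}

theorem strictFam_mem (hT : ∀ i (hi : i + 1 < n), heckeFam hi ∈ S)
    (hL : ∀ hn : 0 < n, levelFam (⟨1, by omega⟩ : Fin (n + 1)) ∈ S)
    (w : Equiv.Perm (Fin n)) (M : Finset (Fin n)) : ∀ I : Set (Fin n), IsLowerFor w I →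
      (∀ m ∈ M, IsMaxFor w I m) → strictFam w I M ∈ S := by
  classical
  induction M using Finset.induction_on with
  | empty =>
    intro I hI _
    rw [strictFam_empty]
    exact subFam_mem hT hL _ w I rfl hI
  | insert a M haM ih =>
    intro I hI hM
    have ha := hM a (Finset.mem_insert_self _ _)
    have hM' : ∀ m ∈ M, IsMaxFor w I m := fun m hm => hM m (Finset.mem_insert_of_mem hm)
    rw [strictFam_insert hI hM' a]
    refine S.sub_mem (ih I hI hM') (ih _ (hI.diff ha) fun m hm => (hM' m hm).diff ?_)
    rintro rfl
    exact haM hm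

/-- A subalgebra containing the Hecke generators and the function of the first level
contains all orbit functions. -/
theorem integralAlgebra_le (hT : ∀ i (hi : i + 1 < n), heckeFam hi ∈ S)
    (hL : ∀ hn : 0 < n, levelFam (⟨1, by omega⟩ : Fin (n + 1)) ∈ S) :
    integralAlgebra n ≤ S := by
  refine Algebra.adjoin_le ?_
  rintro _ ⟨w, β, rfl⟩
  rw [orbitFamily_eq]
  exact strictFam_mem hT hL w _ _ (isLowerFor_lowerClosureFor w β) fun m hm => mem_maxFor.mp hm

end

end Orbits

/-! ### The mirabolic system of the flag algebra -/

section System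

open LaurentPolynomial (T)

variable {n : ℕ}

theorem adjSwap_succ {i : ℕ} (hi : i + 1 < n) : adjSwap n (i + 1) = sw n hi := by
  rw [adjSwap, dif_pos ⟨by omega, hi⟩]
  rfl

theorem heckeGen_val {i : ℕ} (hi : i + 1 < n) : (heckeGen n (i + 1)).val = heckeFam hi := by
  change orbitFamily _ ∅ = _
  rw [adjSwap_succ hi]
  rfl

theorem idem_val (hn : 0 < n) :
    (idem n).val = (T (-1) : ℂ[T;T⁻¹]) • levelFam (⟨1, by omega⟩ : Fin (n + 1)) := by
  rw [← heckeZero_add_one hn]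
  rfl

theorem smul_T_cancel' {M : Type*} [AddCommGroup M] [Module ℂ[T;T⁻¹] M] (x : M) :
    (T (-1) : ℂ[T;T⁻¹]) • (T 1 : ℂ[T;T⁻¹]) • x = x := smul_T_cancel 1 x

theorem heckeGen_quad {i : ℕ} (hi : i + 1 < n) :
    heckeGen n (i + 1) * heckeGen n (i + 1) =
      (T 1 - 1 : ℂ[T;T⁻¹]) • heckeGen n (i + 1) + (T 1 : ℂ[T;T⁻¹]) • 1 := by
  apply Subtype.ext
  change (heckeGen n (i + 1)).val * (heckeGen n (i + 1)).val =
      (T 1 - 1 : ℂ[T;T⁻¹]) • (heckeGen n (i + 1)).val + (T 1 : ℂ[T;T⁻¹]) • 1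
  rw [heckeGen_val hi, heckeFam_quad]

theorem heckeGen_braid {i : ℕ} (hi : i + 2 < n) :
    heckeGen n (i + 1) * heckeGen n (i + 2) * heckeGen n (i + 1) =
      heckeGen n (i + 2) * heckeGen n (i + 1) * heckeGen n (i + 2) := by
  apply Subtype.ext
  change (heckeGen n (i + 1)).val * (heckeGen n (i + 1 + 1)).val * (heckeGen n (i + 1)).val =
    (heckeGen n (i + 1 + 1)).val * (heckeGen n (i + 1)).val * (heckeGen n (i + 1 + 1)).val
  rw [heckeGen_val (by omega : i + 1 < n), heckeGen_val (by omega : i + 1 + 1 < n),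
    mul_assoc, mul_assoc, heckeFam_braid hi]

theorem heckeGen_comm {i j : ℕ} (hij : i + 1 < j) (hj : j + 1 < n) :
    heckeGen n (i + 1) * heckeGen n (j + 1) = heckeGen n (j + 1) * heckeGen n (i + 1) := by
  apply Subtype.ext
  change (heckeGen n (i + 1)).val * (heckeGen n (j + 1)).val =
    (heckeGen n (j + 1)).val * (heckeGen n (i + 1)).val
  rw [heckeGen_val (by omega : i + 1 < n), heckeGen_val hj, heckeFam_comm hij hj]

theorem idem_mul_idem (hn : 0 < n) : idem n * idem n = idem n := by
  apply Subtype.ext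
  change (idem n).val * (idem n).val = (idem n).val
  rw [idem_val hn, smul_mul_smul_comm, levelFam_mul_levelFam _ _ le_rfl, mul_smul]
  congr 1
  exact smul_T_cancel' _

theorem idem_mul_heckeGen {i : ℕ} (h0 : 0 < i) (hi : i + 1 < n) :
    idem n * heckeGen n (i + 1) = heckeGen n (i + 1) * idem n := by
  apply Subtype.ext
  change (idem n).val * (heckeGen n (i + 1)).val = (heckeGen n (i + 1)).val * (idem n).val
  rw [idem_val (by omega), heckeGen_val hi, smul_mul_assoc, mul_smul_comm,
    levelFam_mul_heckeFam _ hi (by simp; omega)]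

theorem levelFam_one_mul_mul (hn : 0 + 1 < n) :
    levelFam ⟨1, by omega⟩ * (heckeFam hn * levelFam ⟨1, by omega⟩) =
      heckeFam hn * levelFam ⟨2, by omega⟩ := by
  have := levelFam_mul_heckeFam_mul_levelFam hn
  rw [Nat.cast_zero, LaurentPolynomial.T_zero, one_smul] at this
  exact this

theorem idem_typeB (hn : 1 < n) :
    idem n * heckeGen n 1 * idem n * heckeGen n 1 =
      heckeGen n 1 * idem n * heckeGen n 1 * idem n := by
  apply Subtype.ext
  change (idem n).val * (heckeGen n (0 + 1)).val * (idem n).val * (heckeGen n (0 + 1)).val =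
    (heckeGen n (0 + 1)).val * (idem n).val * (heckeGen n (0 + 1)).val * (idem n).val
  have h := levelFam_one_mul_mul hn
  have h2 := levelFam_mul_heckeFam (n := n) ⟨2, by omega⟩ hn (by simp)
  rw [idem_val (by omega), heckeGen_val hn]
  simp only [smul_mul_assoc, mul_smul_comm, mul_assoc]
  congr 2
  calc _ = levelFam ⟨1, by omega⟩ * (heckeFam hn * levelFam ⟨1, by omega⟩) * heckeFam hn := by
        simp only [mul_assoc]
    _ = heckeFam hn * (levelFam ⟨1, by omega⟩ * (heckeFam hn * levelFam ⟨1, by omega⟩)) := by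
        rw [h, mul_assoc, h2]

theorem heckeFam_one_add_mul {i : ℕ} (hi : i + 1 < n) (x : ∀ r : PrimePower, ConvAlg n r) :
    (1 + heckeFam hi) * (heckeFam hi * x) = (T 1 : ℂ[T;T⁻¹]) • ((1 + heckeFam hi) * x) := by
  rw [← mul_assoc, add_mul, heckeFam_quad, ← smul_mul_assoc]
  congr 1
  rw [one_mul]
  module

theorem idem_rook (hn : 1 < n) :
    (heckeGen n 1 + 1) * (idem n * heckeGen n 1 - 1) * (1 - idem n) = 0 := by
  apply Subtype.ext
  change ((heckeGen n (0 + 1)).val + 1) * ((idem n).val * (heckeGen n (0 + 1)).val - 1) *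
    (1 - (idem n).val) = 0
  rw [idem_val (by omega), heckeGen_val hn]
  have h1 := one_add_heckeFam_mul_levelFam_mul hn
  have h2 := levelFam_one_mul_mul hn
  set t := heckeFam hn
  set d := levelFam (⟨1, by omega⟩ : Fin (n + 1))
  set d2 := levelFam (⟨2, by omega⟩ : Fin (n + 1))
  have h3 : (1 + t) * (t * d2) = (T 1 : ℂ[T;T⁻¹]) • ((1 + t) * d2) := heckeFam_one_add_mul hn d2
  set c : ℂ[T;T⁻¹] := T (-1) with hc
  have e : (t + 1) * (c • d * t - 1) * (1 - c • d) =
      c • ((1 + t) * (d * (1 + t))) - (1 + t) - c • c • ((1 + t) * (d * (t * d))) := by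
    simp only [smul_mul_assoc, mul_smul_comm, sub_mul, mul_sub, mul_add, add_mul, smul_sub,
      smul_add, one_mul, mul_one, mul_assoc]
    abel
  rw [e, h1, h2, h3, smul_add, hc, smul_T_cancel', smul_T_cancel']
  abel

theorem jucysMurphy_one : jucysMurphy n 1 = idem n := by
  simp [jucysMurphy]

theorem jucysMurphy_succ (i : ℕ) : jucysMurphy n (i + 2) =
    (T (-1) : ℂ[T;T⁻¹]) • (heckeGen n (i + 1) * jucysMurphy n (i + 1) * heckeGen n (i + 1)) := by
  unfold jucysMurphy
  rw [show i + 2 - 1 = i + 1 by omega, show i + 1 - 1 = i by omega, List.range'_1_concat,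
    add_comm 1 i]
  simp only [List.map_append, List.map_cons, List.map_nil, List.prod_append, List.prod_cons,
    List.prod_nil, List.reverse_append, List.reverse_cons, List.reverse_nil, List.nil_append,
    List.cons_append, mul_one]
  rw [mul_smul_comm, smul_mul_assoc, smul_smul, ← LaurentPolynomial.T_add]
  simp only [mul_assoc]
  congr 2
  push_cast
  ring

theorem adjoin_integral : Algebra.adjoin ℂ[T;T⁻¹]
    ({x | x = idem n ∧ 0 < n} ∪ {x | ∃ i, i + 1 < n ∧ x = heckeGen n (i + 1)}) = ⊤ := by
  set S := Algebra.adjoin ℂ[T;T⁻¹]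
    ({x | x = idem n ∧ 0 < n} ∪ {x | ∃ i, i + 1 < n ∧ x = heckeGen n (i + 1)})
  rw [eq_top_iff]
  intro x _
  have hle : integralAlgebra n ≤ S.map (integralAlgebra n).val := by
    refine integralAlgebra_le (fun i hi => ?_) fun hn => ?_
    · exact ⟨_, Algebra.subset_adjoin (Or.inr ⟨i, hi, rfl⟩), heckeGen_val hi⟩
    · refine ⟨(T 1 : ℂ[T;T⁻¹]) • idem n,
        S.smul_mem (Algebra.subset_adjoin (Or.inl ⟨rfl, hn⟩)) _, ?_⟩
      change (T 1 : ℂ[T;T⁻¹]) • (idem n).val = _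
      rw [idem_val hn, smul_smul, ← LaurentPolynomial.T_add, add_neg_cancel,
        LaurentPolynomial.T_zero, one_smul]
  obtain ⟨y, hy, hyx⟩ := hle x.2
  rw [← (Subtype.ext hyx : y = x)]
  exact hy

variable (K : Type) [Field K] [Algebra ℂ[T;T⁻¹] K]

/-- The image of an element in the algebra with extended scalars. -/
def incl (n : ℕ) : R n →ₐ[ℂ[T;T⁻¹]] BaseChange K n := Algebra.TensorProduct.includeRight

theorem incl_apply (x : R n) : incl K n x = 1 ⊗ₜ[ℂ[T;T⁻¹]] x := rfl

theorem incl_smul (c : ℂ[T;T⁻¹]) (x : R n) :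
    incl K n (c • x) = algebraMap ℂ[T;T⁻¹] K c • incl K n x := by
  rw [map_smul, algebraMap_smul]

theorem adjoin_baseChange : Algebra.adjoin K
    ({x | x = incl K n (idem n) ∧ 0 < n} ∪
      {x | ∃ i, i + 1 < n ∧ x = incl K n (heckeGen n (i + 1))}) = ⊤ := by
  set A := Algebra.adjoin K
    ({x | x = incl K n (idem n) ∧ 0 < n} ∪
      {x | ∃ i, i + 1 < n ∧ x = incl K n (heckeGen n (i + 1))})
  have h1 : ∀ x : R n, incl K n x ∈ A := by
    intro x
    have hle : Algebra.adjoin ℂ[T;T⁻¹]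
        ({x | x = idem n ∧ 0 < n} ∪ {x | ∃ i, i + 1 < n ∧ x = heckeGen n (i + 1)}) ≤
        (A.restrictScalars ℂ[T;T⁻¹]).comap (incl K n) := by
      refine Algebra.adjoin_le ?_
      rintro y (⟨rfl, hn⟩ | ⟨i, hi, rfl⟩)
      · exact Algebra.subset_adjoin (Or.inl ⟨rfl, hn⟩)
      · exact Algebra.subset_adjoin (Or.inr ⟨i, hi, rfl⟩)
    rw [adjoin_integral] at hle
    exact hle (Algebra.mem_top : x ∈ ⊤)
  rw [eq_top_iff]
  intro x _
  induction x using TensorProduct.induction_on with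
  | zero => exact A.zero_mem
  | tmul k x =>
    have : (k ⊗ₜ[ℂ[T;T⁻¹]] x : BaseChange K n) = k • incl K n x := by
      rw [incl_apply, TensorProduct.smul_tmul', smul_eq_mul, mul_one]
    rw [this]
    exact A.smul_mem (h1 x) k
  | add x y hx hy => exact A.add_mem (hx Algebra.mem_top) (hy Algebra.mem_top)

/-- The generators of the mirabolic Hecke algebra over `K`. -/
def mirabolicSystem (hn : 0 < n) : MirabolicSystem K (BaseChange K n) n where
  q := algebraMap ℂ[T;T⁻¹] K (T 1)
  T i := incl K n (heckeGen n (i + 1))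
  e := incl K n (idem n)
  q_ne_zero := ((LaurentPolynomial.isUnit_T 1).map (algebraMap ℂ[T;T⁻¹] K)).ne_zero
  quad i hi := by
    rw [← map_mul, heckeGen_quad hi, map_add, incl_smul, incl_smul, map_sub, map_one, map_one]
  braid i hi := by simp only [← map_mul, ← heckeGen_braid hi]
  comm i j hij hj := by simp only [← map_mul, heckeGen_comm hij hj]
  idem := by rw [← map_mul, idem_mul_idem hn]
  comm_e i h0 hi := by simp only [← map_mul, idem_mul_heckeGen h0 hi]
  typeB h := by simp only [← map_mul, zero_add, idem_typeB h]
  rook h := by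
    have := congrArg (incl K n) (idem_rook h)
    simpa only [map_mul, map_add, map_sub, map_one, map_zero, zero_add] using this
  gen := adjoin_baseChange K

theorem mirabolicSystem_q (hn : 0 < n) :
    (mirabolicSystem K hn).q = algebraMap ℂ[T;T⁻¹] K (T 1) := rfl

theorem mirabolicSystem_L (hn : 0 < n) (i : ℕ) :
    (mirabolicSystem K hn).L i = incl K n (jucysMurphy n (i + 1)) := by
  induction i with
  | zero => rw [MirabolicSystem.L_zero, jucysMurphy_one]; rfl
  | succ i ih =>
    rw [MirabolicSystem.L_succ, ih, jucysMurphy_succ, incl_smul, map_mul, map_mul]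
    congr 1
    rw [mirabolicSystem_q]
    refine (eq_inv_of_mul_eq_one_left ?_).symm
    rw [← map_mul, ← LaurentPolynomial.T_add]
    simp

/-- The center is as asserted whenever the parameter is not a root of unity of order at most `n`. -/
theorem centerIsSymmetricInJM_of_two_le (hn : 2 ≤ n)
    (hq : ∀ i : ℕ, 1 ≤ i → i ≤ n → algebraMap ℂ[T;T⁻¹] K (T 1) ^ i ≠ 1) :
    CenterIsSymmetricInJM K n := by
  have hjm : jm K n = fun j : Fin n => (mirabolicSystem K (by omega : 0 < n)).L j := by
    funext j
    rw [mirabolicSystem_L]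
    rfl
  rw [CenterIsSymmetricInJM, hjm]
  exact ⟨fun i j => MirabolicSystem.commute_L_L _ i.2 j.2,
    MirabolicSystem.center_eq (D := mirabolicSystem K (by omega : 0 < n)) hn hq⟩

end System

/-! ### At most one dimension, and the generic algebra -/

section Small

open LaurentPolynomial (T)

variable {n : ℕ}

theorem isSymmetric_of_le_one {K : Type} [Field K] (hn : n ≤ 1) (p : MvPolynomial (Fin n) K) :
    p.IsSymmetric := by
  have : Subsingleton (Fin n) := Fin.subsingleton_iff_le_one.mpr hn
  intro σ
  rw [Subsingleton.elim σ (Equiv.refl _)]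
  exact MvPolynomial.rename_id_apply p

section

variable {K A : Type} [Field K] [Ring A] [Algebra K A] (x : Fin n → A)

theorem evalTuple_eq_sum (p : MvPolynomial (Fin n) K) {s : Finset (Fin n →₀ ℕ)}
    (hs : p.support ⊆ s) :
    evalTuple x p = ∑ m ∈ s, p.coeff m • (List.ofFn fun i => x i ^ m i).prod := by
  refine Finset.sum_subset hs fun m _ hm => ?_
  rw [MvPolynomial.notMem_support_iff.mp hm, zero_smul]

theorem evalTuple_add (p r : MvPolynomial (Fin n) K) :
    evalTuple x (p + r) = evalTuple x p + evalTuple x r := by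
  classical
  rw [evalTuple_eq_sum x (p + r) (MvPolynomial.support_add (p := p) (q := r)),
    evalTuple_eq_sum x p Finset.subset_union_left, evalTuple_eq_sum x r Finset.subset_union_right,
    ← Finset.sum_add_distrib]
  exact Finset.sum_congr rfl fun m _ => by rw [MvPolynomial.coeff_add, add_smul]

theorem evalTuple_monomial (m : Fin n →₀ ℕ) (c : K) :
    evalTuple x (MvPolynomial.monomial m c) = c • (List.ofFn fun i => x i ^ m i).prod := by
  classical
  rw [evalTuple_eq_sum x _ MvPolynomial.support_monomial_subset, Finset.sum_singleton,
    MvPolynomial.coeff_monomial, if_pos rfl]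

end

variable (K : Type) [Field K] [Algebra ℂ[T;T⁻¹] K]

/-- For `n ≤ 1` the algebra is spanned by `1` and, for `n = 1`, the idempotent. -/
theorem exists_eq_smul_add (hn : n ≤ 1) (z : BaseChange K n) :
    ∃ a b : K, (n = 0 → b = 0) ∧ z = a • 1 + b • incl K n (idem n) := by
  have hz : z ∈ Algebra.adjoin K ({x | x = incl K n (idem n) ∧ 0 < n} ∪
      {x | ∃ i, i + 1 < n ∧ x = incl K n (heckeGen n (i + 1))}) := by
    rw [adjoin_baseChange]
    exact Algebra.mem_top
  induction hz using Algebra.adjoin_induction with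
  | mem x hx =>
    rcases hx with ⟨rfl, h⟩ | ⟨i, hi, -⟩
    · exact ⟨0, 1, fun h0 => absurd h0 h.ne', by simp⟩
    · omega
  | algebraMap c => exact ⟨c, 0, fun _ => rfl, by simp [Algebra.algebraMap_eq_smul_one]⟩
  | add x y _ _ hx hy =>
    obtain ⟨a, b, h, rfl⟩ := hx
    obtain ⟨a', b', h', rfl⟩ := hy
    exact ⟨a + a', b + b', fun h0 => by rw [h h0, h' h0, add_zero], by module⟩
  | mul x y _ _ hx hy =>
    obtain ⟨a, b, h, rfl⟩ := hx
    obtain ⟨a', b', h', rfl⟩ := hy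
    refine ⟨a * a', a * b' + b * a' + b * b', fun h0 => by simp [h h0, h' h0], ?_⟩
    have he : (b * b') • (incl K n (idem n) * incl K n (idem n)) =
        (b * b') • incl K n (idem n) := by
      rcases Nat.eq_zero_or_pos n with h0 | h0
      · rw [h h0, zero_mul, zero_smul, zero_smul]
      · rw [← map_mul, idem_mul_idem h0]
    simp only [add_mul, mul_add, smul_mul_smul_comm, one_mul, mul_one, he]
    module

theorem centerIsSymmetricInJM_of_le_one (hn : n ≤ 1) : CenterIsSymmetricInJM K n := by
  have hcomm : ∀ x y : BaseChange K n, Commute x y := by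
    intro x y
    obtain ⟨a, b, -, rfl⟩ := exists_eq_smul_add K hn x
    obtain ⟨a', b', -, rfl⟩ := exists_eq_smul_add K hn y
    change _ * _ = _ * _
    simp only [add_mul, mul_add, smul_mul_smul_comm, one_mul, mul_one, mul_comm b', mul_comm a']
    abel
  refine ⟨fun i j => hcomm _ _, ?_⟩
  ext z
  refine ⟨fun _ => ?_, fun _ => ?_⟩
  · obtain ⟨a, b, hb, rfl⟩ := exists_eq_smul_add K hn z
    rcases Nat.eq_zero_or_pos n with h0 | h0
    · refine ⟨MvPolynomial.monomial 0 a, isSymmetric_of_le_one hn _, ?_⟩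
      rw [evalTuple_monomial, hb h0, zero_smul, add_zero]
      subst h0
      simp
    · obtain rfl : n = 1 := by omega
      refine ⟨MvPolynomial.monomial 0 a + MvPolynomial.monomial (Finsupp.single 0 1) b,
        isSymmetric_of_le_one hn _, ?_⟩
      rw [evalTuple_add, evalTuple_monomial, evalTuple_monomial]
      simp [jm, jucysMurphy_one, incl_apply]
  · exact Subalgebra.mem_center_iff.mpr fun x => hcomm x z

theorem centerIsSymmetricInJM_generic (n : ℕ) : CenterIsSymmetricInJM GenericField n := by
  rcases Nat.lt_or_ge n 2 with hn | hn
  · exact centerIsSymmetricInJM_of_le_one _ (by omega)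
  · refine centerIsSymmetricInJM_of_two_le _ hn fun i hi _ h => ?_
    rw [← map_pow, ← map_one (algebraMap ℂ[T;T⁻¹] GenericField)] at h
    have h2 := IsFractionRing.injective ℂ[T;T⁻¹] GenericField h
    rw [LaurentPolynomial.T_pow, mul_one] at h2
    have h3 := congrArg (evalAt (Units.mk0 (2 : ℂ) two_ne_zero)) h2
    rw [evalAt_T, map_one, Units.val_mk0, zpow_natCast] at h3
    have h4 : (2 : ℕ) ^ i = 1 := by exact_mod_cast h3
    have h5 := Nat.one_lt_two_pow (n := i) (by omega)
    omega

end Small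

/-! ### The Poincaré polynomial of the symmetric group -/

section Poincare

/-- The permutation of `n + 1` points that sends the first point to `p` and acts on the others,
up to the order preserving relabelling, by `e`. -/
def permSucc {n : ℕ} (p : Fin (n + 1)) (e : Equiv.Perm (Fin n)) : Equiv.Perm (Fin (n + 1)) :=
  (Equiv.Perm.decomposeFin.symm (0, e)).trans p.cycleRange.symm

theorem permSucc_zero {n : ℕ} (p : Fin (n + 1)) (e : Equiv.Perm (Fin n)) :
    permSucc p e 0 = p := by
  simp [permSucc]

theorem permSucc_succ {n : ℕ} (p : Fin (n + 1)) (e : Equiv.Perm (Fin n)) (k : Fin n) :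
    permSucc p e k.succ = p.succAbove (e k) := by
  simp [permSucc]

theorem permSucc_bijective (n : ℕ) :
    Function.Bijective fun x : Fin (n + 1) × Equiv.Perm (Fin n) => permSucc x.1 x.2 := by
  rw [Fintype.bijective_iff_injective_and_card]
  constructor
  · rintro ⟨p, e⟩ ⟨p', e'⟩ h
    have h' : permSucc p e = permSucc p' e' := h
    have hp : p = p' := by rw [← permSucc_zero p e, h', permSucc_zero]
    subst hp
    refine Prod.ext rfl (Equiv.ext fun k => ?_)
    apply p.succAbove_right_injective
    rw [← permSucc_succ, h', permSucc_succ]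
  · rw [Fintype.card_prod, Fintype.card_perm, Fintype.card_perm, Fintype.card_fin,
      Fintype.card_fin, Nat.factorial_succ]

theorem inversions_permSucc {n : ℕ} (p : Fin (n + 1)) (e : Equiv.Perm (Fin n)) :
    inversions (permSucc p e) = p.val + inversions e := by
  unfold inversions
  rw [Fin.sum_univ_succ]
  congr 1
  · rw [Fin.sum_univ_succ]
    simp only [permSucc_zero, permSucc_succ, lt_self_iff_false, false_and, if_false,
      zero_add, Fin.succ_pos, true_and]
    rw [Equiv.sum_comp e fun k => if p.succAbove k < p then 1 else 0]
    simp only [Fin.succAbove_lt_iff_castSucc_lt]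
    rw [Finset.sum_boole]
    have := Fin.card_filter_val_lt (n := n) (m := p.val)
    simp only [Fin.lt_def, Fin.val_castSucc]
    rw [this]
    simp
    omega
  · refine Finset.sum_congr rfl fun a _ => ?_
    rw [Fin.sum_univ_succ]
    simp [permSucc_succ]

/-- The generating function of the inversion number is the product of the `q`-integers. -/
theorem sum_pow_inversions {A : Type*} [CommSemiring A] (q : A) (n : ℕ) :
    ∑ w : Equiv.Perm (Fin n), q ^ inversions w =
      ∏ k ∈ Finset.range n, ∑ j ∈ Finset.range (k + 1), q ^ j := by
  induction n with
  | zero => simp [inversions]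
  | succ n ih =>
    rw [← (permSucc_bijective n).sum_comp, Fintype.sum_prod_type, Finset.prod_range_succ, ← ih,
      mul_comm, ← Fin.sum_univ_eq_sum_range (fun j => q ^ j) (n + 1), Finset.sum_mul_sum]
    simp only [inversions_permSucc, pow_add]

end Poincare

/-! ### The element spanning the trivial left ideal -/

section Trivial

open LaurentPolynomial (T)

variable {n : ℕ}

/-- The families of characteristic functions of the triples with flags in relative position `w`. -/
def posFam (w : Equiv.Perm (Fin n)) : ∀ r : PrimePower, ConvAlg n r := subFam w Set.univ

theorem posFam_one : posFam (1 : Equiv.Perm (Fin n)) = levelFam (Fin.last n) := by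
  rw [posFam, ← subFam_one]
  congr 1
  ext k
  simp

theorem inSub_univ {F : Type} [Field F] {w : Equiv.Perm (Fin n)} {X Y : CompleteFlag n F}
    {v : Fin n → F} (h : InSub w Set.univ X Y v) (u : Fin n → F) : InSub w Set.univ X Y u := by
  obtain ⟨b, hX, hY, -⟩ := h
  refine ⟨b, hX, hY, ?_⟩
  rw [Set.image_univ, b.span_eq]
  exact Submodule.mem_top

theorem levelFun_mul_posFun {F : Type} [Field F] [Fintype F] (k : Fin (n + 1))
    (w : Equiv.Perm (Fin n)) : levelFun F k * subFun F w Set.univ =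
      ((Fintype.card F : ℂ) ^ k.val) • subFun F w Set.univ := by
  classical
  ext X Y v
  rw [levelFun_mul_apply, FlagFun.smul_apply, ← sum_mem_space X k, Finset.sum_mul]
  refine Finset.sum_congr rfl fun u _ => ?_
  have h : InSub w Set.univ X Y (v - u) ↔ InSub w Set.univ X Y v :=
    ⟨fun h => inSub_univ h _, fun h => inSub_univ h _⟩
  simp only [subFun_apply]
  rw [if_congr h rfl rfl]
  split_ifs <;> simp

theorem transpose_levelFun {F : Type} [Field F] (k : Fin (n + 1)) :
    transpose (levelFun F k) = levelFun F k := by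
  classical
  ext X Y v
  change levelFun F k Y X v = _
  rw [levelFun_apply, levelFun_apply]
  refine if_congr ⟨?_, ?_⟩ rfl rfl
  · rintro ⟨rfl, h⟩
    exact ⟨rfl, h⟩
  · rintro ⟨rfl, h⟩
    exact ⟨rfl, h⟩

theorem posFun_mul_levelFun {F : Type} [Field F] [Fintype F] (k : Fin (n + 1))
    (w : Equiv.Perm (Fin n)) : subFun F w Set.univ * levelFun F k =
      ((Fintype.card F : ℂ) ^ k.val) • subFun F w Set.univ := by
  have h := congrArg transpose (levelFun_mul_posFun (F := F) k w⁻¹)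
  rw [transpose_mul, transpose_levelFun, transpose_subFun, inv_inv] at h
  rw [Set.preimage_univ] at h
  rw [h]
  change ((Fintype.card F : ℂ) ^ k.val) • transpose (subFun F w⁻¹ Set.univ) = _
  rw [transpose_subFun, inv_inv, Set.preimage_univ]

theorem levelFam_mul_posFam (k : Fin (n + 1)) (w : Equiv.Perm (Fin n)) :
    levelFam k * posFam w = (T (k.val : ℤ) : ℂ[T;T⁻¹]) • posFam w := by
  funext r
  rw [smul_family_apply, evalAt_T, zpow_natCast, ← card_field]
  exact levelFun_mul_posFun k w

theorem posFam_mul_levelFam (k : Fin (n + 1)) (w : Equiv.Perm (Fin n)) :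
    posFam w * levelFam k = (T (k.val : ℤ) : ℂ[T;T⁻¹]) • posFam w := by
  funext r
  rw [smul_family_apply, evalAt_T, zpow_natCast, ← card_field]
  exact posFun_mul_levelFun k w

theorem heckeFam_mul_posFam {i : ℕ} (hi : i + 1 < n) {w : Equiv.Perm (Fin n)}
    (hw : w⁻¹ ⟨i, by omega⟩ < w⁻¹ ⟨i + 1, hi⟩) :
    heckeFam hi * posFam w = posFam (sw n hi * w) :=
  heckeFam_mul_subFam' hi hw fun _ => Set.mem_univ _

theorem heckeFam_mul_posFam_sw {i : ℕ} (hi : i + 1 < n) {w : Equiv.Perm (Fin n)}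
    (hw : w⁻¹ ⟨i, by omega⟩ < w⁻¹ ⟨i + 1, hi⟩) :
    heckeFam hi * posFam (sw n hi * w) =
      (T 1 - 1 : ℂ[T;T⁻¹]) • posFam (sw n hi * w) + (T 1 : ℂ[T;T⁻¹]) • posFam w := by
  rw [← heckeFam_mul_posFam hi hw, ← mul_assoc, heckeFam_quad, add_mul, smul_mul_assoc,
    smul_mul_assoc, one_mul]

theorem ascent_or_sw (w : Equiv.Perm (Fin n)) {i : ℕ} (hi : i + 1 < n) :
    w⁻¹ ⟨i, by omega⟩ < w⁻¹ ⟨i + 1, hi⟩ ∨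
      (sw n hi * w)⁻¹ ⟨i, by omega⟩ < (sw n hi * w)⁻¹ ⟨i + 1, hi⟩ := by
  rw [mul_inv_rev, sw_inv, Equiv.Perm.mul_apply, Equiv.Perm.mul_apply, sw_left, sw_right]
  exact lt_or_gt_of_ne fun e => by simpa using w⁻¹.injective e

/-- The sum of all `posFam w`; by the Bruhat decomposition, the family of constant functions `1`. -/
def sumFam (n : ℕ) : ∀ r : PrimePower, ConvAlg n r := ∑ w : Equiv.Perm (Fin n), posFam w

theorem heckeFam_mul_sumFam {i : ℕ} (hi : i + 1 < n) :
    heckeFam hi * sumFam n = (T 1 : ℂ[T;T⁻¹]) • sumFam n := by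
  -- On the span of `posFam w` and `posFam (s_i w)` the sum of the two is an eigenvector, and these
  -- sums add up to twice `sumFam n`.
  have key : ∀ w : Equiv.Perm (Fin n), w⁻¹ ⟨i, by omega⟩ < w⁻¹ ⟨i + 1, hi⟩ →
      heckeFam hi * posFam w + heckeFam hi * posFam (sw n hi * w) =
        (T 1 : ℂ[T;T⁻¹]) • (posFam w + posFam (sw n hi * w)) := by
    intro w hw
    rw [heckeFam_mul_posFam_sw hi hw, heckeFam_mul_posFam hi hw]
    module
  have key2 : ∀ w : Equiv.Perm (Fin n),
      heckeFam hi * posFam w + heckeFam hi * posFam (sw n hi * w) =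
        (T 1 : ℂ[T;T⁻¹]) • (posFam w + posFam (sw n hi * w)) := by
    intro w
    rcases ascent_or_sw w hi with hw | hw
    · exact key w hw
    · have := key _ hw
      rw [← mul_assoc, sw_mul_self, one_mul] at this
      rw [add_comm, this, add_comm]
  have hs : ∑ w : Equiv.Perm (Fin n), posFam (sw n hi * w) = sumFam n :=
    Equiv.sum_comp (Equiv.mulLeft (sw n hi)) posFam
  have h2 := Finset.sum_congr rfl fun w (_ : w ∈ Finset.univ) => key2 w
  rw [Finset.sum_add_distrib, ← Finset.mul_sum, ← Finset.mul_sum, ← Finset.smul_sum,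
    Finset.sum_add_distrib, hs] at h2
  change heckeFam hi * sumFam n + heckeFam hi * sumFam n =
    (T 1 : ℂ[T;T⁻¹]) • (sumFam n + sumFam n) at h2
  have half : ∀ x : ∀ r : PrimePower, ConvAlg n r,
      (LaurentPolynomial.C (2⁻¹ : ℂ)) • (x + x) = x := by
    intro x
    rw [← two_smul ℂ[T;T⁻¹] x, smul_smul, show (2 : ℂ[T;T⁻¹]) = LaurentPolynomial.C (2 : ℂ) from
      (map_ofNat LaurentPolynomial.C 2).symm, ← map_mul, inv_mul_cancel₀ two_ne_zero, map_one,
      one_smul]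
  rw [← half (heckeFam hi * sumFam n), h2, smul_comm, half]

theorem levelFam_mul_sumFam (k : Fin (n + 1)) :
    levelFam k * sumFam n = (T (k.val : ℤ) : ℂ[T;T⁻¹]) • sumFam n := by
  rw [sumFam, Finset.mul_sum, Finset.smul_sum]
  exact Finset.sum_congr rfl fun w _ => levelFam_mul_posFam k w

/-- A product of `ℓ(w)` Hecke generators, each acting by `q`, and of the full average turns
`sumFam n` into `q ^ n q ^ ℓ(w)` times itself. -/
theorem posFam_mul_sumFam (N : ℕ) (w : Equiv.Perm (Fin n)) (hN : inversions w = N) :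
    posFam w * sumFam n = (T (n : ℤ) * T 1 ^ N : ℂ[T;T⁻¹]) • sumFam n := by
  induction N using Nat.strong_induction_on generalizing w with
  | _ N ih =>
  by_cases hl : ∃ (i : ℕ) (hi : i + 1 < n), w⁻¹ ⟨i + 1, hi⟩ < w⁻¹ ⟨i, by omega⟩
  · obtain ⟨i, hi, hw⟩ := hl
    have hinv := inversions_sw_mul hi hw
    have h := heckeFam_mul_subFam hi hw (I := Set.univ) fun _ => Set.mem_univ _
    rw [Set.preimage_univ] at h
    change heckeFam hi * posFam (sw n hi * w) = posFam w at h
    rw [← h, mul_assoc, ih _ (by omega) _ rfl, mul_smul_comm, heckeFam_mul_sumFam, smul_smul,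
      ← hN, hinv, pow_succ, mul_assoc]
  · push Not at hl
    have hw : w⁻¹ = 1 := by
      refine eq_one_of_forall_lt fun i hi => lt_of_le_of_ne (hl i hi) fun e => ?_
      simpa using w⁻¹.injective e
    have hw1 : w = 1 := inv_eq_one.mp hw
    subst hw1
    have h0 : N = 0 := by
      rw [← hN]
      refine Finset.sum_eq_zero fun a _ => Finset.sum_eq_zero fun b _ => ?_
      rw [if_neg]
      rintro ⟨h1, h2⟩
      exact lt_asymm h1 h2
    rw [posFam_one, levelFam_mul_sumFam, h0, pow_zero, mul_one, Fin.val_last]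

theorem sumFam_mul_sumFam : sumFam n * sumFam n =
    (T (n : ℤ) * ∏ k ∈ Finset.range n, ∑ j ∈ Finset.range (k + 1), T 1 ^ j : ℂ[T;T⁻¹]) •
      sumFam n := by
  nth_rw 1 [sumFam]
  rw [Finset.sum_mul, ← sum_pow_inversions, Finset.mul_sum, Finset.sum_smul]
  exact Finset.sum_congr rfl fun w _ => posFam_mul_sumFam _ w rfl

theorem heckeFam_mem {i : ℕ} (hi : i + 1 < n) : heckeFam hi ∈ integralAlgebra n :=
  Algebra.subset_adjoin ⟨_, _, rfl⟩

theorem levelFam_one_mem (hn : 0 < n) :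
    levelFam (⟨1, by omega⟩ : Fin (n + 1)) ∈ integralAlgebra n := by
  rw [← heckeZero_add_one hn]
  exact Subalgebra.add_mem _ (Algebra.subset_adjoin ⟨_, _, rfl⟩) (Subalgebra.one_mem _)

theorem sumFam_mem : sumFam n ∈ integralAlgebra n :=
  Subalgebra.sum_mem _ fun w _ =>
    subFam_mem (fun _ hi => heckeFam_mem hi) levelFam_one_mem _ w _ rfl
      fun _ _ _ _ _ => Set.mem_univ _

/-- The family `sumFam n` as an element of `R n`. -/
def sumElt (n : ℕ) : R n := ⟨sumFam n, sumFam_mem⟩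

/-! ### The trivial left ideal survives every specialization -/

/-- A Laurent polynomial is determined by its values at the prime powers. -/
theorem laurent_eq_zero {f : ℂ[T;T⁻¹]} (h : ∀ r : PrimePower, evalAt r.card f = 0) : f = 0 := by
  obtain ⟨N, p, hp⟩ := f.exists_T_pow
  have hroot : ∀ k : ℕ, p.eval ((2 : ℂ) ^ (k + 1)) = 0 := by
    intro k
    have h1 := congrArg (evalAt (PrimePower.card ⟨2, k + 1, Nat.prime_two, Nat.succ_pos k⟩)) hp
    rw [map_mul, h, zero_mul] at h1
    have h2 : ∀ (z : ℂˣ) (p : Polynomial ℂ),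
        evalAt z (Polynomial.toLaurent p) = p.eval (z : ℂ) := by
      intro z p
      rw [evalAt, LaurentPolynomial.eval₂_toLaurent]
      simp
    rw [h2] at h1
    simpa [PrimePower.card] using h1
  have hp0 : p = 0 := by
    refine Polynomial.eq_zero_of_infinite_isRoot p (Set.Infinite.mono ?_
      (Set.infinite_range_of_injective (f := fun k : ℕ => (2 : ℂ) ^ (k + 1)) ?_))
    · rintro _ ⟨k, rfl⟩
      exact hroot k
    · intro a b hab
      have : (2 : ℕ) ^ (a + 1) = 2 ^ (b + 1) := by
        have h3 : (2 : ℂ) ^ (a + 1) = 2 ^ (b + 1) := hab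
        exact_mod_cast h3
      simpa using Nat.pow_right_injective le_rfl this
  rw [hp0, map_zero] at hp
  exact (LaurentPolynomial.isUnit_T N).mul_left_eq_zero.mp hp.symm

theorem inSub_self_iff {F : Type} [Field F] (w : Equiv.Perm (Fin n)) (X : CompleteFlag n F) :
    InSub w Set.univ X X 0 ↔ w = 1 := by
  constructor
  · rintro ⟨b, hX, hY, -⟩
    ext k
    have h1 := hX (w k)
    have h2 := hY k
    rw [Function.comp_apply] at h2
    rcases lt_trichotomy (w k).val k.val with h | h | h
    · exact absurd (X.space_mono (by simpa using h) h1.1) h2.2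
    · exact h
    · exact absurd (X.space_mono (by simpa using h) h2.1) h1.2
  · rintro rfl
    obtain ⟨b, hb⟩ := X.exists_adapted
    obtain ⟨B, rfl⟩ := hb.exists_basis
    exact ⟨B, hb, by simpa using hb, Submodule.zero_mem _⟩

/-- The span of the `posFam w` is stable under left multiplication by `R n`. -/
theorem mul_mem_span_posFam {x y : ∀ r : PrimePower, ConvAlg n r} (hx : x ∈ integralAlgebra n)
    (hy : y ∈ Submodule.span ℂ[T;T⁻¹] (Set.range (posFam (n := n)))) :
    x * y ∈ Submodule.span ℂ[T;T⁻¹] (Set.range (posFam (n := n))) := by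
  set N := Submodule.span ℂ[T;T⁻¹] (Set.range (posFam (n := n)))
  let S : Subalgebra ℂ[T;T⁻¹] (∀ r : PrimePower, ConvAlg n r) :=
    { carrier := {x | ∀ y ∈ N, x * y ∈ N}
      mul_mem' := fun {a b} ha hb y hy => by rw [mul_assoc]; exact ha _ (hb _ hy)
      add_mem' := fun {a b} ha hb y hy => by rw [add_mul]; exact N.add_mem (ha _ hy) (hb _ hy)
      algebraMap_mem' := fun c y hy => by
        rw [← Algebra.smul_def]
        exact N.smul_mem c hy }
  have hmem : ∀ w, posFam w ∈ N := fun w => Submodule.subset_span ⟨w, rfl⟩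
  have hgen : ∀ x : ∀ r : PrimePower, ConvAlg n r, (∀ w, x * posFam w ∈ N) → x ∈ S := by
    intro x hx y hy
    induction hy using Submodule.span_induction with
    | mem y hy =>
      obtain ⟨w, rfl⟩ := hy
      exact hx w
    | zero => rw [mul_zero]; exact N.zero_mem
    | add a b _ _ ha hb => rw [mul_add]; exact N.add_mem ha hb
    | smul c a _ ha => rw [mul_smul_comm]; exact N.smul_mem c ha
  have hle : integralAlgebra n ≤ S := by
    refine integralAlgebra_le (fun i hi => hgen _ fun w => ?_) fun hn => hgen _ fun w => ?_
    · rcases ascent_or_sw w hi with hw | hw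
      · rw [heckeFam_mul_posFam hi hw]
        exact hmem _
      · have := heckeFam_mul_posFam_sw hi hw
        rw [← mul_assoc, sw_mul_self, one_mul] at this
        rw [this]
        exact N.add_mem (N.smul_mem _ (hmem _)) (N.smul_mem _ (hmem _))
    · rw [levelFam_mul_posFam]
      exact N.smul_mem _ (hmem _)
  exact hle hx y hy

/-- The value at `(X, X, 0)` of the member over the field with `r` elements of a family. -/
def diagonalValue (r : PrimePower) (X : CompleteFlag n r.field) :
    (∀ r : PrimePower, ConvAlg n r) →+ ℂ where
  toFun y := (show FlagFun n r.field from y r) X X 0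
  map_zero' := rfl
  map_add' _ _ := rfl

theorem diagonalValue_smul (r : PrimePower) (X : CompleteFlag n r.field) (c : ℂ[T;T⁻¹])
    (y : ∀ r : PrimePower, ConvAlg n r) :
    diagonalValue r X (c • y) = evalAt r.card c * diagonalValue r X y := by
  change (show FlagFun n r.field from (c • y) r) X X 0 = _
  rw [smul_family_apply]
  rfl

theorem diagonalValue_posFam [DecidableEq (Equiv.Perm (Fin n))] (r : PrimePower)
    (X : CompleteFlag n r.field) (w : Equiv.Perm (Fin n)) :
    diagonalValue r X (posFam w) = if w = 1 then 1 else 0 := by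
  classical
  change subFun r.field w Set.univ X X 0 = _
  rw [subFun_apply]
  exact if_congr (inSub_self_iff w X) rfl rfl

theorem exists_diagonalValue_eq {y : ∀ r : PrimePower, ConvAlg n r}
    (hy : y ∈ Submodule.span ℂ[T;T⁻¹] (Set.range (posFam (n := n)))) :
    ∃ c : ℂ[T;T⁻¹], ∀ (r : PrimePower) (X : CompleteFlag n r.field),
      diagonalValue r X y = evalAt r.card c := by
  classical
  induction hy using Submodule.span_induction with
  | mem y hy =>
    obtain ⟨w, rfl⟩ := hy
    refine ⟨if w = 1 then 1 else 0, fun r X => ?_⟩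
    rw [diagonalValue_posFam]
    split_ifs <;> simp
  | zero => exact ⟨0, fun r X => by rw [map_zero, map_zero]⟩
  | add a b _ _ ha hb =>
    obtain ⟨c, hc⟩ := ha
    obtain ⟨d, hd⟩ := hb
    exact ⟨c + d, fun r X => by rw [map_add, map_add, ← hc r X, ← hd r X]⟩
  | smul s a _ ha =>
    obtain ⟨c, hc⟩ := ha
    exact ⟨s * c, fun r X => by rw [map_mul, ← hc r X, diagonalValue_smul]⟩

/-- The functional takes `x` to the value at `(X, X, 0)`, a Laurent polynomial in the cardinality
of the field, of the product of `x` with the family of the triples `(X, X, v)`. -/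
theorem exists_functional (n : ℕ) : ∃ φ : R n →ₗ[ℂ[T;T⁻¹]] ℂ[T;T⁻¹], φ (sumElt n) = T (n : ℤ) := by
  classical
  have h1 : ∀ x : R n, ∃ c : ℂ[T;T⁻¹], ∀ (r : PrimePower) (X : CompleteFlag n r.field),
      diagonalValue r X (x.val * posFam 1) = evalAt r.card c := fun x =>
    exists_diagonalValue_eq (mul_mem_span_posFam x.2 (Submodule.subset_span ⟨1, rfl⟩))
  choose φ hφ using h1
  have huniq : ∀ (c d : ℂ[T;T⁻¹]), (∀ (r : PrimePower) (_ : CompleteFlag n r.field),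
      evalAt r.card c = evalAt r.card d) → c = d := by
    intro c d h
    refine sub_eq_zero.mp (laurent_eq_zero fun r => ?_)
    rw [map_sub, h r (flagOfBasis (Pi.basisFun r.field (Fin n))), sub_self]
  refine ⟨{ toFun := φ, map_add' := fun x y => ?_, map_smul' := fun s x => ?_ }, ?_⟩
  · refine huniq _ _ fun r X => ?_
    rw [map_add, ← hφ x r X, ← hφ y r X, ← hφ (x + y) r X, ← map_add, ← add_mul]
    rfl
  · refine huniq _ _ fun r X => ?_
    rw [RingHom.id_apply, smul_eq_mul, map_mul, ← hφ x r X, ← hφ (s • x) r X,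
      ← diagonalValue_smul, ← smul_mul_assoc]
    rfl
  · refine huniq _ _ fun r X => ?_
    change evalAt r.card (φ (sumElt n)) = _
    have e : (sumElt n).val * posFam 1 = (T (n : ℤ) : ℂ[T;T⁻¹]) • sumFam n := by
      change sumFam n * posFam 1 = _
      rw [posFam_one, sumFam, Finset.sum_mul, Finset.smul_sum]
      refine Finset.sum_congr rfl fun w _ => ?_
      rw [posFam_mul_levelFam, Fin.val_last]
    rw [← hφ (sumElt n) r X, e, diagonalValue_smul, sumFam, map_sum]
    simp [diagonalValue_posFam]

variable (K : Type) [Field K] [Algebra ℂ[T;T⁻¹] K]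

theorem incl_sumElt_ne_zero : incl K n (sumElt n) ≠ 0 := by
  obtain ⟨φ, hφ⟩ := exists_functional n
  intro h
  have h2 := congrArg (fun z => TensorProduct.rid ℂ[T;T⁻¹] K (φ.lTensor K z)) h
  simp only [incl_apply, LinearMap.lTensor_tmul, TensorProduct.rid_tmul, map_zero, hφ] at h2
  rw [Algebra.smul_def, mul_one] at h2
  exact ((LaurentPolynomial.isUnit_T (n : ℤ)).map (algebraMap ℂ[T;T⁻¹] K)).ne_zero h2

/-- `sumElt n` spans a left ideal. -/
theorem exists_mul_sumElt_eq_smul (a : BaseChange K n) :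
    ∃ c : K, a * incl K n (sumElt n) = c • incl K n (sumElt n) := by
  have ha : a ∈ Algebra.adjoin K ({x | x = incl K n (idem n) ∧ 0 < n} ∪
      {x | ∃ i, i + 1 < n ∧ x = incl K n (heckeGen n (i + 1))}) := by
    rw [adjoin_baseChange]
    exact Algebra.mem_top
  induction ha using Algebra.adjoin_induction with
  | mem x hx =>
    rcases hx with ⟨rfl, hn⟩ | ⟨i, hi, rfl⟩
    · refine ⟨1, ?_⟩
      rw [← map_mul, one_smul]
      congr 1
      apply Subtype.ext
      change (idem n).val * sumFam n = sumFam n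
      rw [idem_val hn, smul_mul_assoc, levelFam_mul_sumFam]
      exact smul_T_cancel' _
    · refine ⟨algebraMap ℂ[T;T⁻¹] K (T 1), ?_⟩
      rw [← map_mul, ← incl_smul]
      congr 1
      apply Subtype.ext
      change (heckeGen n (i + 1)).val * sumFam n = (T 1 : ℂ[T;T⁻¹]) • sumFam n
      rw [heckeGen_val hi, heckeFam_mul_sumFam]
  | algebraMap c => exact ⟨c, (Algebra.smul_def _ _).symm⟩
  | add x y _ _ hx hy =>
    obtain ⟨c, hc⟩ := hx
    obtain ⟨d, hd⟩ := hy
    exact ⟨c + d, by rw [add_mul, hc, hd, add_smul]⟩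
  | mul x y _ _ hx hy =>
    obtain ⟨c, hc⟩ := hx
    obtain ⟨d, hd⟩ := hy
    exact ⟨d * c, by rw [mul_assoc, hd, mul_smul_comm, hc, smul_smul]⟩

theorem sumElt_sq_eq_zero {i : ℕ} (hi : 1 ≤ i) (hin : i ≤ n)
    (h1 : algebraMap ℂ[T;T⁻¹] K (T 1) ≠ 1) (h : algebraMap ℂ[T;T⁻¹] K (T 1) ^ i = 1) :
    incl K n (sumElt n) * incl K n (sumElt n) = 0 := by
  have hs : sumElt n * sumElt n =
      (T (n : ℤ) * ∏ k ∈ Finset.range n, ∑ j ∈ Finset.range (k + 1), T 1 ^ j : ℂ[T;T⁻¹]) •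
        sumElt n := Subtype.ext sumFam_mul_sumFam
  rw [← map_mul, hs, incl_smul, map_mul, map_prod]
  have h0 : algebraMap ℂ[T;T⁻¹] K (∑ j ∈ Finset.range (i - 1 + 1), T 1 ^ j) = 0 := by
    rw [map_sum, Nat.sub_add_cancel hi]
    simp only [map_pow]
    have := geom_sum_mul (algebraMap ℂ[T;T⁻¹] K (T 1)) i
    rw [h, sub_self] at this
    exact (mul_eq_zero.mp this).resolve_right (sub_ne_zero.mpr h1)
  rw [Finset.prod_eq_zero (Finset.mem_range.mpr (by omega : i - 1 < n)) h0, mul_zero, zero_smul]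

/-- If `q ≠ 1` is a root of unity of order at most `n`, then `sumElt n` spans a nonzero left ideal
with square zero, which does not exist in a semisimple ring, where left ideals are generated by
idempotents. -/
theorem pow_ne_one_of_isSemisimpleRing [IsSemisimpleRing (BaseChange K n)]
    (h1 : algebraMap ℂ[T;T⁻¹] K (T 1) ≠ 1) {i : ℕ} (hi : 1 ≤ i) (hin : i ≤ n) :
    algebraMap ℂ[T;T⁻¹] K (T 1) ^ i ≠ 1 := by
  intro h
  have hsq := sumElt_sq_eq_zero K hi hin h1 h
  obtain ⟨ε, hε, hspan⟩ := IsSemisimpleRing.ideal_eq_span_idempotent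
    (Ideal.span {incl K n (sumElt n)})
  have hmem : ε ∈ Ideal.span {incl K n (sumElt n)} := by
    rw [hspan]
    exact Ideal.mem_span_singleton_self ε
  obtain ⟨a, ha⟩ := Ideal.mem_span_singleton'.mp hmem
  obtain ⟨c, hc⟩ := exists_mul_sumElt_eq_smul K a
  have hε0 : ε = 0 := by
    rw [← hε.eq, ← ha, hc, smul_mul_smul_comm, hsq, smul_zero]
  have hJ : incl K n (sumElt n) ∈ Ideal.span {incl K n (sumElt n)} :=
    Ideal.mem_span_singleton_self _
  rw [hspan, hε0, Ideal.span_singleton_eq_bot.mpr rfl] at hJ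
  exact incl_sumElt_ne_zero K ((Submodule.mem_bot _).mp hJ)

theorem centerIsSymmetricInJM_specialization (n : ℕ) (q : ℂˣ) (hq : q = 1 → n ≤ 1)
    (hss : IsSemisimpleRing (BaseChange (SpecField q) n)) :
    CenterIsSymmetricInJM (SpecField q) n := by
  rcases Nat.lt_or_ge n 2 with hn | hn
  · exact centerIsSymmetricInJM_of_le_one _ (by omega)
  · refine centerIsSymmetricInJM_of_two_le _ hn fun i hi hin => ?_
    refine pow_ne_one_of_isSemisimpleRing (SpecField q) (fun h => ?_) hi hin
    have h2 : evalAt q (T 1) = (1 : ℂ) := h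
    rw [evalAt_T, zpow_one] at h2
    have := hq (Units.ext h2)
    omega

end Trivial

end Mirabolic

end

theorem mainTheorem2 (n : ℕ) :
    Mirabolic.CenterIsSymmetricInJM Mirabolic.GenericField n ∧
      ∀ q : ℂˣ, (q = 1 → n ≤ 1) →
        IsSemisimpleRing (Mirabolic.BaseChange (Mirabolic.SpecField q) n) →
        Mirabolic.CenterIsSymmetricInJM (Mirabolic.SpecField q) n :=
  ⟨Mirabolic.centerIsSymmetricInJM_generic n,
    Mirabolic.centerIsSymmetricInJM_specialization n⟩
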